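/- Let $\mathcal{G}\rightrightarrows M$ be a proper Lie groupoid: $M$ is a (finite-dimensional, Hausdorff, second countable) smooth manifold, the source and target $s,t$ are smooth submersions, the manifold of arrows $\mathcal{G}$ is Hausdorff and $(s,t):\mathcal{G}\to M\times M$ is a proper map. Let $A=\mathrm{Ker}(ds)|_M$ be its Lie algebroid with anchor $\rho=dt|_A:A\to TM$, let $\bar m(p,q)=pq^{-1}$ be the division map (defined when $s(p)=s(q)$), and let $\mathcal{G}^{(k)}$ be the manifold of strings $(g_1,\dots,g_k)$ with $s(g_i)=t(g_{i+1})$. The deformation complex $(C^*_{\mathrm{def}}(\mathcal{G}),\delta)$ is defined by $C^0_{\mathrm{def}}(\mathcal{G})=\Gamma(A)$ and, for $k\ge 1$, by letting $C^k_{\mathrm{def}}(\mathcal{G})$ be the space of smooth maps $c:\mathcal{G}^{(k)}\to T\mathcal{G}$ with $c(g_1,\dots,g_k)\in T_{g_1}\mathcal{G}$ such that $ds(c(g_1,\dots,g_k))$ does not depend on $g_1$ (for $k=1$: depends only on $s(g_1)$), with $$(\delta c)(g_1,\dots,g_{k+1})=-d\bar m\big(c(g_1g_2,g_3,\dots,g_{k+1}),c(g_2,\dots,g_{k+1})\big)+\sum_{i=2}^{k}(-1)^i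 c(g_1,\dots,g_ig_{i+1},\dots,g_{k+1})+(-1)^{k+1}c(g_1,\dots,g_k)$$ and, for $\alpha\in\Gamma(A)$, $\delta(\alpha)(g)=r_g(\alpha_{t(g)})+l_g(di(\alpha_{s(g)}))$, where $i$ is the inversion and $r_g$, $l_g$ are the differentials of right and left translation by $g$. Its cohomology is denoted $H^*_{\mathrm{def}}(\mathcal{G})$. Let $\Gamma(\mathfrak{i})^{\mathrm{inv}}$ be the space of $\alpha\in\Gamma(A)$ with $\rho(\alpha)=0$ and $ad_g(\alpha_x)=\alpha_y$ for every arrow $g:x\to y$, where $ad_g$ is the differential at the unit of the conjugation $h\mapsto ghg^{-1}$ between the isotropy groups at $x$ and $y$. Let $\Gamma(\nu)=\mathfrak{X}(M)/\rho(\Gamma(A))$, and let $\Gamma(\nu)^{\mathrm{inv}}\subset\Gamma(\nu)$ be the space of classes $[V]$ of vector fields $V\in\mathfrak{X}(M)$ for which there is a vector field on $\mathcal{G}$ that is both $s$-projectable and $t$-projectable to $V$. Then: 1. $H^0_{\mathrm{def}}(\mathcal{G})\cong\Gamma(\mathfrak{i})^{\mathrm{inv}}$; in fact the two coincide as subspaces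 of $\Gamma(A)$. 2. $H^1_{\mathrm{def}}(\mathcal{G})\cong\Gamma(\nu)^{\mathrm{inv}}$; the isomorphism sends the class of a $1$-cocycle $X$ to the class $[V]$ of the vector field $V$ on $M$ to which $X$ is $s$-projectable. 3. $H^k_{\mathrm{def}}(\mathcal{G})=0$ for all $k\ge 2$. -/

import Mathlib

open scoped Manifold ContDiff

noncomputable section

section General

variable {E H E' H' : Type*} [NormedAddCommGroup E] [NormedSpace ℝ E] [TopologicalSpace H]
  [NormedAddCommGroup E'] [NormedSpace ℝ E'] [TopologicalSpace H']
  {X N : Type*} [TopologicalSpace X] [ChartedSpace H X] [TopologicalSpace N] [ChartedSpace H' N]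

/-- A map `f` defined on a subset `S` of a manifold `X`, with values in a manifold `N`, is smooth
if around each point of `S` it extends to a smooth map on an open subset of `X`. When `S` is an
embedded submanifold of `X` this is smoothness of `f` on the manifold `S`. -/
def SmoothOnSubset (I : ModelWithCorners ℝ E H) (J : ModelWithCorners ℝ E' H') (S : Set X)
    (f : S → N) : Prop :=
  ∀ x : S, ∃ U : Set X, IsOpen U ∧ (x : X) ∈ U ∧
    ∃ F : X → N, ContMDiffOn I J ∞ F U ∧ ∀ y : S, (y : X) ∈ U → F y = f y

/-- The identification of the tangent spaces at two equal points. -/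
def tangentCast (I : ModelWithCorners ℝ E H) {x y : X} (h : x = y) :
    TangentSpace I x →ₗ[ℝ] TangentSpace I y :=
  h ▸ LinearMap.id

end General

section VectorFields

variable (E : Type*) [NormedAddCommGroup E] [NormedSpace ℝ E]
  (X : Type*) [TopologicalSpace X] [ChartedSpace E X] [IsManifold 𝓘(ℝ, E) ∞ X]

/-- The space `𝔛(X)` of smooth vector fields on the manifold `X`. -/
abbrev SmoothVectorField : Type _ :=
  ContMDiffSection 𝓘(ℝ, E) E ∞ (TangentSpace 𝓘(ℝ, E) : X → Type _)

end VectorFields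

section SmoothAlong

variable {E : Type*} [NormedAddCommGroup E] [NormedSpace ℝ E]
  {N : Type*} [TopologicalSpace N] [ChartedSpace E N] [IsManifold 𝓘(ℝ, E) ∞ N]
  {E' H' : Type*} [NormedAddCommGroup E'] [NormedSpace ℝ E'] [TopologicalSpace H']
  {I' : ModelWithCorners ℝ E' H'}
  {X : Type*} [TopologicalSpace X] [ChartedSpace H' X]

theorem ContMDiff.zero_along {b : X → N} (hb : ContMDiff I' 𝓘(ℝ, E) ∞ b) :
    ContMDiff I' 𝓘(ℝ, E).tangent ∞ (fun y => (⟨b y, 0⟩ : TangentBundle 𝓘(ℝ, E) N)) :=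
  (Bundle.contMDiff_zeroSection ℝ (TangentSpace 𝓘(ℝ, E) : N → Type _)).comp hb

theorem SmoothOnSubset.add_smul_along {b : X → N} (hb : ContMDiff I' 𝓘(ℝ, E) ∞ b) {S : Set X}
    {v w : ∀ y : S, TangentSpace 𝓘(ℝ, E) (b y)} (r : ℝ)
    (hv : SmoothOnSubset I' 𝓘(ℝ, E).tangent S
      (fun y => (⟨b y, v y⟩ : TangentBundle 𝓘(ℝ, E) N)))
    (hw : SmoothOnSubset I' 𝓘(ℝ, E).tangent S
      (fun y => (⟨b y, w y⟩ : TangentBundle 𝓘(ℝ, E) N))) :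
    SmoothOnSubset I' 𝓘(ℝ, E).tangent S
      (fun y => (⟨b y, v y + r • w y⟩ : TangentBundle 𝓘(ℝ, E) N)) := by
  intro x
  obtain ⟨U, hU, hxU, F, hF, hFv⟩ := hv x
  obtain ⟨W, hW, hxW, K, hK, hKw⟩ := hw x
  set e := trivializationAt E (TangentSpace 𝓘(ℝ, E) : N → Type _) (b x) with he
  have hxe : b x ∈ e.baseSet := FiberBundle.mem_baseSet_trivializationAt' (b x)
  have hFo : IsOpen (U ∩ F ⁻¹' e.source) :=
    hF.continuousOn.isOpen_inter_preimage hU e.open_source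
  have hKo : IsOpen (W ∩ K ⁻¹' e.source) :=
    hK.continuousOn.isOpen_inter_preimage hW e.open_source
  have hbo : IsOpen (b ⁻¹' e.baseSet) := e.open_baseSet.preimage hb.continuous
  refine ⟨(U ∩ F ⁻¹' e.source) ∩ (W ∩ K ⁻¹' e.source) ∩ b ⁻¹' e.baseSet,
    (hFo.inter hKo).inter hbo, ⟨⟨⟨hxU, ?_⟩, ⟨hxW, ?_⟩⟩, hxe⟩,
    fun y => e.toOpenPartialHomeomorph.symm (b y, (e (F y)).2 + r • (e (K y)).2), ?_, ?_⟩
  · change F x ∈ e.source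
    rw [hFv x hxU, e.mem_source]; exact hxe
  · change K x ∈ e.source
    rw [hKw x hxW, e.mem_source]; exact hxe
  · have h1 : ContMDiffOn I' 𝓘(ℝ, E) ∞ (fun y => (e (F y)).2)
        ((U ∩ F ⁻¹' e.source) ∩ (W ∩ K ⁻¹' e.source) ∩ b ⁻¹' e.baseSet) :=
      ((e.contMDiffOn_iff (fun y hy => hy.1.1.2)).1 (hF.mono fun y hy => hy.1.1.1)).2
    have h2 : ContMDiffOn I' 𝓘(ℝ, E) ∞ (fun y => (e (K y)).2)
        ((U ∩ F ⁻¹' e.source) ∩ (W ∩ K ⁻¹' e.source) ∩ b ⁻¹' e.baseSet) :=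
      ((e.contMDiffOn_iff (fun y hy => hy.1.2.2)).1 (hK.mono fun y hy => hy.1.2.1)).2
    refine (Bundle.Trivialization.contMDiffOn_symm (IB := 𝓘(ℝ, E)) (n := ∞) e).comp
      (hb.contMDiffOn.prodMk (h1.add ((contMDiffOn_const (I' := 𝓘(ℝ, ℝ)) (c := r)).smul h2))) ?_
    intro y hy
    exact (e.mem_target).2 hy.2
  · intro y hy
    have hl := e.linear ℝ hy.2
    have h3 : e (⟨b y, v y + r • w y⟩ : TangentBundle 𝓘(ℝ, E) N)
        = (b y, (e (F y)).2 + r • (e (K y)).2) := by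
      rw [hFv y hy.1.1.1, hKw y hy.1.2.1]
      refine Prod.ext (e.coe_fst ((e.mem_source).2 hy.2)) ?_
      refine (hl.map_add (v y) (r • w y)).trans ?_
      exact congrArg _ (hl.map_smul r (w y))
    change e.toOpenPartialHomeomorph.symm (b y, (e (F y)).2 + r • (e (K y)).2) = _
    rw [← h3]
    exact e.toOpenPartialHomeomorph.left_inv ((e.mem_source).2 hy.2)

theorem ContMDiff.add_smul_along {b : X → N} {v w : ∀ y, TangentSpace 𝓘(ℝ, E) (b y)} (r : ℝ)
    (hv : ContMDiff I' 𝓘(ℝ, E).tangent ∞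
      (fun y => (⟨b y, v y⟩ : TangentBundle 𝓘(ℝ, E) N)))
    (hw : ContMDiff I' 𝓘(ℝ, E).tangent ∞
      (fun y => (⟨b y, w y⟩ : TangentBundle 𝓘(ℝ, E) N))) :
    ContMDiff I' 𝓘(ℝ, E).tangent ∞
      (fun y => (⟨b y, v y + r • w y⟩ : TangentBundle 𝓘(ℝ, E) N)) := by
  have hb : ContMDiff I' 𝓘(ℝ, E) ∞ b :=
    (Bundle.contMDiff_proj (TangentSpace 𝓘(ℝ, E) : N → Type _)).comp hv
  intro x
  obtain ⟨U, hU, hxU, F, hF, hFe⟩ := SmoothOnSubset.add_smul_along hb (S := Set.univ)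
    (v := fun y => v y) (w := fun y => w y) r
    (fun x => ⟨Set.univ, isOpen_univ, trivial, _, hv.contMDiffOn, fun _ _ => rfl⟩)
    (fun x => ⟨Set.univ, isOpen_univ, trivial, _, hw.contMDiffOn, fun _ _ => rfl⟩) ⟨x, trivial⟩
  exact (hF.contMDiffAt (hU.mem_nhds hxU)).congr_of_eventuallyEq
    (Filter.mem_of_superset (hU.mem_nhds hxU) fun y hy => (hFe ⟨y, trivial⟩ hy).symm)

/-- The coordinate projections of a finite power of a manifold are smooth. -/
theorem contMDiff_coord {E : Type*} [NormedAddCommGroup E] [NormedSpace ℝ E]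
    {N : Type*} [TopologicalSpace N] [ChartedSpace E N] [IsManifold 𝓘(ℝ, E) ∞ N] {n : ℕ}
    (i : Fin n) :
    ContMDiff (ModelWithCorners.pi fun _ : Fin n => 𝓘(ℝ, E)) 𝓘(ℝ, E) ∞
      (fun g : Fin n → N => g i) := by
  intro g
  refine ⟨(continuous_apply i).continuousWithinAt, ?_⟩
  have h1 : ContDiffWithinAt ℝ ∞ (fun x : Fin n → E => x i) Set.univ
      (fun j => chartAt E (g j) (g j)) := contDiffWithinAt_univ.2 (contDiff_apply ℝ E i).contDiffAt
  have h2 : ∀ᶠ x : Fin n → E in nhds (fun j => chartAt E (g j) (g j)),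
      x i ∈ (chartAt E (g i)).target :=
    (continuous_apply i).continuousAt.preimage_mem_nhds
      ((chartAt E (g i)).open_target.mem_nhds (mem_chart_target E (g i)))
  refine (h1.congr_of_eventuallyEq ?_ ?_).mono (Set.subset_univ _)
  · rw [nhdsWithin_univ]
    filter_upwards [h2] with x hx
    exact (chartAt E (g i)).right_inv hx
  · exact (chartAt E (g i)).right_inv (mem_chart_target E (g i))

end SmoothAlong

/-- A Lie groupoid `G ⇉ M`, where `M` is modelled on `EM` and the manifold of arrows `G` on `EG`.
An arrow `g` goes from `source g` to `target g`, and `mul g h` is the composition `gh`, defined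
when `source g = target h`. The function `mul` is total for convenience: its values on
non-composable pairs are irrelevant, and all axioms only concern composable pairs. -/
structure LieGroupoid (EM EG M G : Type*)
    [NormedAddCommGroup EM] [NormedSpace ℝ EM] [NormedAddCommGroup EG] [NormedSpace ℝ EG]
    [TopologicalSpace M] [ChartedSpace EM M] [IsManifold 𝓘(ℝ, EM) ∞ M]
    [TopologicalSpace G] [ChartedSpace EG G] [IsManifold 𝓘(ℝ, EG) ∞ G] where
  source : G → M
  target : G → M
  unit : M → G
  inv : G → G
  mul : G → G → G
  source_unit : ∀ x, source (unit x) = x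
  target_unit : ∀ x, target (unit x) = x
  source_inv : ∀ g, source (inv g) = target g
  target_inv : ∀ g, target (inv g) = source g
  source_mul : ∀ g h, source g = target h → source (mul g h) = source h
  target_mul : ∀ g h, source g = target h → target (mul g h) = target g
  mul_assoc : ∀ g h k, source g = target h → source h = target k →
    mul (mul g h) k = mul g (mul h k)
  unit_mul : ∀ g, mul (unit (target g)) g = g
  mul_unit : ∀ g, mul g (unit (source g)) = g
  inv_mul : ∀ g, mul (inv g) g = unit (source g)
  mul_inv : ∀ g, mul g (inv g) = unit (target g)
  isSubmersion_source : Manifold.IsSubmersion 𝓘(ℝ, EG) 𝓘(ℝ, EM) ∞ source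
  isSubmersion_target : Manifold.IsSubmersion 𝓘(ℝ, EG) 𝓘(ℝ, EM) ∞ target
  contMDiff_unit : ContMDiff 𝓘(ℝ, EM) 𝓘(ℝ, EG) ∞ unit
  contMDiff_inv : ContMDiff 𝓘(ℝ, EG) 𝓘(ℝ, EG) ∞ inv
  smooth_mul : SmoothOnSubset (𝓘(ℝ, EG).prod 𝓘(ℝ, EG)) 𝓘(ℝ, EG)
    {p : G × G | source p.1 = target p.2} (fun p => mul p.1.1 p.1.2)

namespace LieGroupoid

variable {EM EG M G : Type*}
  [NormedAddCommGroup EM] [NormedSpace ℝ EM] [NormedAddCommGroup EG] [NormedSpace ℝ EG]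
  [TopologicalSpace M] [ChartedSpace EM M] [IsManifold 𝓘(ℝ, EM) ∞ M]
  [TopologicalSpace G] [ChartedSpace EG G] [IsManifold 𝓘(ℝ, EG) ∞ G]
  (𝒢 : LieGroupoid EM EG M G)

/-- A Lie groupoid is proper if its manifold of arrows is Hausdorff and the map
`(s, t) : G → M × M` is proper. -/
structure IsProper : Prop where
  t2Space : T2Space G
  isProperMap : IsProperMap (fun g : G => (𝒢.source g, 𝒢.target g))

theorem inv_unit (x : M) : 𝒢.inv (𝒢.unit x) = 𝒢.unit x := by
  have h1 := 𝒢.unit_mul (𝒢.inv (𝒢.unit x))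
  have h2 := 𝒢.mul_inv (𝒢.unit x)
  rw [𝒢.target_inv, 𝒢.source_unit] at h1
  rw [𝒢.target_unit] at h2
  exact h1.symm.trans h2

/-! ### Strings of composable arrows -/

/-- The set `𝒢⁽ⁿ⁺¹⁾ ⊆ Gⁿ⁺¹` of strings of `n + 1` composable arrows. -/
def strings (n : ℕ) : Set (Fin (n + 1) → G) :=
  {g | ∀ i : Fin n, 𝒢.source (g i.castSucc) = 𝒢.target (g i.succ)}

/-- `(g₁, …, gₙ₊₂) ↦ (g₂, …, gₙ₊₂)`. -/
def tailString {n : ℕ} (g : 𝒢.strings (n + 1)) : 𝒢.strings n :=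
  ⟨Fin.tail g.1, fun i => g.2 i.succ⟩

/-- `(g₁, …, gₙ₊₂) ↦ (g₁, …, gⱼ₊₁gⱼ₊₂, …, gₙ₊₂)` for `0 ≤ j ≤ n`, and
`(g₁, …, gₙ₊₂) ↦ (g₁, …, gₙ₊₁)` for `j = n + 1`. -/
def contractString {n : ℕ} (j : Fin (n + 2)) (g : 𝒢.strings (n + 1)) : 𝒢.strings n :=
  ⟨Fin.contractNth j 𝒢.mul g.1, by
    intro i
    have h1 := g.2 i.castSucc
    have h2 := g.2 i.succ
    rw [Fin.succ_castSucc] at h1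
    rw [← Fin.succ_castSucc] at h2
    simp only [Fin.contractNth, Fin.val_castSucc, Fin.val_succ]
    split_ifs
    all_goals first
      | omega
      | exact h1
      | exact h2
      | exact h1.trans (𝒢.target_mul _ _ h2).symm
      | exact (𝒢.source_mul _ _ h1).trans h2⟩

theorem contractString_zero_zero {n : ℕ} (g : 𝒢.strings (n + 1)) :
    (𝒢.contractString 0 g).1 0 = 𝒢.mul (g.1 0) (g.1 1) := by
  simp [contractString, Fin.contractNth]

theorem contractString_succ_zero {n : ℕ} (j : Fin (n + 1)) (g : 𝒢.strings (n + 1)) :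
    (𝒢.contractString j.succ g).1 0 = g.1 0 := by
  simp [contractString, Fin.contractNth]

theorem div_string {n : ℕ} (g : 𝒢.strings (n + 1)) :
    𝒢.mul ((𝒢.contractString 0 g).1 0) (𝒢.inv ((𝒢.tailString g).1 0)) = g.1 0 := by
  have h : 𝒢.source (g.1 0) = 𝒢.target (g.1 1) := g.2 0
  have h' : (𝒢.tailString g).1 0 = g.1 1 := rfl
  rw [contractString_zero_zero, h', 𝒢.mul_assoc _ _ _ h (𝒢.target_inv _).symm, 𝒢.mul_inv, ← h,
    𝒢.mul_unit]

/-! ### Sections of the Lie algebroid -/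

/-- Families of tangent vectors to `G` at the units. -/
abbrev UnitField : Type _ := ∀ x : M, TangentSpace 𝓘(ℝ, EG) (𝒢.unit x)

/-- The space `Γ(A)` of smooth sections of the Lie algebroid `A = Ker(ds)|_M`; this is the space
`C⁰_def(𝒢)` of deformation cochains of degree `0`. -/
def algebroidSections : Submodule ℝ 𝒢.UnitField where
  carrier := {α |
    ContMDiff 𝓘(ℝ, EM) 𝓘(ℝ, EG).tangent ∞
      (fun x => (⟨𝒢.unit x, α x⟩ : TangentBundle 𝓘(ℝ, EG) G)) ∧
    ∀ x, mfderiv 𝓘(ℝ, EG) 𝓘(ℝ, EM) 𝒢.source (𝒢.unit x) (α x) = 0}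
  zero_mem' := ⟨𝒢.contMDiff_unit.zero_along, fun x => map_zero _⟩
  add_mem' {α β} hα hβ := by
    refine ⟨?_, fun x => ?_⟩
    · simpa using ContMDiff.add_smul_along 1 hα.1 hβ.1
    · rw [Pi.add_apply, map_add, hα.2 x, hβ.2 x, add_zero]
  smul_mem' r α hα := by
    refine ⟨?_, fun x => ?_⟩
    · simpa using ContMDiff.add_smul_along r 𝒢.contMDiff_unit.zero_along hα.1
    · rw [Pi.smul_apply, map_smul, hα.2 x, smul_zero]

/-- The anchor `ρ(α)ₓ = dt(αₓ)`. -/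
def anchor (x : M) : 𝒢.UnitField →ₗ[ℝ] TangentSpace 𝓘(ℝ, EM) x :=
  tangentCast 𝓘(ℝ, EM) (𝒢.target_unit x) ∘ₗ
    (mfderiv 𝓘(ℝ, EG) 𝓘(ℝ, EM) 𝒢.target (𝒢.unit x)).toLinearMap ∘ₗ LinearMap.proj x

/-- The differential at `h` of the right translation `R_g : s⁻¹(t(g)) → s⁻¹(s(g))`, `h ↦ hg`. It is
meaningful on the tangent space `Ker(ds)_h` of the fibre. -/
def rightTranslation (g h : G) :
    TangentSpace 𝓘(ℝ, EG) h →L[ℝ] TangentSpace 𝓘(ℝ, EG) (𝒢.mul h g) :=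
  mfderivWithin 𝓘(ℝ, EG) 𝓘(ℝ, EG) (fun h => 𝒢.mul h g) {h | 𝒢.source h = 𝒢.target g} h

/-- The differential at `h` of the left translation `L_g : t⁻¹(s(g)) → t⁻¹(t(g))`, `h ↦ gh`. It is
meaningful on the tangent space `Ker(dt)_h` of the fibre. -/
def leftTranslation (g h : G) :
    TangentSpace 𝓘(ℝ, EG) h →L[ℝ] TangentSpace 𝓘(ℝ, EG) (𝒢.mul g h) :=
  mfderivWithin 𝓘(ℝ, EG) 𝓘(ℝ, EG) (fun h => 𝒢.mul g h) {h | 𝒢.target h = 𝒢.source g} h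

theorem mul_inv_unit_source (g : G) : 𝒢.mul g (𝒢.inv (𝒢.unit (𝒢.source g))) = g := by
  rw [𝒢.inv_unit, 𝒢.mul_unit]

/-- The value at `g` of the right invariant vector field of `α`: `r_g(α_{t(g)})`. -/
def rightInvariant (g : G) : 𝒢.UnitField →ₗ[ℝ] TangentSpace 𝓘(ℝ, EG) g :=
  tangentCast 𝓘(ℝ, EG) (𝒢.unit_mul g) ∘ₗ
    (𝒢.rightTranslation g (𝒢.unit (𝒢.target g))).toLinearMap ∘ₗ LinearMap.proj (𝒢.target g)

/-- The value at `g` of the left invariant vector field of `α`: `l_g(di(α_{s(g)}))`. -/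
def leftInvariant (g : G) : 𝒢.UnitField →ₗ[ℝ] TangentSpace 𝓘(ℝ, EG) g :=
  tangentCast 𝓘(ℝ, EG) (𝒢.mul_inv_unit_source g) ∘ₗ
    (𝒢.leftTranslation g (𝒢.inv (𝒢.unit (𝒢.source g)))).toLinearMap ∘ₗ
    (mfderiv 𝓘(ℝ, EG) 𝓘(ℝ, EG) 𝒢.inv (𝒢.unit (𝒢.source g))).toLinearMap ∘ₗ
    LinearMap.proj (𝒢.source g)

/-! ### The deformation complex -/

/-- Families `c(g₁, …, gₙ₊₁) ∈ T_{g₁}G` indexed by strings of `n + 1` composable arrows. -/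
abbrev StringField (n : ℕ) : Type _ := ∀ g : 𝒢.strings n, TangentSpace 𝓘(ℝ, EG) (g.1 0)

/-- The space `Cⁿ⁺¹_def(𝒢)` of deformation cochains of degree `n + 1`: the families
`c(g₁, …, gₙ₊₁) ∈ T_{g₁}G` which are smooth and `s`-projectable, that is, `ds ∘ c` depends only on
`(g₂, …, gₙ₊₁)`; when `n = 0` this means that `ds(c(g))` depends only on `s(g)`. -/
def cochains (n : ℕ) : Submodule ℝ (𝒢.StringField n) where
  carrier := {c |
    SmoothOnSubset (ModelWithCorners.pi fun _ : Fin (n + 1) => 𝓘(ℝ, EG)) 𝓘(ℝ, EG).tangent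
      (𝒢.strings n) (fun g => (⟨g.1 0, c g⟩ : TangentBundle 𝓘(ℝ, EG) G)) ∧
    ∀ (g g' : 𝒢.strings n) (h : 𝒢.source (g.1 0) = 𝒢.source (g'.1 0)),
      Fin.tail g.1 = Fin.tail g'.1 →
      tangentCast 𝓘(ℝ, EM) h (mfderiv 𝓘(ℝ, EG) 𝓘(ℝ, EM) 𝒢.source (g.1 0) (c g)) =
        mfderiv 𝓘(ℝ, EG) 𝓘(ℝ, EM) 𝒢.source (g'.1 0) (c g')}
  zero_mem' := by
    refine ⟨fun x => ⟨Set.univ, isOpen_univ, trivial, _,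
      (contMDiff_coord 0).zero_along.contMDiffOn, fun _ _ => rfl⟩, fun g g' h _ => ?_⟩
    simp only [Pi.zero_apply, map_zero]
  add_mem' {c d} hc hd := by
    refine ⟨?_, fun g g' h hg => ?_⟩
    · simpa using SmoothOnSubset.add_smul_along (contMDiff_coord 0) 1 hc.1 hd.1
    · rw [Pi.add_apply, Pi.add_apply, map_add, map_add, map_add, hc.2 g g' h hg, hd.2 g g' h hg]
  smul_mem' r c hc := by
    refine ⟨?_, fun g g' h hg => ?_⟩
    · have h0 : SmoothOnSubset (ModelWithCorners.pi fun _ : Fin (n + 1) => 𝓘(ℝ, EG))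
          𝓘(ℝ, EG).tangent (𝒢.strings n)
          (fun g => (⟨g.1 0, 0⟩ : TangentBundle 𝓘(ℝ, EG) G)) :=
        fun x => ⟨Set.univ, isOpen_univ, trivial, _,
          (contMDiff_coord 0).zero_along.contMDiffOn, fun _ _ => rfl⟩
      simpa using SmoothOnSubset.add_smul_along (contMDiff_coord 0) r h0 hc.1
    · rw [Pi.smul_apply, Pi.smul_apply, map_smul, map_smul, map_smul, hc.2 g g' h hg]

/-- The differential at `(p, q)` of the division map `m̄(p, q) = pq⁻¹`, which is defined on the
submanifold of pairs with `s(p) = s(q)`. It is meaningful on the tangent space of this submanifold,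
which consists of the pairs `(v, w)` with `ds(v) = ds(w)`. -/
def divDeriv (p q : G) :
    (TangentSpace 𝓘(ℝ, EG) p × TangentSpace 𝓘(ℝ, EG) q) →L[ℝ]
      TangentSpace 𝓘(ℝ, EG) (𝒢.mul p (𝒢.inv q)) :=
  mfderivWithin (𝓘(ℝ, EG).prod 𝓘(ℝ, EG)) 𝓘(ℝ, EG)
    (fun x : G × G => 𝒢.mul x.1 (𝒢.inv x.2)) {x | 𝒢.source x.1 = 𝒢.source x.2} (p, q)

/-- The differential in degree `0`: `δ(α)` is the sum of the right and left invariant vector fields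
of `α`. -/
def deltaZero : 𝒢.UnitField →ₗ[ℝ] 𝒢.StringField 0 :=
  LinearMap.pi fun g => 𝒢.rightInvariant (g.1 0) + 𝒢.leftInvariant (g.1 0)

/-- The differential in degree `k = n + 1`: `(δc)(g₁, …, gₖ₊₁)` is
`- dm̄(c(g₁g₂, …, gₖ₊₁), c(g₂, …, gₖ₊₁))`
`+ ∑_{2 ≤ i ≤ k} (-1)ⁱ c(g₁, …, gᵢgᵢ₊₁, …, gₖ₊₁) + (-1)ᵏ⁺¹ c(g₁, …, gₖ)`,
where the last two terms form a single sum over `i = j + 2`, `0 ≤ j ≤ n`. -/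
def delta (n : ℕ) : 𝒢.StringField n →ₗ[ℝ] 𝒢.StringField (n + 1) :=
  LinearMap.pi fun g =>
    - (tangentCast 𝓘(ℝ, EG) (𝒢.div_string g) ∘ₗ
        (𝒢.divDeriv ((𝒢.contractString 0 g).1 0) ((𝒢.tailString g).1 0)).toLinearMap ∘ₗ
        (LinearMap.proj (𝒢.contractString 0 g)).prod (LinearMap.proj (𝒢.tailString g)))
    + ∑ j : Fin (n + 1), (-1 : ℝ) ^ ((j : ℕ) + 2) •
        (tangentCast 𝓘(ℝ, EG) (𝒢.contractString_succ_zero j g) ∘ₗ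
          LinearMap.proj (𝒢.contractString j.succ g))

/-- The space of deformation cocycles of degree `0`; as there are no coboundaries in degree `0`,
this is also the deformation cohomology `H⁰_def(𝒢)`. -/
def cocyclesZero : Submodule ℝ 𝒢.UnitField :=
  𝒢.algebroidSections ⊓ LinearMap.ker 𝒢.deltaZero

/-- The space of deformation cocycles of degree `n + 1`. -/
def cocycles (n : ℕ) : Submodule ℝ (𝒢.StringField n) :=
  𝒢.cochains n ⊓ LinearMap.ker (𝒢.delta n)

/-- The space of deformation coboundaries of degree `n + 1`. -/
def coboundaries : ∀ n : ℕ, Submodule ℝ (𝒢.StringField n)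
  | 0 => 𝒢.algebroidSections.map 𝒢.deltaZero
  | n + 1 => (𝒢.cochains n).map (𝒢.delta n)

/-- The deformation cohomology `H⁰_def(𝒢)`. -/
abbrev cohomologyZero : Type _ := 𝒢.cocyclesZero

/-- The deformation cohomology `Hⁿ⁺¹_def(𝒢)` in degree `n + 1`: cocycles modulo coboundaries.
(Coboundaries are smooth, `s`-projectable cocycles; `submoduleOf` regards them inside the space of
cocycles.) -/
abbrev cohomologySucc (n : ℕ) : Type _ :=
  𝒢.cocycles n ⧸ (𝒢.coboundaries n).submoduleOf (𝒢.cocycles n)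

/-! ### Invariant sections of the isotropy and normal representations -/

theorem conj_unit (g : G) :
    𝒢.mul (𝒢.mul g (𝒢.unit (𝒢.source g))) (𝒢.inv g) = 𝒢.unit (𝒢.target g) := by
  rw [𝒢.mul_unit, 𝒢.mul_inv]

/-- The action `ad_g` of an arrow `g : x → y` on isotropy vectors: the differential at the unit of
the conjugation `h ↦ ghg⁻¹` from the isotropy group at `x` to the isotropy group at `y`. It is
meaningful on the tangent space of the isotropy group, the isotropy Lie algebra `Ker(ρₓ)`. -/
def isotropyAction (g : G) :
    TangentSpace 𝓘(ℝ, EG) (𝒢.unit (𝒢.source g)) →ₗ[ℝ]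
      TangentSpace 𝓘(ℝ, EG) (𝒢.unit (𝒢.target g)) :=
  tangentCast 𝓘(ℝ, EG) (𝒢.conj_unit g) ∘ₗ
    (mfderivWithin 𝓘(ℝ, EG) 𝓘(ℝ, EG) (fun h => 𝒢.mul (𝒢.mul g h) (𝒢.inv g))
      {h | 𝒢.source h = 𝒢.source g ∧ 𝒢.target h = 𝒢.source g}
      (𝒢.unit (𝒢.source g))).toLinearMap

/-- The space `Γ(𝔦)^inv` of invariant smooth sections of the isotropy `𝔦 = Ker(ρ)`: the `α ∈ Γ(A)`
with `ρ(α) = 0` and `ad_g(α(x)) = α(y)` for all arrows `g : x → y`. -/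
def invariantIsotropySections : Submodule ℝ 𝒢.UnitField where
  carrier := {α | α ∈ 𝒢.algebroidSections ∧ (∀ x, 𝒢.anchor x α = 0) ∧
    ∀ g, 𝒢.isotropyAction g (α (𝒢.source g)) = α (𝒢.target g)}
  zero_mem' := ⟨zero_mem _, fun _ => map_zero _, fun _ => map_zero _⟩
  add_mem' {α β} hα hβ := by
    refine ⟨add_mem hα.1 hβ.1, fun x => ?_, fun g => ?_⟩
    · rw [map_add, hα.2.1, hβ.2.1, add_zero]
    · rw [Pi.add_apply, Pi.add_apply, map_add, hα.2.2, hβ.2.2]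
  smul_mem' r α hα := by
    refine ⟨Submodule.smul_mem _ r hα.1, fun x => ?_, fun g => ?_⟩
    · rw [map_smul, hα.2.1, smul_zero]
    · rw [Pi.smul_apply, Pi.smul_apply, map_smul, hα.2.2]

/-- The image of the anchor `ρ : Γ(A) → 𝔛(M)`. -/
def anchorImage : Submodule ℝ (SmoothVectorField EM M) where
  carrier := {V | ∃ α ∈ 𝒢.algebroidSections, ∀ x, V x = 𝒢.anchor x α}
  zero_mem' := ⟨0, zero_mem _, fun x => (map_zero _).symm⟩
  add_mem' := by
    rintro V W ⟨α, hα, hV⟩ ⟨β, hβ, hW⟩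
    exact ⟨α + β, add_mem hα hβ, fun x => by
      rw [map_add, ← hV, ← hW, ContMDiffSection.coe_add, Pi.add_apply]⟩
  smul_mem' := by
    rintro r V ⟨α, hα, hV⟩
    exact ⟨r • α, Submodule.smul_mem _ r hα, fun x => by
      rw [map_smul, ← hV, ContMDiffSection.coe_smul, Pi.smul_apply]⟩

/-- The space `Γ(ν) = 𝔛(M) / Im(ρ)` of sections of the normal bundle `ν = TM / ρ(A)`. -/
abbrev normalSections : Type _ := SmoothVectorField EM M ⧸ 𝒢.anchorImage

/-- The vector fields `V` on `M` which admit an `(s, t)`-lift: a vector field `X` on `G` which is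
both `s`-projectable and `t`-projectable to `V`. -/
def liftableFields : Submodule ℝ (SmoothVectorField EM M) where
  carrier := {V | ∃ X : SmoothVectorField EG G, ∀ g,
    mfderiv 𝓘(ℝ, EG) 𝓘(ℝ, EM) 𝒢.source g (X g) = V (𝒢.source g) ∧
    mfderiv 𝓘(ℝ, EG) 𝓘(ℝ, EM) 𝒢.target g (X g) = V (𝒢.target g)}
  zero_mem' := ⟨0, fun g => ⟨map_zero _, map_zero _⟩⟩
  add_mem' := by
    rintro V W ⟨X, hX⟩ ⟨Y, hY⟩
    refine ⟨X + Y, fun g => ?_⟩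
    simp only [ContMDiffSection.coe_add, Pi.add_apply, map_add, hX g, hY g, and_self]
  smul_mem' := by
    rintro r V ⟨X, hX⟩
    refine ⟨r • X, fun g => ?_⟩
    simp only [ContMDiffSection.coe_smul, Pi.smul_apply, map_smul, hX g, and_self]

/-- The space `Γ(ν)^inv` of invariant elements of `Γ(ν)`: the classes of the vector fields which
admit an `(s, t)`-lift. -/
def invariantNormalSections : Submodule ℝ 𝒢.normalSections :=
  𝒢.liftableFields.map 𝒢.anchorImage.mkQ

/-- `V` is the base field of the vector field `X` on `G` (a family indexed by strings of one
arrow): `X` is `s`-projectable to `V`. -/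
def IsBaseField (X : 𝒢.StringField 0) (V : SmoothVectorField EM M) : Prop :=
  ∀ g : 𝒢.strings 0,
    mfderiv 𝓘(ℝ, EG) 𝓘(ℝ, EM) 𝒢.source (g.1 0) (X g) = V (𝒢.source (g.1 0))

end LieGroupoid

end

open scoped Topology
open Set Filter MeasureTheory

set_option linter.unusedSectionVars false

/-! The engine is averaging. A proper groupoid carries a normalized left invariant Haar system:
smooth probability measures on the target fibres `t⁻¹(x)` such that left translation by an arrow `g`
carries the measure on `t⁻¹(s(g))` to the one on `t⁻¹(t(g))`. Its ingredients are a cut-off function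
on `M` (`IsProper.exists_cutoff`), which confines integrals to compact sets, and a density
transported from the units by left translations (`HaarData.density_eq`). The outcome is the
invariance `HaarData.average_translate`, the commutation with linear maps
`HaarData.average_comp_clm`, and the smooth dependence on parameters
`HaarData.contMDiffAt_tangentAverage`.

In degree at least two, a cocycle `c` is averaged over its last arrow. In the cocycle identity at
`(g₁, …, g_k, h)` the last face is `c(g₁, …, g_k)`. Averaging the others over `h` gives the terms of
`δ` of the averaged cochain; the face containing `g_k h` is brought to that form by left invariance.
Hence `c` is a coboundary up to sign (`HaarData.delta_contraction`).

In degree one, cocycles are multiplicative vector fields. Such a field `X` is `s`- and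
`t`-projectable to its base field, so its class gives an invariant class in `Γ(ν)`. The base field
of `δα` is `ρ(α)`. Conversely, if the base field of `X` is `ρ(α)`, dividing `X` by the left
invariant field of `α` gives vectors at the units, and their average over `t⁻¹(x)` is a primitive of
`X` (`HaarData.mem_coboundaries_zero`). For surjectivity, a lift `X` of `V` to both sides is made
multiplicative without changing its base field: `dm̄(X(gh), X(h))` is a vector at `g`, and its
average over `h` is a cocycle (`HaarData.multiplicativeAverage_mem_cocycles`).

In degree zero, applying `dt` to `δα = 0` gives `ρ(α) = 0`; for such `α` the equation `δα = 0` at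
`g` is `ad_g`-invariance, because `r_g(ad_g α)` is the left translate of `α` by `g`
(`isotropyAction_eq_iff`).

Multiplication is meaningful on composable pairs only, so its differential is controlled through
curves: tangent vectors are realized by curves that stay composable, and identities between arrows
are differentiated along them. -/

noncomputable section

/-! ### Velocities of curves, as points of the tangent bundle. -/

section Velocity

variable {E H E' H' E'' H'' : Type*} [NormedAddCommGroup E] [NormedSpace ℝ E] [TopologicalSpace H]
  [NormedAddCommGroup E'] [NormedSpace ℝ E'] [TopologicalSpace H']
  {I : ModelWithCorners ℝ E H} {J : ModelWithCorners ℝ E' H'}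
  {X N : Type*} [TopologicalSpace X] [ChartedSpace H X] [TopologicalSpace N] [ChartedSpace H' N]

/-- The curve `γ` is differentiable at time `0`, with velocity `ξ`. -/
def HasVelocity (I : ModelWithCorners ℝ E H) (γ : ℝ → X) (ξ : TangentBundle I X) : Prop :=
  MDifferentiableAt 𝓘(ℝ, ℝ) I γ 0 ∧ tangentMap 𝓘(ℝ, ℝ) I γ ⟨0, (1 : ℝ)⟩ = ξ

theorem HasVelocity.apply_zero {γ : ℝ → X} {ξ : TangentBundle I X} (h : HasVelocity I γ ξ) :
    γ 0 = ξ.1 := congrArg (fun ζ : TangentBundle I X => ζ.1) h.2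

theorem HasVelocity.unique {γ : ℝ → X} {ξ η : TangentBundle I X} (h : HasVelocity I γ ξ)
    (h' : HasVelocity I γ η) : ξ = η := h.2.symm.trans h'.2

theorem HasVelocity.congr {γ γ' : ℝ → X} {ξ : TangentBundle I X} (h : HasVelocity I γ ξ)
    (h' : ∀ᶠ τ in 𝓝 0, γ τ = γ' τ) : HasVelocity I γ' ξ := by
  have h1 : γ' =ᶠ[𝓝 0] γ := h'.mono fun τ hτ => hτ.symm
  have h2 := (h.1.hasMFDerivAt).congr_of_eventuallyEq h1
  refine ⟨h2.mdifferentiableAt, ?_⟩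
  rw [← h.2]
  have h3 := h2.mfderiv
  have h4 : γ' 0 = γ 0 := h1.self_of_nhds
  simp only [tangentMap]
  rw [h3]
  exact Bundle.TotalSpace.ext h4 HEq.rfl

theorem HasVelocity.unique_of_eventuallyEq {γ γ' : ℝ → X} {ξ η : TangentBundle I X}
    (h : HasVelocity I γ ξ) (h' : HasVelocity I γ' η) (hγ : ∀ᶠ τ in 𝓝 0, γ τ = γ' τ) : ξ = η :=
  (h.congr hγ).unique h'

theorem HasVelocity.continuousAt {γ : ℝ → X} {ξ : TangentBundle I X} (h : HasVelocity I γ ξ) :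
    ContinuousAt γ 0 := h.1.continuousAt

theorem HasVelocity.comp {γ : ℝ → X} {ξ : TangentBundle I X} (h : HasVelocity I γ ξ) {f : X → N}
    (hf : MDifferentiableAt I J f ξ.1) : HasVelocity J (fun τ => f (γ τ)) (tangentMap I J f ξ) := by
  rw [← h.apply_zero] at hf
  refine ⟨hf.comp 0 h.1, ?_⟩
  have := tangentMap_comp_at (I := 𝓘(ℝ, ℝ)) (I' := I) (I'' := J) (f := γ) (g := f)
    (⟨0, (1 : ℝ)⟩ : TangentBundle 𝓘(ℝ, ℝ) ℝ) hf h.1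
  rw [h.2] at this
  exact this

/-- Derivatives within `S` need not be unique, but all of them agree on velocities of curves that
stay in `S`. This is what gives the differentials of partially defined groupoid operations a
meaning. -/
theorem HasVelocity.comp_within {γ : ℝ → X} {ξ : TangentBundle I X} (h : HasVelocity I γ ξ)
    {f : X → N} {S : Set X} (hf : MDifferentiableWithinAt I J f S ξ.1)
    (hS : ∀ᶠ τ in 𝓝 0, γ τ ∈ S) :
    HasVelocity J (fun τ => f (γ τ)) (tangentMapWithin I J f S ξ) := by
  obtain ⟨hγ, rfl⟩ := h
  have h1 : HasMFDerivWithinAt I J f S (γ 0) (mfderivWithin I J f S (γ 0)) :=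
    MDifferentiableWithinAt.hasMFDerivWithinAt hf
  have h2 := h1.comp (I := 𝓘(ℝ, ℝ)) 0 (hγ.hasMFDerivAt.hasMFDerivWithinAt (s := γ ⁻¹' S))
    (fun _ h => h)
  have h3 := h2.hasMFDerivAt hS
  refine ⟨h3.mdifferentiableAt, ?_⟩
  simp only [tangentMap, tangentMapWithin]
  have h4 := h3.mfderiv
  change (⟨f (γ 0), mfderiv 𝓘(ℝ, ℝ) J (f ∘ γ) 0 (1 : ℝ)⟩ : TangentBundle J N) = _
  rw [h4]
  rfl

theorem HasVelocity.prodMk {γ : ℝ → X} {δ : ℝ → N} {ξ : TangentBundle I X} {η : TangentBundle J N}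
    (h : HasVelocity I γ ξ) (h' : HasVelocity J δ η) :
    HasVelocity (I.prod J) (fun τ => (γ τ, δ τ))
      (⟨(ξ.1, η.1), (ξ.2, η.2)⟩ : TangentBundle (I.prod J) (X × N)) := by
  obtain ⟨hγ, rfl⟩ := h
  obtain ⟨hδ, rfl⟩ := h'
  have h1 := hγ.hasMFDerivAt.prodMk hδ.hasMFDerivAt
  refine ⟨h1.mdifferentiableAt, ?_⟩
  simp only [tangentMap]
  rw [h1.mfderiv]
  rfl

theorem exists_hasVelocity {E : Type*} [NormedAddCommGroup E] [NormedSpace ℝ E] {X : Type*}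
    [TopologicalSpace X] [ChartedSpace E X] (ξ : TangentBundle 𝓘(ℝ, E) X) :
    ∃ γ : ℝ → X, HasVelocity 𝓘(ℝ, E) γ ξ := by
  obtain ⟨x, v⟩ := ξ
  change E at v
  set e := chartAt E x
  have hx : e x ∈ e.target := mem_chart_target E x
  have hc : Continuous fun τ : ℝ => e x + τ • v := by fun_prop
  have h0 : e x + (0 : ℝ) • v = e x := by simp
  have hnear : ∀ᶠ τ : ℝ in 𝓝 0, e x + τ • v ∈ e.target :=
    hc.continuousAt.preimage_mem_nhds (by rw [h0]; exact e.open_target.mem_nhds hx)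
  set γ : ℝ → X := fun τ => e.symm (e x + τ • v) with hγ
  have hγ0 : γ 0 = x := by
    simp only [hγ, h0]
    exact e.left_inv (mem_chart_source E x)
  have hd : HasMFDerivAt 𝓘(ℝ, ℝ) 𝓘(ℝ, E) γ 0
      ((ContinuousLinearMap.id ℝ ℝ).smulRight v : ℝ →L[ℝ] E) := by
    constructor
    · refine ContinuousAt.comp (g := e.symm) ?_ hc.continuousAt
      rw [h0]
      exact e.symm.continuousAt hx
    · have h1 : HasFDerivAt (fun τ : ℝ => e x + τ • v)
          ((ContinuousLinearMap.id ℝ ℝ).smulRight v) 0 :=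
        ((hasFDerivAt_id (𝕜 := ℝ) (0 : ℝ)).smul_const v).const_add (e x)
      refine (h1.congr_of_eventuallyEq ?_).hasFDerivWithinAt
      filter_upwards [hnear] with τ hτ
      simp only [writtenInExtChartAt, mfld_simps, hγ0]
      exact e.right_inv hτ
  refine ⟨γ, hd.mdifferentiableAt, ?_⟩
  simp only [tangentMap]
  rw [hd.mfderiv]
  refine Bundle.TotalSpace.ext hγ0 (heq_of_eq ?_)
  change ((ContinuousLinearMap.id ℝ ℝ).smulRight v : ℝ →L[ℝ] E) (1 : ℝ) = v
  simp

/-- In the total space the transport along an equality of base points disappears, which is why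
identities between tangent vectors are mostly stated there. -/
theorem mk_tangentCast {x y : X} (h : x = y) (v : TangentSpace I x) :
    (⟨y, tangentCast I h v⟩ : TangentBundle I X) = ⟨x, v⟩ := by
  subst h; rfl

theorem hasVelocity_const (x : X) : HasVelocity I (fun _ : ℝ => x) ⟨x, 0⟩ := by
  refine ⟨mdifferentiableAt_const, ?_⟩
  simp only [tangentMap, mfderiv_const]
  rfl

end Velocity

/-! ### The local normal form of a submersion, and lifting of curves. -/

section FibredChart

variable {EM EG M G : Type*}
  [NormedAddCommGroup EM] [NormedSpace ℝ EM] [NormedAddCommGroup EG] [NormedSpace ℝ EG]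
  [TopologicalSpace M] [ChartedSpace EM M]
  [TopologicalSpace G] [ChartedSpace EG G]

/-- A local presentation of `f : G → M` as a projection `M × F → M`. -/
structure FibredChart (EM EG : Type*) [NormedAddCommGroup EM] [NormedSpace ℝ EM]
    [NormedAddCommGroup EG] [NormedSpace ℝ EG] {M G : Type*}
    [TopologicalSpace M] [ChartedSpace EM M] [TopologicalSpace G] [ChartedSpace EG G]
    (f : G → M) (F : Type*) [NormedAddCommGroup F] [NormedSpace ℝ F] where
  source : Set G
  target : Set (M × F)
  param : M × F → G
  coord : G → F
  open_source : IsOpen source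
  open_target : IsOpen target
  map_source : ∀ h ∈ source, (f h, coord h) ∈ target
  map_target : ∀ z ∈ target, param z ∈ source
  left_inv : ∀ h ∈ source, param (f h, coord h) = h
  fst_param : ∀ z ∈ target, f (param z) = z.1
  coord_param : ∀ z ∈ target, coord (param z) = z.2
  contMDiffOn_param : ContMDiffOn (𝓘(ℝ, EM).prod 𝓘(ℝ, F)) 𝓘(ℝ, EG) ∞ param target
  contMDiffOn_coord : ContMDiffOn 𝓘(ℝ, EG) 𝓘(ℝ, F) ∞ coord source

/-- In the charts of the submersion `f` is the projection `EM × F → EM`. Undoing the chart of `M`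
makes the first coordinate the point `f h` itself. -/
theorem Manifold.IsSubmersionAtOfComplement.exists_fibredChart {F : Type*} [NormedAddCommGroup F]
    [NormedSpace ℝ F] {f : G → M} {x : G}
    (h : Manifold.IsSubmersionAtOfComplement F 𝓘(ℝ, EG) 𝓘(ℝ, EM) ∞ f x) :
    ∃ c : FibredChart EM EG f F, x ∈ c.source := by
  set φ := h.domChart
  set ψ := h.codChart
  set e := h.equiv
  have hw : ∀ z ∈ φ.target, ψ (f (φ.symm z)) = (e z).1 := by
    intro z hz
    have := h.writtenInCharts (show z ∈ (φ.extend 𝓘(ℝ, EG)).target by simpa using hz)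
    simpa using this
  have hs : ∀ y ∈ φ.source, f y ∈ ψ.source := fun y hy => h.source_subset_preimage_source hy
  have hw' : ∀ y ∈ φ.source, (e (φ y)).1 = ψ (f y) := by
    intro y hy
    rw [← hw _ (φ.map_source hy), φ.left_inv hy]
  have hψ := contMDiffOn_of_mem_maximalAtlas h.codChart_mem_maximalAtlas
  have hφ := contMDiffOn_of_mem_maximalAtlas h.domChart_mem_maximalAtlas
  have hφs := contMDiffOn_symm_of_mem_maximalAtlas h.domChart_mem_maximalAtlas
  have hin : ContMDiffOn (𝓘(ℝ, EM).prod 𝓘(ℝ, F)) 𝓘(ℝ, EG) ∞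
      (fun z : M × F => e.symm (ψ z.1, z.2)) (Prod.fst ⁻¹' ψ.source) := by
    have h1 : ContMDiffOn (𝓘(ℝ, EM).prod 𝓘(ℝ, F)) 𝓘(ℝ, EM) ∞
      (fun z : M × F => ψ z.1) (Prod.fst ⁻¹' ψ.source) :=
      hψ.comp contMDiff_fst.contMDiffOn fun _ h => h
    have h2 : ContMDiffOn (𝓘(ℝ, EM).prod 𝓘(ℝ, F)) 𝓘(ℝ, EM × F) ∞
        (fun z : M × F => (ψ z.1, z.2)) (Prod.fst ⁻¹' ψ.source) :=
      h1.prodMk_space contMDiff_snd.contMDiffOn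
    exact e.symm.contDiff.contMDiff.comp_contMDiffOn h2
  refine ⟨{
    source := φ.source
    target := (Prod.fst ⁻¹' ψ.source) ∩ (fun z : M × F => e.symm (ψ z.1, z.2)) ⁻¹' φ.target
    param := fun z => φ.symm (e.symm (ψ z.1, z.2))
    coord := fun y => (e (φ y)).2
    open_source := φ.open_source
    open_target := hin.continuousOn.isOpen_inter_preimage
      (ψ.open_source.preimage continuous_fst) φ.open_target
    map_source := fun y hy => ⟨hs y hy, ?_⟩
    map_target := fun z hz => φ.map_target hz.2
    left_inv := fun y hy => ?_
    fst_param := fun z hz => ?_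
    coord_param := fun z hz => ?_
    contMDiffOn_param := hφs.comp (hin.mono inter_subset_left) fun z hz => hz.2
    contMDiffOn_coord := ?_ }, h.mem_domChart_source⟩
  · change e.symm (ψ (f y), (e (φ y)).2) ∈ φ.target
    rw [← hw' y hy]
    simpa using φ.map_source hy
  · change φ.symm (e.symm (ψ (f y), (e (φ y)).2)) = y
    rw [← hw' y hy]
    simpa using φ.left_inv hy
  · have h1 := hw _ hz.2
    simp only [ContinuousLinearEquiv.apply_symm_apply] at h1
    exact ψ.injOn (hs _ (φ.map_target hz.2)) hz.1 h1
  · rw [φ.right_inv hz.2]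
    simp
  · exact ((ContinuousLinearMap.snd ℝ EM F).comp
      (e : EG →L[ℝ] EM × F)).contDiff.contMDiff.comp_contMDiffOn hφ

/-- The complement of a submersion can be taken finite dimensional. -/
theorem Manifold.IsSubmersion.exists_fibredChart [FiniteDimensional ℝ EG] {f : G → M}
    (h : Manifold.IsSubmersion 𝓘(ℝ, EG) 𝓘(ℝ, EM) ∞ f) :
    ∃ d : ℕ, ∀ x, ∃ c : FibredChart EM EG f (Fin d → ℝ), x ∈ c.source := by
  obtain ⟨F, _, _, hF⟩ := h
  rcases isEmpty_or_nonempty G with hG | ⟨⟨x₀⟩⟩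
  · exact ⟨0, fun x => (hG.false x).elim⟩
  · have e := (hF x₀).equiv
    -- The complement is a quotient of the finite dimensional model `EG ≃ EM × F`.
    have : FiniteDimensional ℝ F :=
      Module.Finite.of_surjective ((LinearMap.snd ℝ EM F) ∘ₗ e.toLinearEquiv.toLinearMap)
        (Prod.snd_surjective.comp e.surjective)
    have e' : F ≃L[ℝ] (Fin (Module.finrank ℝ F) → ℝ) :=
      ContinuousLinearEquiv.ofFinrankEq (by simp)
    exact ⟨Module.finrank ℝ F, fun x => ((hF x).trans_F e').exists_fibredChart⟩

variable {F : Type*} [NormedAddCommGroup F] [NormedSpace ℝ F]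

/-- Curves can be lifted along a submersion, with prescribed velocity. -/
theorem FibredChart.exists_lift {f : G → M} (c : FibredChart EM EG f F)
    {ξ : TangentBundle 𝓘(ℝ, EG) G} (hx : ξ.1 ∈ c.source)
    (hf : MDifferentiableAt 𝓘(ℝ, EG) 𝓘(ℝ, EM) f ξ.1)
    {β : ℝ → M} (hβ : HasVelocity 𝓘(ℝ, EM) β (tangentMap 𝓘(ℝ, EG) 𝓘(ℝ, EM) f ξ)) :
    ∃ γ : ℝ → G, HasVelocity 𝓘(ℝ, EG) γ ξ ∧ ∀ᶠ τ in 𝓝 0, f (γ τ) = β τ := by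
  -- Any curve with velocity `ξ` serves as a start; the lift keeps its fibre coordinate and replaces
  -- its base coordinate by `β`.
  obtain ⟨γ, hγ⟩ := exists_hasVelocity ξ
  have hγs : ∀ᶠ τ in 𝓝 0, γ τ ∈ c.source :=
    hγ.continuousAt.preimage_mem_nhds (by rw [hγ.apply_zero]; exact c.open_source.mem_nhds hx)
  have hparam : MDifferentiableAt (𝓘(ℝ, EM).prod 𝓘(ℝ, EG)) 𝓘(ℝ, EG)
      (fun z : M × G => c.param (z.1, c.coord z.2)) (f ξ.1, ξ.1) := by
    have h1 : MDifferentiableAt 𝓘(ℝ, EG) 𝓘(ℝ, F) c.coord ξ.1 :=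
      (c.contMDiffOn_coord.contMDiffAt (c.open_source.mem_nhds hx)).mdifferentiableAt (by simp)
    have h2 : MDifferentiableAt (𝓘(ℝ, EM).prod 𝓘(ℝ, F)) 𝓘(ℝ, EG) c.param (f ξ.1, c.coord ξ.1) :=
      (c.contMDiffOn_param.contMDiffAt (c.open_target.mem_nhds (c.map_source _ hx))).mdifferentiableAt
        (by simp)
    exact h2.comp (f ξ.1, ξ.1)
      (mdifferentiableAt_fst.prodMk (h1.comp (f ξ.1, ξ.1) mdifferentiableAt_snd))
  -- Since `β` and `f ∘ γ` have the same velocity, the corrected curve has the velocity of the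
  -- uncorrected one, which is `γ` itself near `0`.
  have h1 := (hβ.prodMk hγ).comp (f := fun z : M × G => c.param (z.1, c.coord z.2)) hparam
  have h2 := ((hγ.comp hf).prodMk hγ).comp (f := fun z : M × G => c.param (z.1, c.coord z.2)) hparam
  have h3 : ∀ᶠ τ in 𝓝 0, c.param (f (γ τ), c.coord (γ τ)) = γ τ :=
    hγs.mono fun τ hτ => c.left_inv _ hτ
  have h4 := h2.unique_of_eventuallyEq hγ h3
  rw [h4] at h1
  refine ⟨_, h1, ?_⟩
  have h5 : ContinuousAt (fun τ => (β τ, c.coord (γ τ))) 0 := by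
    refine hβ.continuousAt.prodMk (ContinuousAt.comp (g := c.coord) ?_ hγ.continuousAt)
    rw [hγ.apply_zero]
    exact c.contMDiffOn_coord.continuousOn.continuousAt (c.open_source.mem_nhds hx)
  have h6 : ∀ᶠ τ in 𝓝 0, (β τ, c.coord (γ τ)) ∈ c.target := by
    refine h5.preimage_mem_nhds (c.open_target.mem_nhds ?_)
    rw [hβ.apply_zero, hγ.apply_zero]
    exact c.map_source _ hx
  exact h6.mono fun τ hτ => c.fst_param _ hτ

end FibredChart

/-! ### Smoothness on subsets that carry no manifold structure. -/

section SmoothOnSubset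

variable {E H E' H' E'' H'' : Type*} [NormedAddCommGroup E] [NormedSpace ℝ E] [TopologicalSpace H]
  [NormedAddCommGroup E'] [NormedSpace ℝ E'] [TopologicalSpace H']
  [NormedAddCommGroup E''] [NormedSpace ℝ E''] [TopologicalSpace H'']
  {I : ModelWithCorners ℝ E H} {J : ModelWithCorners ℝ E' H'} {K : ModelWithCorners ℝ E'' H''}
  {X N P : Type*} [TopologicalSpace X] [ChartedSpace H X] [TopologicalSpace N] [ChartedSpace H' N]
  [TopologicalSpace P] [ChartedSpace H'' P]

theorem SmoothOnSubset.contMDiffOn {S : Set X} {f : X → N}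
    (h : SmoothOnSubset I J S fun y => f y) : ContMDiffOn I J ∞ f S := by
  intro x hx
  obtain ⟨U, hU, hxU, F, hF, hFf⟩ := h ⟨x, hx⟩
  refine ((hF.contMDiffAt (hU.mem_nhds hxU)).contMDiffWithinAt).congr_of_eventuallyEq ?_
    (hFf ⟨x, hx⟩ hxU).symm
  filter_upwards [mem_nhdsWithin_of_mem_nhds (hU.mem_nhds hxU), self_mem_nhdsWithin] with y hy hyS
  exact (hFf ⟨y, hyS⟩ hy).symm

/-- A map that stays in `S` near `p` has a neighbourhood of `p` as preimage of `S`, so the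
restriction to `S` costs nothing after composition. -/
theorem ContMDiffOn.comp_contMDiffAt_of_eventually {S : Set X} {f : X → N}
    (h : ContMDiffOn I J ∞ f S) {φ : P → X} {p : P} (hφ : ContMDiffAt K I ∞ φ p)
    (hS : ∀ᶠ q in 𝓝 p, φ q ∈ S) : ContMDiffAt K J ∞ (fun q => f (φ q)) p :=
  ((h _ hS.self_of_nhds).comp (t := S) (s := φ ⁻¹' S) p hφ.contMDiffWithinAt
    fun _ h => h).contMDiffAt hS

theorem SmoothOnSubset.continuous {S : Set X} {f : S → N} (h : SmoothOnSubset I J S f) :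
    Continuous f := by
  refine continuous_iff_continuousAt.2 fun x => ?_
  obtain ⟨U, hU, hxU, F, hF, hFf⟩ := h x
  have h1 : ContinuousAt (fun y : S => F y) x :=
    ContinuousAt.comp (g := F) (hF.continuousOn.continuousAt (hU.mem_nhds hxU))
      continuous_subtype_val.continuousAt
  refine h1.congr ?_
  filter_upwards [continuous_subtype_val.continuousAt.preimage_mem_nhds (hU.mem_nhds hxU)]
    with y hy using hFf y hy

end SmoothOnSubset

/-! ### Smooth structure maps, cancellation laws, and the tangent division map. -/

namespace LieGroupoid

variable {EM EG M G : Type*}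
  [NormedAddCommGroup EM] [NormedSpace ℝ EM] [NormedAddCommGroup EG] [NormedSpace ℝ EG]
  [TopologicalSpace M] [ChartedSpace EM M] [IsManifold 𝓘(ℝ, EM) ∞ M]
  [TopologicalSpace G] [ChartedSpace EG G] [IsManifold 𝓘(ℝ, EG) ∞ G]
  (𝒢 : LieGroupoid EM EG M G)

theorem contMDiff_source : ContMDiff 𝓘(ℝ, EG) 𝓘(ℝ, EM) ∞ 𝒢.source :=
  𝒢.isSubmersion_source.contMDiff

theorem contMDiff_target : ContMDiff 𝓘(ℝ, EG) 𝓘(ℝ, EM) ∞ 𝒢.target :=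
  𝒢.isSubmersion_target.contMDiff

theorem mdiff_source (g : G) : MDifferentiableAt 𝓘(ℝ, EG) 𝓘(ℝ, EM) 𝒢.source g :=
  𝒢.contMDiff_source.mdifferentiableAt (by simp)

theorem mdiff_target (g : G) : MDifferentiableAt 𝓘(ℝ, EG) 𝓘(ℝ, EM) 𝒢.target g :=
  𝒢.contMDiff_target.mdifferentiableAt (by simp)

theorem mdiff_inv (g : G) : MDifferentiableAt 𝓘(ℝ, EG) 𝓘(ℝ, EG) 𝒢.inv g :=
  𝒢.contMDiff_inv.mdifferentiableAt (by simp)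

theorem contMDiffOn_mul : ContMDiffOn (𝓘(ℝ, EG).prod 𝓘(ℝ, EG)) 𝓘(ℝ, EG) ∞
    (fun p : G × G => 𝒢.mul p.1 p.2) {p : G × G | 𝒢.source p.1 = 𝒢.target p.2} :=
  𝒢.smooth_mul.contMDiffOn

theorem contMDiffOn_div : ContMDiffOn (𝓘(ℝ, EG).prod 𝓘(ℝ, EG)) 𝓘(ℝ, EG) ∞
    (fun p : G × G => 𝒢.mul p.1 (𝒢.inv p.2)) {p : G × G | 𝒢.source p.1 = 𝒢.source p.2} :=
  𝒢.contMDiffOn_mul.comp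
    (contMDiff_fst.prodMk (𝒢.contMDiff_inv.comp contMDiff_snd)).contMDiffOn
    fun p hp => by
      change 𝒢.source p.1 = 𝒢.target (𝒢.inv p.2)
      rw [𝒢.target_inv]; exact hp

section Smooth

variable {E'' H'' : Type*} [NormedAddCommGroup E''] [NormedSpace ℝ E''] [TopologicalSpace H'']
  {K : ModelWithCorners ℝ E'' H''} {P : Type*} [TopologicalSpace P] [ChartedSpace H'' P]

theorem contMDiffAt_mul {a b : P → G} {p : P} (ha : ContMDiffAt K 𝓘(ℝ, EG) ∞ a p)
    (hb : ContMDiffAt K 𝓘(ℝ, EG) ∞ b p) (h : ∀ᶠ q in 𝓝 p, 𝒢.source (a q) = 𝒢.target (b q)) :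
    ContMDiffAt K 𝓘(ℝ, EG) ∞ (fun q => 𝒢.mul (a q) (b q)) p :=
  𝒢.contMDiffOn_mul.comp_contMDiffAt_of_eventually (ha.prodMk hb) h

end Smooth

/-! ### Groupoid algebra -/

theorem inv_mul_cancel_left {g h : G} (H : 𝒢.source g = 𝒢.target h) :
    𝒢.mul (𝒢.inv g) (𝒢.mul g h) = h := by
  rw [← 𝒢.mul_assoc _ _ _ (𝒢.source_inv g) H, 𝒢.inv_mul, H, 𝒢.unit_mul]

theorem mul_inv_cancel_right {g h : G} (H : 𝒢.source g = 𝒢.target h) :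
    𝒢.mul (𝒢.mul g h) (𝒢.inv h) = g := by
  rw [𝒢.mul_assoc _ _ _ H (𝒢.target_inv h).symm, 𝒢.mul_inv, ← H, 𝒢.mul_unit]

theorem inv_mul_cancel_right {g h : G} (H : 𝒢.source g = 𝒢.source h) :
    𝒢.mul (𝒢.mul g (𝒢.inv h)) h = g := by
  rw [𝒢.mul_assoc _ _ _ (by rw [H, 𝒢.target_inv]) (𝒢.source_inv h), 𝒢.inv_mul, ← H, 𝒢.mul_unit]

theorem eq_inv_of_mul_eq_unit {g h : G} (H : 𝒢.source g = 𝒢.target h)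
    (h' : 𝒢.mul g h = 𝒢.unit (𝒢.target g)) : h = 𝒢.inv g := by
  rw [← 𝒢.inv_mul_cancel_left H, h', ← 𝒢.source_inv g, 𝒢.mul_unit]

theorem inv_inv (g : G) : 𝒢.inv (𝒢.inv g) = g :=
  (𝒢.eq_inv_of_mul_eq_unit (𝒢.source_inv g) (by rw [𝒢.inv_mul, 𝒢.target_inv])).symm

theorem source_div {a b : G} (h : 𝒢.source a = 𝒢.source b) :
    𝒢.source (𝒢.mul a (𝒢.inv b)) = 𝒢.target b := by
  rw [𝒢.source_mul _ _ (by rw [h, 𝒢.target_inv]), 𝒢.source_inv]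

theorem target_div {a b : G} (h : 𝒢.source a = 𝒢.source b) :
    𝒢.target (𝒢.mul a (𝒢.inv b)) = 𝒢.target a :=
  𝒢.target_mul _ _ (by rw [h, 𝒢.target_inv])

theorem inv_div {a b : G} (h : 𝒢.source a = 𝒢.source b) :
    𝒢.inv (𝒢.mul a (𝒢.inv b)) = 𝒢.mul b (𝒢.inv a) := by
  symm
  apply 𝒢.eq_inv_of_mul_eq_unit
  · rw [𝒢.source_div h, 𝒢.target_div h.symm]
  · rw [← 𝒢.mul_assoc _ _ _ (by rw [𝒢.source_div h]) (by rw [𝒢.target_inv, h]),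
      𝒢.inv_mul_cancel_right h, 𝒢.mul_inv, 𝒢.target_div h]

/-- Differentiated, this cancellation becomes `tangentDiv_tangentDiv_tangentDiv`, which is why
averaged quotients of a lift form a cocycle. -/
theorem div_div_div {a b c : G} (hac : 𝒢.source a = 𝒢.source c) (hbc : 𝒢.source b = 𝒢.source c) :
    𝒢.mul (𝒢.mul a (𝒢.inv c)) (𝒢.inv (𝒢.mul b (𝒢.inv c))) = 𝒢.mul a (𝒢.inv b) := by
  rw [𝒢.inv_div hbc, ← 𝒢.mul_assoc _ _ _ (by rw [𝒢.source_div hac]) (by rw [𝒢.target_inv, hbc]),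
    𝒢.inv_mul_cancel_right hac]

theorem mul_div {a b c : G} (hab : 𝒢.source a = 𝒢.target b) (hbc : 𝒢.source b = 𝒢.source c) :
    𝒢.mul (𝒢.mul a b) (𝒢.inv c) = 𝒢.mul a (𝒢.mul b (𝒢.inv c)) :=
  𝒢.mul_assoc _ _ _ hab (by rw [hbc, 𝒢.target_inv])

theorem div_unit {a : G} {x : M} (h : 𝒢.source a = x) : 𝒢.mul a (𝒢.inv (𝒢.unit x)) = a := by
  rw [𝒢.inv_unit, ← h, 𝒢.mul_unit]

/-! ### The tangent division map -/

/-- The tangent map of the division map `(p, q) ↦ pq⁻¹`. -/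
def tangentDiv (ξ η : TangentBundle 𝓘(ℝ, EG) G) : TangentBundle 𝓘(ℝ, EG) G :=
  ⟨𝒢.mul ξ.1 (𝒢.inv η.1), 𝒢.divDeriv ξ.1 η.1 (ξ.2, η.2)⟩

/-- The tangent map of the source map. -/
abbrev tangentSource (ξ : TangentBundle 𝓘(ℝ, EG) G) : TangentBundle 𝓘(ℝ, EM) M :=
  tangentMap 𝓘(ℝ, EG) 𝓘(ℝ, EM) 𝒢.source ξ

/-- The tangent map of the target map. -/
abbrev tangentTarget (ξ : TangentBundle 𝓘(ℝ, EG) G) : TangentBundle 𝓘(ℝ, EM) M :=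
  tangentMap 𝓘(ℝ, EG) 𝓘(ℝ, EM) 𝒢.target ξ

theorem source_eq_of_tangentSource_eq {ξ η : TangentBundle 𝓘(ℝ, EG) G}
    (h : 𝒢.tangentSource ξ = 𝒢.tangentSource η) : 𝒢.source ξ.1 = 𝒢.source η.1 :=
  congrArg (fun ζ : TangentBundle 𝓘(ℝ, EM) M => ζ.1) h

variable {𝒢}

theorem _root_.HasVelocity.div {a b : ℝ → G} {ξ η : TangentBundle 𝓘(ℝ, EG) G}
    (ha : HasVelocity 𝓘(ℝ, EG) a ξ) (hb : HasVelocity 𝓘(ℝ, EG) b η)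
    (h : ∀ᶠ τ in 𝓝 0, 𝒢.source (a τ) = 𝒢.source (b τ)) :
    HasVelocity 𝓘(ℝ, EG) (fun τ => 𝒢.mul (a τ) (𝒢.inv (b τ))) (𝒢.tangentDiv ξ η) := by
  have h0 := h.self_of_nhds
  rw [ha.apply_zero, hb.apply_zero] at h0
  exact (ha.prodMk hb).comp_within (f := fun p : G × G => 𝒢.mul p.1 (𝒢.inv p.2))
    ((𝒢.contMDiffOn_div (ξ.1, η.1) h0).mdifferentiableWithinAt (by simp)) h

theorem _root_.HasVelocity.mul_right {a : ℝ → G} {ξ : TangentBundle 𝓘(ℝ, EG) G} {g : G}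
    (ha : HasVelocity 𝓘(ℝ, EG) a ξ) (h : ∀ᶠ τ in 𝓝 0, 𝒢.source (a τ) = 𝒢.target g) :
    HasVelocity 𝓘(ℝ, EG) (fun τ => 𝒢.mul (a τ) g)
      ⟨𝒢.mul ξ.1 g, 𝒢.rightTranslation g ξ.1 ξ.2⟩ := by
  have h0 := h.self_of_nhds
  rw [ha.apply_zero] at h0
  refine ha.comp_within (f := fun p : G => 𝒢.mul p g) (S := {h | 𝒢.source h = 𝒢.target g}) ?_ h
  have h1 : ContMDiffOn 𝓘(ℝ, EG) 𝓘(ℝ, EG) ∞ (fun p : G => 𝒢.mul p g)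
      {h | 𝒢.source h = 𝒢.target g} :=
    𝒢.contMDiffOn_mul.comp (contMDiff_id.prodMk contMDiff_const).contMDiffOn fun p hp => hp
  exact (h1 _ h0).mdifferentiableWithinAt (by simp)

theorem _root_.HasVelocity.mul_left {a : ℝ → G} {ξ : TangentBundle 𝓘(ℝ, EG) G} {g : G}
    (ha : HasVelocity 𝓘(ℝ, EG) a ξ) (h : ∀ᶠ τ in 𝓝 0, 𝒢.target (a τ) = 𝒢.source g) :
    HasVelocity 𝓘(ℝ, EG) (fun τ => 𝒢.mul g (a τ))
      ⟨𝒢.mul g ξ.1, 𝒢.leftTranslation g ξ.1 ξ.2⟩ := by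
  have h0 := h.self_of_nhds
  rw [ha.apply_zero] at h0
  refine ha.comp_within (f := fun p : G => 𝒢.mul g p) (S := {h | 𝒢.target h = 𝒢.source g}) ?_ h
  have h1 : ContMDiffOn 𝓘(ℝ, EG) 𝓘(ℝ, EG) ∞ (fun p : G => 𝒢.mul g p)
      {h | 𝒢.target h = 𝒢.source g} :=
    𝒢.contMDiffOn_mul.comp (contMDiff_const.prodMk contMDiff_id).contMDiffOn fun p hp => hp.symm
  exact (h1 _ h0).mdifferentiableWithinAt (by simp)

theorem _root_.HasVelocity.source {a : ℝ → G} {ξ : TangentBundle 𝓘(ℝ, EG) G}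
    (ha : HasVelocity 𝓘(ℝ, EG) a ξ) :
    HasVelocity 𝓘(ℝ, EM) (fun τ => 𝒢.source (a τ)) (𝒢.tangentSource ξ) :=
  ha.comp (𝒢.mdiff_source _)

theorem _root_.HasVelocity.target {a : ℝ → G} {ξ : TangentBundle 𝓘(ℝ, EG) G}
    (ha : HasVelocity 𝓘(ℝ, EG) a ξ) :
    HasVelocity 𝓘(ℝ, EM) (fun τ => 𝒢.target (a τ)) (𝒢.tangentTarget ξ) :=
  ha.comp (𝒢.mdiff_target _)

variable (𝒢)

section Lifts

variable [FiniteDimensional ℝ EG]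

theorem exists_source_lift {ξ : TangentBundle 𝓘(ℝ, EG) G} {β : ℝ → M}
    (hβ : HasVelocity 𝓘(ℝ, EM) β (𝒢.tangentSource ξ)) :
    ∃ γ : ℝ → G, HasVelocity 𝓘(ℝ, EG) γ ξ ∧ ∀ᶠ τ in 𝓝 0, 𝒢.source (γ τ) = β τ := by
  obtain ⟨d, hd⟩ := 𝒢.isSubmersion_source.exists_fibredChart
  obtain ⟨c, hc⟩ := hd ξ.1
  exact c.exists_lift hc (𝒢.mdiff_source _) hβ

/-- Pairs of vectors with equal `ds` are realized by pairs of curves with equal source, because `s`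
is a submersion. Every identity for the division map thereby passes to tangent vectors. -/
theorem exists_curves {ξ η : TangentBundle 𝓘(ℝ, EG) G}
    (h : 𝒢.tangentSource ξ = 𝒢.tangentSource η) :
    ∃ a b : ℝ → G, HasVelocity 𝓘(ℝ, EG) a ξ ∧ HasVelocity 𝓘(ℝ, EG) b η ∧
      ∀ᶠ τ in 𝓝 0, 𝒢.source (a τ) = 𝒢.source (b τ) := by
  obtain ⟨a, ha⟩ := exists_hasVelocity ξ
  obtain ⟨b, hb, hab⟩ := 𝒢.exists_source_lift (h ▸ ha.source (𝒢 := 𝒢))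
  exact ⟨a, b, ha, hb, hab.mono fun τ hτ => hτ.symm⟩

theorem tangentSource_tangentDiv {ξ η : TangentBundle 𝓘(ℝ, EG) G}
    (h : 𝒢.tangentSource ξ = 𝒢.tangentSource η) :
    𝒢.tangentSource (𝒢.tangentDiv ξ η) = 𝒢.tangentTarget η := by
  obtain ⟨a, b, ha, hb, hab⟩ := 𝒢.exists_curves h
  exact (ha.div hb hab).source.unique_of_eventuallyEq hb.target (hab.mono fun τ hτ => 𝒢.source_div hτ)

theorem tangentDiv_tangentDiv_tangentDiv {ξ η ζ : TangentBundle 𝓘(ℝ, EG) G}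
    (h : 𝒢.tangentSource ξ = 𝒢.tangentSource ζ) (h' : 𝒢.tangentSource η = 𝒢.tangentSource ζ) :
    𝒢.tangentDiv (𝒢.tangentDiv ξ ζ) (𝒢.tangentDiv η ζ) = 𝒢.tangentDiv ξ η := by
  obtain ⟨a, c, ha, hc, hac⟩ := 𝒢.exists_curves h
  obtain ⟨b, hb, hbc⟩ := 𝒢.exists_source_lift (h' ▸ hc.source (𝒢 := 𝒢))
  refine ((ha.div hc hac).div (hb.div hc hbc) ?_).unique_of_eventuallyEq (ha.div hb ?_) ?_
  · filter_upwards [hac, hbc] with τ h1 h2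
    rw [𝒢.source_div h1, 𝒢.source_div h2]
  · filter_upwards [hac, hbc] with τ h1 h2
    rw [h1, h2]
  · filter_upwards [hac, hbc] with τ h1 h2 using 𝒢.div_div_div h1 h2

section SmoothTangentDiv

variable {E'' H'' : Type*} [NormedAddCommGroup E''] [NormedSpace ℝ E''] [TopologicalSpace H'']
  {K : ModelWithCorners ℝ E'' H''} {P : Type*} [TopologicalSpace P] [ChartedSpace H'' P]

/-- The tangent division map is the restriction of a map which is smooth on an open set. -/
theorem exists_extend_tangentDiv {p q : G} (hpq : 𝒢.source p = 𝒢.source q) :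
    ∃ U : Set (TangentBundle 𝓘(ℝ, EG) G × TangentBundle 𝓘(ℝ, EG) G), IsOpen U ∧
      (∀ z, z.1.1 = p → z.2.1 = q → z ∈ U) ∧
      ∃ T : TangentBundle 𝓘(ℝ, EG) G × TangentBundle 𝓘(ℝ, EG) G → TangentBundle 𝓘(ℝ, EG) G,
        ContMDiffOn (𝓘(ℝ, EG).tangent.prod 𝓘(ℝ, EG).tangent) 𝓘(ℝ, EG).tangent ∞ T U ∧
        ∀ z ∈ U, 𝒢.tangentSource z.1 = 𝒢.tangentSource z.2 → T z = 𝒢.tangentDiv z.1 z.2 := by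
  -- A local smooth extension of the multiplication near `(p, q⁻¹)` yields one of the division map,
  -- and the tangent map of the latter is the required extension.
  obtain ⟨U₀, hU₀, hmem, F₀, hF₀, hF₀m⟩ := 𝒢.smooth_mul ⟨(p, 𝒢.inv q), by
    simpa [𝒢.target_inv] using hpq⟩
  have hι : ContMDiff (𝓘(ℝ, EG).prod 𝓘(ℝ, EG)) (𝓘(ℝ, EG).prod 𝓘(ℝ, EG)) ∞
      (fun z : G × G => (z.1, 𝒢.inv z.2)) :=
    contMDiff_fst.prodMk (𝒢.contMDiff_inv.comp contMDiff_snd)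
  set U : Set (G × G) := (fun z : G × G => (z.1, 𝒢.inv z.2)) ⁻¹' U₀ with hUdef
  have hU : IsOpen U := hU₀.preimage hι.continuous
  set F : G × G → G := fun z => F₀ (z.1, 𝒢.inv z.2) with hFdef
  have hF : ContMDiffOn (𝓘(ℝ, EG).prod 𝓘(ℝ, EG)) 𝓘(ℝ, EG) ∞ F U :=
    hF₀.comp hι.contMDiffOn fun _ h => h
  have hFm : ∀ z ∈ U, 𝒢.source z.1 = 𝒢.source z.2 → F z = 𝒢.mul z.1 (𝒢.inv z.2) := by
    intro z hz hs
    exact hF₀m ⟨(z.1, 𝒢.inv z.2), by simpa [𝒢.target_inv] using hs⟩ hz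
  have hT := hF.contMDiffOn_tangentMapWithin (m := ∞) (by simp) hU.uniqueMDiffOn
  have hpair := contMDiff_equivTangentBundleProd_symm (I := 𝓘(ℝ, EG)) (I' := 𝓘(ℝ, EG))
    (M := G) (M' := G) (n := ∞)
  have hcont : Continuous fun z : TangentBundle 𝓘(ℝ, EG) G × TangentBundle 𝓘(ℝ, EG) G =>
      (z.1.1, z.2.1) := by
    have h1 : Continuous (fun z : TangentBundle 𝓘(ℝ, EG) G => z.1) :=
      (Bundle.contMDiff_proj (n := ∞) (IB := 𝓘(ℝ, EG))
        (TangentSpace 𝓘(ℝ, EG) : G → Type _)).continuous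
    exact (h1.comp continuous_fst).prodMk (h1.comp continuous_snd)
  refine ⟨(fun z => (z.1.1, z.2.1)) ⁻¹' U, hU.preimage hcont, ?_, _,
    hT.comp hpair.contMDiffOn fun z hz => hz, ?_⟩
  · intro z h1 h2
    change (z.1.1, 𝒢.inv z.2.1) ∈ U₀
    rw [h1, h2]; exact hmem
  · rintro ⟨ξ, η⟩ hz hs
    change tangentMapWithin (𝓘(ℝ, EG).prod 𝓘(ℝ, EG)) 𝓘(ℝ, EG) F U
      ⟨(ξ.1, η.1), (ξ.2, η.2)⟩ = 𝒢.tangentDiv ξ η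
    -- Along curves with equal source the extension is the division map, so the two tangent maps
    -- give the same velocity.
    obtain ⟨a, b, ha, hb, hab⟩ := 𝒢.exists_curves hs
    have hev : ∀ᶠ τ in 𝓝 0, (a τ, b τ) ∈ U := by
      refine (ha.continuousAt.prodMk hb.continuousAt).preimage_mem_nhds (hU.mem_nhds ?_)
      rw [ha.apply_zero, hb.apply_zero]; exact hz
    refine ((ha.prodMk hb).comp_within (f := F) ((hF _ hz).mdifferentiableWithinAt (by simp))
      hev).unique_of_eventuallyEq (ha.div hb hab) ?_
    filter_upwards [hev, hab] with τ h1 h2 using hFm _ h1 h2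

theorem contMDiffAt_tangentDiv {ξ η : P → TangentBundle 𝓘(ℝ, EG) G} {p : P}
    (hξ : ContMDiffAt K 𝓘(ℝ, EG).tangent ∞ ξ p) (hη : ContMDiffAt K 𝓘(ℝ, EG).tangent ∞ η p)
    (h : ∀ᶠ q in 𝓝 p, 𝒢.tangentSource (ξ q) = 𝒢.tangentSource (η q)) :
    ContMDiffAt K 𝓘(ℝ, EG).tangent ∞ (fun q => 𝒢.tangentDiv (ξ q) (η q)) p := by
  obtain ⟨U, hU, hmem, T, hT, hTe⟩ :=
    𝒢.exists_extend_tangentDiv (𝒢.source_eq_of_tangentSource_eq h.self_of_nhds)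
  have hpU : (ξ p, η p) ∈ U := hmem _ rfl rfl
  have h1 : ContMDiffAt K 𝓘(ℝ, EG).tangent ∞ (fun q => T (ξ q, η q)) p :=
    ((hT.contMDiffAt (hU.mem_nhds hpU))).comp p (hξ.prodMk hη)
  refine h1.congr_of_eventuallyEq ?_
  filter_upwards [h, (hξ.continuousAt.prodMk hη.continuousAt).preimage_mem_nhds
    (hU.mem_nhds hpU)] with q hq hqU
  exact (hTe _ hqU hq).symm

end SmoothTangentDiv

end Lifts

end LieGroupoid

/-! ### Smooth dependence of integrals on parameters. -/

section ParametricIntegral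

instance ModelWithCorners.boundaryless_pi {n : ℕ} {E : Type*} [NormedAddCommGroup E]
    [NormedSpace ℝ E] : (ModelWithCorners.pi fun _ : Fin n => 𝓘(ℝ, E)).Boundaryless :=
  ⟨Set.eq_univ_of_forall fun y => ⟨y, rfl⟩⟩

variable {EP HP E' F : Type*} [NormedAddCommGroup EP] [NormedSpace ℝ EP] [TopologicalSpace HP]
  {K : ModelWithCorners ℝ EP HP} [K.Boundaryless] {P : Type*} [TopologicalSpace P]
  [ChartedSpace HP P] [IsManifold K ∞ P] [NormedAddCommGroup E'] [NormedSpace ℝ E']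
  [NormedAddCommGroup F] [NormedSpace ℝ F] [FiniteDimensional ℝ F] [MeasurableSpace F]
  [BorelSpace F] {μ : Measure F} [IsLocallyFiniteMeasure μ]

/-- Smooth dependence on parameters of integrals of smooth functions with uniformly compact
support. -/
theorem contMDiffAt_integral_of_compact_support {Ψ : P → F → E'} {U : Set P} (hU : IsOpen U)
    {p₀ : P} (hp₀ : p₀ ∈ U) {k : Set F} (hk : IsCompact k) (h0 : ∀ p ∈ U, ∀ v, v ∉ k → Ψ p v = 0)
    (hΨ : ∀ p ∈ U, ∀ v, ContMDiffAt (K.prod 𝓘(ℝ, F)) 𝓘(ℝ, E') ∞ (fun z : P × F => Ψ z.1 z.2) (p, v)) :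
    ContMDiffAt K 𝓘(ℝ, E') ∞ (fun p => ∫ v, Ψ p v ∂μ) p₀ := by
  set e := extChartAt K p₀
  set S : Set EP := e.target ∩ e.symm ⁻¹' U
  have hS : IsOpen S :=
    (continuousOn_extChartAt_symm p₀).isOpen_inter_preimage (isOpen_extChartAt_target p₀) hU
  have hsymm : ContMDiffOn 𝓘(ℝ, EP) K ∞ e.symm e.target := contMDiffOn_extChartAt_symm p₀
  have hg : ContDiffOn ℝ ∞ (Function.uncurry fun (q : EP) (v : F) => Ψ (e.symm q) (-v))
      (S ×ˢ univ) := by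
    rw [← contMDiffOn_iff_contDiffOn]
    rintro ⟨q, v⟩ ⟨⟨hq, hqU⟩, -⟩
    refine ContMDiffAt.contMDiffWithinAt ?_
    have h1 : ContMDiffAt 𝓘(ℝ, EP × F) K ∞ (fun z : EP × F => e.symm z.1) (q, v) :=
      (hsymm.contMDiffAt ((isOpen_extChartAt_target p₀).mem_nhds hq)).comp (q, v)
        contDiff_fst.contMDiff.contMDiffAt
    have h2 : ContMDiffAt 𝓘(ℝ, EP × F) 𝓘(ℝ, F) ∞ (fun z : EP × F => -z.2) (q, v) :=
      contDiff_snd.neg.contMDiff.contMDiffAt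
    exact (hΨ _ hqU (-v)).comp (q, v) (h1.prodMk h2)
  have hkneg : IsCompact (-k) := hk.neg
  -- The integral is the convolution of the constant `1` with `v ↦ Ψ p (-v)`, evaluated at `0`; this
  -- explains the sign.
  have hconv := contDiffOn_convolution_right_with_param_comp (μ := μ) (n := ⊤)
    (ContinuousLinearMap.lsmul ℝ ℝ : ℝ →L[ℝ] E' →L[ℝ] E') (v := fun _ : EP => (0 : F))
    contDiffOn_const (f := fun _ : F => (1 : ℝ)) hS hkneg
    (g := fun (q : EP) (v : F) => Ψ (e.symm q) (-v))
    (fun q v hq hv => h0 _ hq.2 _ (by simpa using hv)) (locallyIntegrable_const 1) hg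
  rw [contMDiffAt_iff_source, K.range_eq_univ, contMDiffWithinAt_univ]
  have hmem : e p₀ ∈ S := ⟨mem_extChartAt_target p₀, by
    change e.symm (e p₀) ∈ U
    rwa [extChartAt_to_inv p₀]⟩
  have h2 := (hconv.contDiffAt (hS.mem_nhds hmem)).contMDiffAt
  refine h2.congr_of_eventuallyEq (Eventually.of_forall fun q => ?_)
  simp [MeasureTheory.convolution]
  rfl

end ParametricIntegral

/-! ### Integration along the fibres of a submersion. -/

section FibreIntegral

variable {EM EG M G : Type*}
  [NormedAddCommGroup EM] [NormedSpace ℝ EM] [NormedAddCommGroup EG] [NormedSpace ℝ EG]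
  [TopologicalSpace M] [ChartedSpace EM M]
  [TopologicalSpace G] [ChartedSpace EG G] {f : G → M} {d : ℕ}
  {E' E'' : Type*} [NormedAddCommGroup E'] [NormedSpace ℝ E']
  [NormedAddCommGroup E''] [NormedSpace ℝ E'']

namespace FibredChart

variable (c : FibredChart EM EG f (Fin d → ℝ))

/-- The set of fibre coordinates of the points over `x`. -/
def fibre (x : M) : Set (Fin d → ℝ) := {v | (x, v) ∈ c.target}

/-- The integral, in the coordinates of the chart, of a function along the fibre over `x`. -/
def integral (x : M) (φ : G → E') : E' := ∫ v in c.fibre x, φ (c.param (x, v))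

theorem isOpen_fibre (x : M) : IsOpen (c.fibre x) :=
  c.open_target.preimage (Continuous.prodMk_right x)

theorem continuousOn_param_fibre (x : M) : ContinuousOn (fun v => c.param (x, v)) (c.fibre x) :=
  c.contMDiffOn_param.continuousOn.comp (Continuous.prodMk_right x).continuousOn fun _ h => h

theorem integral_congr {x : M} {φ ψ : G → E'} (h : ∀ y ∈ c.source, f y = x → φ y = ψ y) :
    c.integral x φ = c.integral x ψ :=
  setIntegral_congr_fun (c.isOpen_fibre x).measurableSet fun _ hv =>
    h _ (c.map_target _ hv) (c.fst_param _ hv)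

variable [T2Space M]

/-- The fibre is merely open in coordinate space, but the integrand vanishes off the compact trace
of `k` on it, so continuity suffices. -/
theorem integrableOn (hf : Continuous f) {x : M} {φ : G → E'} {k : Set G} (hk : IsCompact k)
    (hks : k ⊆ c.source) (hφ : ContinuousOn φ (f ⁻¹' {x})) (h0 : ∀ y, f y = x → y ∉ k → φ y = 0) :
    IntegrableOn (fun v => φ (c.param (x, v))) (c.fibre x) := by
  have hk' : IsCompact (c.coord '' (k ∩ f ⁻¹' {x})) :=
    (hk.inter_right (isClosed_singleton.preimage hf)).image_of_continuousOn
      (c.contMDiffOn_coord.continuousOn.mono fun y hy => hks hy.1)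
  have hsub : c.coord '' (k ∩ f ⁻¹' {x}) ⊆ c.fibre x := by
    rintro _ ⟨y, ⟨hy, rfl⟩, rfl⟩
    exact c.map_source y (hks hy)
  have hcont : ContinuousOn (fun v => φ (c.param (x, v))) (c.fibre x) :=
    hφ.comp (c.continuousOn_param_fibre x) fun v hv => c.fst_param _ hv
  refine IntegrableOn.of_forall_sdiff_eq_zero ((hcont.mono hsub).integrableOn_compact hk')
    (c.isOpen_fibre x).measurableSet fun v hv => h0 _ (c.fst_param _ hv.1) fun hmem => hv.2 ?_
  exact ⟨_, ⟨hmem, c.fst_param _ hv.1⟩, c.coord_param _ hv.1⟩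

variable {EP HP : Type*} [NormedAddCommGroup EP] [NormedSpace ℝ EP] [TopologicalSpace HP]
  {K : ModelWithCorners ℝ EP HP} [K.Boundaryless] {P : Type*} [TopologicalSpace P]
  [ChartedSpace HP P] [IsManifold K ∞ P]

/-- The domain of integration moves with `x p`. Extending the integrand by zero gives a smooth
function supported in the fixed compact set `coord '' k`. As `Φ p y` matters only for `f y = x p`,
smoothness is asked of local extensions off this constraint. -/
theorem contMDiffAt_integral (hf : Continuous f) {k : Set G} (hk : IsCompact k)
    (hks : k ⊆ c.source) {x : P → M}
    {Φ : P → G → E'} {U : Set P} (hU : IsOpen U) {p₀ : P} (hp₀ : p₀ ∈ U)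
    (hx : ContMDiffOn K 𝓘(ℝ, EM) ∞ x U) (h0 : ∀ p y, f y = x p → y ∉ k → Φ p y = 0)
    (hΦ : ∀ p ∈ U, ∀ y, f y = x p → ∃ Φ' : P × G → E',
      ContMDiffAt (K.prod 𝓘(ℝ, EG)) 𝓘(ℝ, E') ∞ Φ' (p, y) ∧
      ∀ᶠ z in 𝓝 (p, y), f z.2 = x z.1 → Φ' z = Φ z.1 z.2) :
    ContMDiffAt K 𝓘(ℝ, E') ∞ (fun p => c.integral (x p) (Φ p)) p₀ := by
  classical
  set Ψ : P → (Fin d → ℝ) → E' := fun p =>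
    (c.fibre (x p)).indicator fun v => Φ p (c.param (x p, v)) with hΨdef
  have hint : ∀ p, c.integral (x p) (Φ p) = ∫ v, Ψ p v := fun p =>
    (integral_indicator (c.isOpen_fibre (x p)).measurableSet).symm
  simp_rw [hint]
  have hkc : IsCompact ((fun y => (f y, c.coord y)) '' k) :=
    hk.image_of_continuousOn (hf.continuousOn.prodMk (c.contMDiffOn_coord.continuousOn.mono hks))
  have hkey : ∀ p v, (x p, v) ∉ (fun y => (f y, c.coord y)) '' k → Ψ p v = 0 := by
    intro p v hv
    by_cases hm : v ∈ c.fibre (x p)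
    · simp only [hΨdef, indicator_of_mem hm]
      refine h0 _ _ (c.fst_param _ hm) fun hmem => hv ⟨_, hmem, ?_⟩
      exact Prod.ext (c.fst_param _ hm) (c.coord_param _ hm)
    · exact indicator_of_notMem hm _
  refine contMDiffAt_integral_of_compact_support hU hp₀
    (hk.image_of_continuousOn (c.contMDiffOn_coord.continuousOn.mono hks)) ?_ ?_
  · intro p _ v hv
    refine hkey p v ?_
    rintro ⟨y, hy, hyv⟩
    exact hv ⟨y, hy, congrArg Prod.snd hyv⟩
  · intro p hp v
    have hxp : ContMDiffAt K 𝓘(ℝ, EM) ∞ x p := hx.contMDiffAt (hU.mem_nhds hp)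
    have hpair : ContMDiffAt (K.prod 𝓘(ℝ, Fin d → ℝ)) (𝓘(ℝ, EM).prod 𝓘(ℝ, Fin d → ℝ)) ∞
        (fun z : P × (Fin d → ℝ) => (x z.1, z.2)) (p, v) :=
      (hxp.comp (p, v) contMDiffAt_fst).prodMk contMDiffAt_snd
    -- Inside the target of the chart smoothness is the hypothesis. Outside it, the image of `k` is
    -- closed and misses the point, so the extended integrand is zero nearby.
    by_cases hm : (x p, v) ∈ c.target
    · obtain ⟨Φ', hΦ', hΦe⟩ := hΦ p hp (c.param (x p, v)) (c.fst_param _ hm)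
      have hpar : ContMDiffAt (K.prod 𝓘(ℝ, Fin d → ℝ)) (K.prod 𝓘(ℝ, EG)) ∞
          (fun z : P × (Fin d → ℝ) => (z.1, c.param (x z.1, z.2))) (p, v) :=
        contMDiffAt_fst.prodMk
          ((c.contMDiffOn_param.contMDiffAt (c.open_target.mem_nhds hm)).comp (p, v) hpair)
      refine (ContMDiffAt.comp (p, v) (g := Φ') hΦ' hpar).congr_of_eventuallyEq ?_
      filter_upwards [hpair.continuousAt.preimage_mem_nhds (c.open_target.mem_nhds hm),
        hpar.continuousAt.eventually hΦe] with z hz hz'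
      have hz1 : z.2 ∈ c.fibre (x z.1) := hz
      simp only [hΨdef, indicator_of_mem hz1]
      exact (hz' (c.fst_param _ hz)).symm
    · have hm' : (x p, v) ∉ (fun y => (f y, c.coord y)) '' k := by
        rintro ⟨y, hy, hyv⟩
        exact hm (hyv ▸ c.map_source y (hks hy))
      refine (contMDiffAt_const (c := (0 : E'))).congr_of_eventuallyEq ?_
      filter_upwards [hpair.continuousAt.preimage_mem_nhds
        (hkc.isClosed.isOpen_compl.mem_nhds hm')] with z hz
      exact hkey _ _ hz

end FibredChart

/-- A smooth family of measures along the fibres of `f`, given in fibred charts by smooth densities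
with compact support. -/
structure FibreIntegral (EM EG : Type*) [NormedAddCommGroup EM] [NormedSpace ℝ EM]
    [NormedAddCommGroup EG] [NormedSpace ℝ EG] {M G : Type*}
    [TopologicalSpace M] [ChartedSpace EM M] [TopologicalSpace G] [ChartedSpace EG G]
    (f : G → M) (d : ℕ) where
  index : Type*
  chart : index → FibredChart EM EG f (Fin d → ℝ)
  weight : index → G → ℝ
  supp : index → Set G
  contMDiff_weight : ∀ i, ContMDiff 𝓘(ℝ, EG) 𝓘(ℝ, ℝ) ∞ (weight i)
  isCompact_supp : ∀ i, IsCompact (supp i)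
  supp_subset : ∀ i, supp i ⊆ (chart i).source
  weight_eq_zero : ∀ i h, h ∉ supp i → weight i h = 0
  locallyFinite : ∀ x, ∃ N ∈ 𝓝 x, {i | ∃ h, f h ∈ N ∧ weight i h ≠ 0}.Finite

namespace FibreIntegral

variable (A : FibreIntegral EM EG f d)

/-- The integral of a function along the fibre over `x`. -/
def integral (x : M) (φ : G → E') : E' :=
  ∑ᶠ i, (A.chart i).integral x fun h => A.weight i h • φ h

theorem integral_congr {x : M} {φ ψ : G → E'} (h : ∀ y, f y = x → φ y = ψ y) :
    A.integral x φ = A.integral x ψ :=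
  finsum_congr fun i => (A.chart i).integral_congr fun y _ hy => by simp only [h y hy]

theorem term_eq_zero {x : M} {i : A.index} (h : ∀ y, f y = x → A.weight i y = 0) (φ : G → E') :
    (A.chart i).integral x (fun h => A.weight i h • φ h) = 0 := by
  rw [(A.chart i).integral_congr (ψ := fun _ => 0) fun y _ hy => by rw [h y hy, zero_smul]]
  simp [FibredChart.integral]

theorem integral_eq_sum {x : M} {s : Finset A.index} (hs : ∀ i y, f y = x → A.weight i y ≠ 0 → i ∈ s)
    (φ : G → E') :
    A.integral x φ = ∑ i ∈ s, (A.chart i).integral x fun h => A.weight i h • φ h := by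
  refine finsum_eq_sum_of_support_subset _ fun i hi => ?_
  by_contra hn
  refine hi (A.term_eq_zero (fun y hy => ?_) φ)
  by_contra hw
  exact hn (hs i y hy hw)

theorem eventually_finite (x₀ : M) :
    ∃ s : Finset A.index, ∀ᶠ x in 𝓝 x₀, ∀ i y, f y = x → A.weight i y ≠ 0 → i ∈ s := by
  obtain ⟨N, hN, hfin⟩ := A.locallyFinite x₀
  refine ⟨hfin.toFinset, ?_⟩
  filter_upwards [hN] with x hx i y hy hw
  rw [Set.Finite.mem_toFinset]
  exact ⟨y, by rwa [hy], hw⟩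

variable [T2Space M]

theorem term_integrableOn (hf : Continuous f) {x : M} {φ : G → E'}
    (hφ : ContinuousOn φ (f ⁻¹' {x})) (i : A.index) :
    IntegrableOn (fun v => A.weight i ((A.chart i).param (x, v)) • φ ((A.chart i).param (x, v)))
      ((A.chart i).fibre x) :=
  (A.chart i).integrableOn (φ := fun h => A.weight i h • φ h) hf (A.isCompact_supp i)
    (A.supp_subset i) ((A.contMDiff_weight i).continuous.continuousOn.smul hφ)
    fun y _ hy => by rw [A.weight_eq_zero i y hy, zero_smul]

theorem integral_add (hf : Continuous f) {x : M} {φ ψ : G → E'}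
    (hφ : ContinuousOn φ (f ⁻¹' {x})) (hψ : ContinuousOn ψ (f ⁻¹' {x})) :
    A.integral x (fun y => φ y + ψ y) = A.integral x φ + A.integral x ψ := by
  obtain ⟨s, hs⟩ := A.eventually_finite x
  rw [A.integral_eq_sum hs.self_of_nhds, A.integral_eq_sum hs.self_of_nhds,
    A.integral_eq_sum hs.self_of_nhds, ← Finset.sum_add_distrib]
  refine Finset.sum_congr rfl fun i _ => ?_
  simp only [FibredChart.integral, smul_add]
  exact MeasureTheory.integral_add (A.term_integrableOn hf hφ i) (A.term_integrableOn hf hψ i)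

theorem integral_comp_clm [CompleteSpace E'] [CompleteSpace E''] (hf : Continuous f) {x : M}
    {φ : G → E'} (hφ : ContinuousOn φ (f ⁻¹' {x})) (L : E' →L[ℝ] E'') :
    A.integral x (fun y => L (φ y)) = L (A.integral x φ) := by
  obtain ⟨s, hs⟩ := A.eventually_finite x
  rw [A.integral_eq_sum hs.self_of_nhds, A.integral_eq_sum hs.self_of_nhds, map_sum]
  refine Finset.sum_congr rfl fun i _ => ?_
  simp only [FibredChart.integral, ← L.map_smul]
  exact L.integral_comp_comm (A.term_integrableOn hf hφ i)

theorem integral_smul_const [CompleteSpace E'] (hf : Continuous f) {x : M} {φ : G → ℝ}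
    (hφ : ContinuousOn φ (f ⁻¹' {x})) (a : E') :
    A.integral x (fun y => φ y • a) = A.integral x φ • a :=
  A.integral_comp_clm hf hφ ((ContinuousLinearMap.id ℝ ℝ).smulRight a)

variable {EP HP : Type*} [NormedAddCommGroup EP] [NormedSpace ℝ EP] [TopologicalSpace HP]
  {K : ModelWithCorners ℝ EP HP} [K.Boundaryless] {P : Type*} [TopologicalSpace P]
  [ChartedSpace HP P] [IsManifold K ∞ P]

theorem contMDiffAt_integral (hf : Continuous f) {x : P → M} {Φ : P → G → E'} {U : Set P}
    (hU : IsOpen U) {p₀ : P} (hp₀ : p₀ ∈ U) (hx : ContMDiffOn K 𝓘(ℝ, EM) ∞ x U)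
    (hΦ : ∀ p ∈ U, ∀ y, f y = x p → ∃ Φ' : P × G → E',
      ContMDiffAt (K.prod 𝓘(ℝ, EG)) 𝓘(ℝ, E') ∞ Φ' (p, y) ∧
      ∀ᶠ z in 𝓝 (p, y), f z.2 = x z.1 → Φ' z = Φ z.1 z.2) :
    ContMDiffAt K 𝓘(ℝ, E') ∞ (fun p => A.integral (x p) (Φ p)) p₀ := by
  obtain ⟨s, hs⟩ := A.eventually_finite (x p₀)
  have hxc : ContinuousAt x p₀ := (hx.contMDiffAt (hU.mem_nhds hp₀)).continuousAt
  have hsum : ContMDiffAt K 𝓘(ℝ, E') ∞ (fun p => ∑ i ∈ s,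
      (A.chart i).integral (x p) (fun h => A.weight i h • Φ p h)) p₀ := by
    refine ContMDiffAt.sum fun i _ => ?_
    refine (A.chart i).contMDiffAt_integral hf (A.isCompact_supp i) (A.supp_subset i) hU hp₀ hx
      (fun p y _ hy => by rw [A.weight_eq_zero i y hy, zero_smul]) fun p hp y hy => ?_
    obtain ⟨Φ', h1, h2⟩ := hΦ p hp y hy
    refine ⟨fun z => A.weight i z.2 • Φ' z,
      ((A.contMDiff_weight i).contMDiffAt.comp (p, y) contMDiffAt_snd).smul h1, ?_⟩
    filter_upwards [h2] with z hz hzx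
    rw [hz hzx]
  refine hsum.congr_of_eventuallyEq ?_
  filter_upwards [hxc.eventually hs] with p hp using A.integral_eq_sum hp _

end FibreIntegral

end FibreIntegral

/-! ### Saturations and cut-off functions. -/

namespace LieGroupoid

variable {EM EG M G : Type*}
  [NormedAddCommGroup EM] [NormedSpace ℝ EM] [NormedAddCommGroup EG] [NormedSpace ℝ EG]
  [TopologicalSpace M] [ChartedSpace EM M] [IsManifold 𝓘(ℝ, EM) ∞ M]
  [TopologicalSpace G] [ChartedSpace EG G] [IsManifold 𝓘(ℝ, EG) ∞ G]
  (𝒢 : LieGroupoid EM EG M G)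

/-- The local section `y ↦ param (y, coord x)` through `x` carries points near `f x` into any given
neighbourhood of `x`. -/
theorem _root_.FibredChart.isOpenMap {F : Type*} [NormedAddCommGroup F] [NormedSpace ℝ F]
    {f : G → M} (h : ∀ x, ∃ c : FibredChart EM EG f F, x ∈ c.source) : IsOpenMap f := by
  refine isOpenMap_iff_nhds_le.2 fun x => ?_
  intro s hs
  obtain ⟨c, hc⟩ := h x
  have h1 : ContinuousAt (fun y : M => c.param (y, c.coord x)) (f x) :=
    ContinuousAt.comp (g := c.param)
      (c.contMDiffOn_param.continuousOn.continuousAt (c.open_target.mem_nhds (c.map_source x hc)))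
      (Continuous.prodMk_left (c.coord x)).continuousAt
  have h2 : ∀ᶠ y in 𝓝 (f x), c.param (y, c.coord x) ∈ f ⁻¹' s :=
    h1.preimage_mem_nhds (by rw [c.left_inv x hc]; exact hs)
  have h3 : ∀ᶠ y in 𝓝 (f x), (y, c.coord x) ∈ c.target :=
    (Continuous.prodMk_left (c.coord x)).continuousAt.preimage_mem_nhds
      (c.open_target.mem_nhds (c.map_source x hc))
  filter_upwards [h2, h3] with y hy hy'
  have := c.fst_param _ hy'
  rw [mem_preimage, this] at hy
  exact hy

/-- The union of the orbits which meet `A`. -/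
def saturation (A : Set M) : Set M := 𝒢.source '' (𝒢.target ⁻¹' A)

theorem subset_saturation (A : Set M) : A ⊆ 𝒢.saturation A := fun x hx =>
  ⟨𝒢.unit x, by rwa [mem_preimage, 𝒢.target_unit], 𝒢.source_unit x⟩

theorem saturation_mono {A B : Set M} (h : A ⊆ B) : 𝒢.saturation A ⊆ 𝒢.saturation B :=
  image_mono (preimage_mono h)

theorem isOpen_saturation [FiniteDimensional ℝ EG] {A : Set M} (hA : IsOpen A) :
    IsOpen (𝒢.saturation A) := by
  obtain ⟨d, hd⟩ := 𝒢.isSubmersion_source.exists_fibredChart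
  exact FibredChart.isOpenMap hd _ (hA.preimage 𝒢.contMDiff_target.continuous)

variable {𝒢}

/-- A proper map has closed range, so the orbit relation is closed in `M × M`; the tube lemma then
separates a point outside the saturation from the compact set `A`. -/
theorem IsProper.isClosed_saturation (h𝒢 : 𝒢.IsProper) {A : Set M} (hA : IsCompact A) :
    IsClosed (𝒢.saturation A) := by
  have hZ : IsClosed (range fun g : G => (𝒢.source g, 𝒢.target g)) :=
    h𝒢.isProperMap.isClosedMap.isClosed_range
  refine isOpen_compl_iff.1 (isOpen_iff_mem_nhds.2 fun y hy => ?_)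
  have hsub : ({y} : Set M) ×ˢ A ⊆ (range fun g : G => (𝒢.source g, 𝒢.target g))ᶜ := by
    rintro ⟨y', x⟩ ⟨rfl, hx⟩ ⟨g, hg⟩
    rw [Prod.mk.injEq] at hg
    exact hy ⟨g, by rw [mem_preimage, hg.2]; exact hx, hg.1⟩
  obtain ⟨u, v, hu, -, hyu, hAv, huv⟩ :=
    generalized_tube_lemma isCompact_singleton hA hZ.isOpen_compl hsub
  refine mem_of_superset (hu.mem_nhds (hyu rfl)) ?_
  rintro y' hy' ⟨g, hg, rfl⟩
  exact huv (mk_mem_prod hy' (hAv hg)) ⟨g, rfl⟩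

theorem IsProper.isCompact_preimage (h𝒢 : 𝒢.IsProper) {A B : Set M} (hA : IsCompact A)
    (hB : IsCompact B) : IsCompact (𝒢.source ⁻¹' A ∩ 𝒢.target ⁻¹' B) :=
  h𝒢.isProperMap.isCompact_preimage (hA.prod hB)

variable [FiniteDimensional ℝ EM] [FiniteDimensional ℝ EG] [T2Space M] [SecondCountableTopology M]

/-- Countability is assumed of `M` only. Properness pulls a compact exhaustion of `M` back to `G`,
where partitions of unity will be needed. -/
theorem IsProper.sigmaCompactSpace (h𝒢 : 𝒢.IsProper) : SigmaCompactSpace G := by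
  have : LocallyCompactSpace M := ChartedSpace.locallyCompactSpace EM M
  refine ⟨fun n => 𝒢.source ⁻¹' compactCovering M n ∩ 𝒢.target ⁻¹' compactCovering M n,
    fun n => h𝒢.isCompact_preimage (isCompact_compactCovering M n) (isCompact_compactCovering M n),
    eq_univ_of_forall fun g => ?_⟩
  obtain ⟨m, hm⟩ := exists_mem_compactCovering (𝒢.source g)
  obtain ⟨n, hn⟩ := exists_mem_compactCovering (𝒢.target g)
  exact mem_iUnion.2 ⟨max m n, compactCovering_subset M (le_max_left m n) hm,
    compactCovering_subset M (le_max_right m n) hn⟩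

/-- A proper Lie groupoid has cut-off functions. -/
theorem IsProper.exists_cutoff (h𝒢 : 𝒢.IsProper) :
    ∃ c : M → ℝ, ContMDiff 𝓘(ℝ, EM) 𝓘(ℝ, ℝ) ∞ c ∧ (∀ x, 0 ≤ c x) ∧
      (∀ x, ∃ h, 𝒢.target h = x ∧ 0 < c (𝒢.source h)) ∧
      ∀ x, ∃ N ∈ 𝓝 x, ∃ K : Set G, IsCompact K ∧
        ∀ h, 𝒢.target h ∈ N → c (𝒢.source h) ≠ 0 → h ∈ K := by
  have : LocallyCompactSpace M := ChartedSpace.locallyCompactSpace EM M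
  -- The two shifts make `K 0` and `K 1` empty, so the first `K n` that meets a given orbit has `n =
  -- m + 2`, and `f m` is available for it.
  set K : CompactExhaustion M := (CompactExhaustion.choice M).shiftr.shiftr
  have hK0 : K 0 = ∅ := rfl
  have hK1 : K 1 = ∅ := rfl
  have hsat : ∀ n, 𝒢.saturation (K n) ⊆ 𝒢.saturation (interior (K (n + 1))) := fun n =>
    𝒢.saturation_mono (K.subset_interior_succ n)
  -- `f n` takes care of the orbits that reach `K (n + 2)` but avoid the interior of `K (n + 1)`; it
  -- dies on orbits that meet `K n` and outside `K (n + 3)`.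
  have hex : ∀ n, ∃ f : C^∞⟮𝓘(ℝ, EM), M; 𝓘(ℝ, ℝ), ℝ⟯,
      EqOn f 0 ((interior (K (n + 3)))ᶜ ∪ 𝒢.saturation (K n)) ∧
      EqOn f 1 (K (n + 2) \ 𝒢.saturation (interior (K (n + 1)))) ∧ ∀ x, f x ∈ Icc (0 : ℝ) 1 := by
    intro n
    refine exists_contMDiffMap_zero_one_of_isClosed 𝓘(ℝ, EM)
      (isOpen_interior.isClosed_compl.union (h𝒢.isClosed_saturation (K.isCompact n)))
      ((K.isCompact (n + 2)).isClosed.sdiff (𝒢.isOpen_saturation isOpen_interior)) ?_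
    rw [disjoint_left]
    rintro x (hx | hx) ⟨h1, h2⟩
    · exact hx (K.subset_interior_succ (n + 2) h1)
    · exact h2 (hsat n hx)
  choose f hf0 hf1 hf using hex
  -- On `K (N + 1)` every `f m` with `m ≥ N + 1` vanishes, since `K m` lies in its own saturation.
  have hlf : LocallyFinite fun n => Function.support (f n) := by
    intro x
    obtain ⟨N, hN⟩ := mem_iUnion.1 (K.iUnion_eq ▸ mem_univ x : x ∈ ⋃ n, K n)
    refine ⟨K (N + 1), mem_interior_iff_mem_nhds.1 (K.subset_interior_succ N hN),
      (finite_lt_nat (N + 1)).subset ?_⟩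
    rintro m ⟨y, hy, hyK⟩
    by_contra hm
    exact hy (hf0 m (Or.inr (𝒢.subset_saturation _ (K.subset (not_lt.1 hm) hyK))))
  refine ⟨fun x => ∑ᶠ n, f n x, contMDiff_finsum (fun n => (f n).contMDiff) hlf,
    fun x => finsum_nonneg fun n => (hf n x).1, fun x => ?_, fun x => ?_⟩
  · have hne : ∃ n, ∃ h, 𝒢.target h = x ∧ 𝒢.source h ∈ K n := by
      obtain ⟨N, hN⟩ := mem_iUnion.1 (K.iUnion_eq ▸ mem_univ x : x ∈ ⋃ n, K n)
      exact ⟨N, 𝒢.unit x, 𝒢.target_unit x, by rwa [𝒢.source_unit]⟩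
    classical
    obtain ⟨h, hx, hh⟩ := Nat.find_spec hne
    have hmin := fun m => Nat.find_min (H := hne) (m := m)
    generalize Nat.find hne = n at hh hmin
    obtain _ | _ | m := n
    · rw [hK0] at hh; exact hh.elim
    · rw [hK1] at hh; exact hh.elim
    · refine ⟨h, hx, ?_⟩
      have hone : f m (𝒢.source h) = 1 := by
        refine hf1 m ⟨hh, ?_⟩
        -- Otherwise `h g⁻¹` would join `x` to a point of `K (m + 1)`, against the minimality of the
        -- index.
        rintro ⟨g, hg, hgs⟩
        refine hmin (m + 1) (by omega) ⟨𝒢.mul h (𝒢.inv g), ?_, ?_⟩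
        · rw [𝒢.target_div hgs.symm, hx]
        · rw [𝒢.source_div hgs.symm]; exact interior_subset hg
      have hfin : (Function.support fun n => f n (𝒢.source h)).Finite := hlf.point_finite _
      have h1 := single_le_finsum m hfin fun n => (hf n (𝒢.source h)).1
      rw [hone] at h1
      exact lt_of_lt_of_le one_pos h1
  · obtain ⟨N, hN⟩ := mem_iUnion.1 (K.iUnion_eq ▸ mem_univ x : x ∈ ⋃ n, K n)
    refine ⟨K (N + 1), mem_interior_iff_mem_nhds.1 (K.subset_interior_succ N hN), _,
      h𝒢.isCompact_preimage (K.isCompact (N + 4)) (K.isCompact (N + 1)), fun h hh hc => ?_⟩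
    obtain ⟨m, hm⟩ : ∃ m, f m (𝒢.source h) ≠ 0 := by
      by_contra! hall
      exact hc (by simp [hall])
    -- The orbit meets `K (N + 1)` at the target of `h`, so only indices up to `N` contribute, and
    -- they confine the source of `h` to `K (N + 4)`.
    have h1 : m < N + 1 := by
      by_contra hlt
      exact hm (hf0 m (Or.inr ⟨h, K.subset (not_lt.1 hlt) hh, rfl⟩))
    have h2 : 𝒢.source h ∈ interior (K (m + 3)) := by
      by_contra hn
      exact hm (hf0 m (Or.inl hn))
    exact ⟨K.subset (by omega) (interior_subset h2), hh⟩

end LieGroupoid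

/-! ### Determinants, and Jacobians of left translations between target fibres. -/

theorem ContinuousLinearMap.contDiff_det {d : ℕ} {n : WithTop ℕ∞} :
    ContDiff ℝ n fun A : (Fin d → ℝ) →L[ℝ] (Fin d → ℝ) => A.det := by
  have h : (fun A : (Fin d → ℝ) →L[ℝ] (Fin d → ℝ) => A.det) = fun A =>
      ∑ σ : Equiv.Perm (Fin d), (Equiv.Perm.sign σ : ℤ) •
        ∏ i, A (Pi.single i 1) (σ i) := by
    funext A
    rw [ContinuousLinearMap.det, ← LinearMap.det_toMatrix', Matrix.det_apply]
    refine Finset.sum_congr rfl fun σ _ => ?_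
    rw [Units.smul_def]
    refine congrArg _ (Finset.prod_congr rfl fun i _ => ?_)
    rw [LinearMap.toMatrix'_apply]
    rfl
  rw [h]
  refine ContDiff.sum fun σ _ => ContDiff.const_smul _ (contDiff_prod fun i _ => ?_)
  have h1 : ContDiff ℝ n fun A : (Fin d → ℝ) →L[ℝ] (Fin d → ℝ) => A (Pi.single i 1) :=
    contDiff_id.clm_apply contDiff_const
  exact contDiff_pi.1 h1 (σ i)

namespace LieGroupoid

variable {EM EG M G : Type*}
  [NormedAddCommGroup EM] [NormedSpace ℝ EM] [NormedAddCommGroup EG] [NormedSpace ℝ EG]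
  [TopologicalSpace M] [ChartedSpace EM M] [IsManifold 𝓘(ℝ, EM) ∞ M]
  [TopologicalSpace G] [ChartedSpace EG G] [IsManifold 𝓘(ℝ, EG) ∞ G]
  (𝒢 : LieGroupoid EM EG M G) {d : ℕ}

/-! ### Left translations in fibred charts of the target map -/

section Transition

variable (a b c : FibredChart EM EG 𝒢.target (Fin d → ℝ))

/-- The left translation by `g`, in two fibred charts. -/
def transition (g : G) (v : Fin d → ℝ) : Fin d → ℝ :=
  b.coord (𝒢.mul g (a.param (𝒢.source g, v)))

/-- The domain of the left translation by `g`, in two fibred charts. -/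
def transitionDomain (g : G) : Set (Fin d → ℝ) :=
  {v ∈ a.fibre (𝒢.source g) | 𝒢.mul g (a.param (𝒢.source g, v)) ∈ b.source}

/-- The Jacobian determinant of the left translation by `g`, in two fibred charts. -/
def jacobian (g : G) (v : Fin d → ℝ) : ℝ := (fderiv ℝ (𝒢.transition a b g) v).det

theorem target_param {g : G} {v : Fin d → ℝ} (hv : v ∈ a.fibre (𝒢.source g)) :
    𝒢.target (a.param (𝒢.source g, v)) = 𝒢.source g := a.fst_param _ hv

theorem contMDiffAt_mul_param {g : G} {v : Fin d → ℝ} (hv : v ∈ a.fibre (𝒢.source g)) :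
    ContMDiffAt 𝓘(ℝ, Fin d → ℝ) 𝓘(ℝ, EG) ∞
      (fun v => 𝒢.mul g (a.param (𝒢.source g, v))) v := by
  have h1 : ContMDiffAt 𝓘(ℝ, Fin d → ℝ) 𝓘(ℝ, EG) ∞ (fun v => a.param (𝒢.source g, v)) v :=
    ContMDiffAt.comp (g := a.param) v
      (a.contMDiffOn_param.contMDiffAt (a.open_target.mem_nhds hv))
      (contMDiffAt_const.prodMk contMDiffAt_id)
  refine 𝒢.contMDiffAt_mul contMDiffAt_const h1 ?_
  filter_upwards [(a.isOpen_fibre _).mem_nhds hv] with w hw using (𝒢.target_param a hw).symm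

theorem isOpen_transitionDomain (g : G) : IsOpen (𝒢.transitionDomain a b g) := by
  refine isOpen_iff_mem_nhds.2 fun v hv => ?_
  filter_upwards [(a.isOpen_fibre _).mem_nhds hv.1,
    (𝒢.contMDiffAt_mul_param a hv.1).continuousAt.preimage_mem_nhds
      (b.open_source.mem_nhds hv.2)] with w h1 h2 using ⟨h1, h2⟩

theorem differentiableAt_transition {g : G} {v : Fin d → ℝ}
    (hv : v ∈ 𝒢.transitionDomain a b g) : DifferentiableAt ℝ (𝒢.transition a b g) v := by
  have h1 : ContMDiffAt 𝓘(ℝ, Fin d → ℝ) 𝓘(ℝ, Fin d → ℝ) ∞ (𝒢.transition a b g) v :=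
    ContMDiffAt.comp (g := b.coord) v
      (b.contMDiffOn_coord.contMDiffAt (b.open_source.mem_nhds hv.2))
      (𝒢.contMDiffAt_mul_param a hv.1)
  exact h1.contDiffAt.differentiableAt (by simp)

theorem target_mul_param {g : G} {v : Fin d → ℝ} (hv : v ∈ a.fibre (𝒢.source g)) :
    𝒢.target (𝒢.mul g (a.param (𝒢.source g, v))) = 𝒢.target g :=
  𝒢.target_mul _ _ (𝒢.target_param a hv).symm

theorem param_transition {g : G} {v : Fin d → ℝ} (hv : v ∈ 𝒢.transitionDomain a b g) :
    b.param (𝒢.target g, 𝒢.transition a b g v) = 𝒢.mul g (a.param (𝒢.source g, v)) := by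
  rw [← 𝒢.target_mul_param a hv.1]
  exact b.left_inv _ hv.2

theorem transition_mem_fibre {g : G} {v : Fin d → ℝ} (hv : v ∈ 𝒢.transitionDomain a b g) :
    𝒢.transition a b g v ∈ b.fibre (𝒢.target g) := by
  change (𝒢.target g, _) ∈ b.target
  rw [← 𝒢.target_mul_param a hv.1]
  exact b.map_source _ hv.2

theorem transition_transition {g k : G} (hk : 𝒢.source k = 𝒢.target g) {v : Fin d → ℝ}
    (hv : v ∈ 𝒢.transitionDomain a b g) :
    𝒢.transition b c k (𝒢.transition a b g v) = 𝒢.transition a c (𝒢.mul k g) v := by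
  unfold transition
  rw [𝒢.source_mul _ _ hk, 𝒢.mul_assoc _ _ _ hk (𝒢.target_param a hv.1).symm, hk]
  exact congrArg (fun z => c.coord (𝒢.mul k z)) (𝒢.param_transition a b hv)

/-- The chain rule for `L_{kg} = L_k ∘ L_g`, read in charts. -/
theorem jacobian_mul {g k : G} (hk : 𝒢.source k = 𝒢.target g) {v : Fin d → ℝ}
    (hv : v ∈ 𝒢.transitionDomain a b g)
    (hv' : 𝒢.transition a b g v ∈ 𝒢.transitionDomain b c k) :
    𝒢.jacobian a c (𝒢.mul k g) v =
      𝒢.jacobian b c k (𝒢.transition a b g v) * 𝒢.jacobian a b g v := by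
  have h1 : 𝒢.transition a c (𝒢.mul k g) =ᶠ[𝓝 v] 𝒢.transition b c k ∘ 𝒢.transition a b g := by
    filter_upwards [(𝒢.isOpen_transitionDomain a b g).mem_nhds hv] with w hw
    exact (𝒢.transition_transition a b c hk hw).symm
  unfold jacobian
  rw [h1.fderiv_eq, fderiv_comp v (𝒢.differentiableAt_transition b c hv')
    (𝒢.differentiableAt_transition a b hv)]
  exact LinearMap.det_comp _ _

theorem transition_inv {g : G} {v : Fin d → ℝ} (hv : v ∈ 𝒢.transitionDomain a b g) :
    𝒢.transition b a (𝒢.inv g) (𝒢.transition a b g v) = v := by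
  unfold transition
  rw [𝒢.source_inv]
  change a.coord (𝒢.mul (𝒢.inv g) (b.param (𝒢.target g, 𝒢.transition a b g v))) = v
  rw [𝒢.param_transition a b hv, 𝒢.inv_mul_cancel_left (𝒢.target_param a hv.1).symm]
  exact a.coord_param _ hv.1

theorem transition_mem_transitionDomain_inv {g : G} {v : Fin d → ℝ}
    (hv : v ∈ 𝒢.transitionDomain a b g) :
    𝒢.transition a b g v ∈ 𝒢.transitionDomain b a (𝒢.inv g) := by
  unfold transitionDomain
  rw [𝒢.source_inv]
  refine ⟨𝒢.transition_mem_fibre a b hv, ?_⟩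
  rw [𝒢.param_transition a b hv, 𝒢.inv_mul_cancel_left (𝒢.target_param a hv.1).symm]
  exact a.map_target _ hv.1

/-- Translation by `g⁻¹` inverts translation by `g`, so the two Jacobians multiply to `1`. This
serves both the positivity of the density and the smoothness of absolute values. -/
theorem jacobian_ne_zero {g : G} {v : Fin d → ℝ} (hv : v ∈ 𝒢.transitionDomain a b g) :
    𝒢.jacobian a b g v ≠ 0 := by
  have h1 := 𝒢.transition_mem_transitionDomain_inv a b hv
  have h2 : 𝒢.transition b a (𝒢.inv g) ∘ 𝒢.transition a b g =ᶠ[𝓝 v] id := by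
    filter_upwards [(𝒢.isOpen_transitionDomain a b g).mem_nhds hv] with w hw
    exact 𝒢.transition_inv a b hw
  have h3 := h2.fderiv_eq (𝕜 := ℝ)
  rw [fderiv_comp v (𝒢.differentiableAt_transition b a h1)
    (𝒢.differentiableAt_transition a b hv), fderiv_id] at h3
  have h4 := congrArg ContinuousLinearMap.det h3
  intro h0
  have h5 : 𝒢.jacobian b a (𝒢.inv g) (𝒢.transition a b g v) * 𝒢.jacobian a b g v = 1 := by
    have h6 := LinearMap.det_comp
      (fderiv ℝ (𝒢.transition b a (𝒢.inv g)) (𝒢.transition a b g v)).toLinearMap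
      (fderiv ℝ (𝒢.transition a b g) v).toLinearMap
    refine h6.symm.trans (h4.trans ?_)
    exact LinearMap.det_id (A := ℝ) (M := Fin d → ℝ)
  rw [h0, mul_zero] at h5
  exact zero_ne_one h5

theorem transition_image (g : G) :
    𝒢.transition a b g '' 𝒢.transitionDomain a b g =
      {u ∈ b.fibre (𝒢.target g) | 𝒢.mul (𝒢.inv g) (b.param (𝒢.target g, u)) ∈ a.source} := by
  have key : 𝒢.transitionDomain b a (𝒢.inv g) =
      {u ∈ b.fibre (𝒢.target g) | 𝒢.mul (𝒢.inv g) (b.param (𝒢.target g, u)) ∈ a.source} := by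
    unfold transitionDomain
    rw [𝒢.source_inv]
  rw [← key]
  refine Subset.antisymm ?_ fun u hu => ?_
  · rintro _ ⟨v, hv, rfl⟩
    exact 𝒢.transition_mem_transitionDomain_inv a b hv
  · have h1 := 𝒢.transition_mem_transitionDomain_inv b a hu
    have h2 := 𝒢.transition_inv b a hu
    rw [𝒢.inv_inv] at h1 h2
    exact ⟨_, h1, h2⟩

/-- Change of variables by a left translation. -/
theorem integral_translate {E' : Type*} [NormedAddCommGroup E'] [NormedSpace ℝ E'] (g : G)
    {θ : G → E'} (ha : ∀ h, 𝒢.target h = 𝒢.target g → 𝒢.mul (𝒢.inv g) h ∉ a.source → θ h = 0)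
    (hb : ∀ h, 𝒢.target h = 𝒢.target g → h ∉ b.source → θ h = 0) :
    b.integral (𝒢.target g) θ = a.integral (𝒢.source g) fun h =>
      |𝒢.jacobian a b g (a.coord h)| • θ (𝒢.mul g h) := by
  -- By the two vanishing hypotheses both integrals live on the part of the fibre seen by both
  -- charts, where the usual change of variables applies.
  have h1 : b.integral (𝒢.target g) θ =
      ∫ u in 𝒢.transition a b g '' 𝒢.transitionDomain a b g, θ (b.param (𝒢.target g, u)) := by
    rw [𝒢.transition_image]
    refine setIntegral_eq_of_subset_of_forall_sdiff_eq_zero (b.isOpen_fibre _).measurableSet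
      (fun u hu => hu.1) fun u hu => ha _ (b.fst_param _ hu.1) fun hmem => hu.2 ⟨hu.1, hmem⟩
  have h2 : InjOn (𝒢.transition a b g) (𝒢.transitionDomain a b g) := by
    intro v hv w hw hvw
    rw [← 𝒢.transition_inv a b hv, hvw, 𝒢.transition_inv a b hw]
  rw [h1, integral_image_eq_integral_abs_det_fderiv_smul volume
    (𝒢.isOpen_transitionDomain a b g).measurableSet (fun v hv =>
      (𝒢.differentiableAt_transition a b hv).hasFDerivAt.hasFDerivWithinAt) h2]
  have h3 : a.integral (𝒢.source g) (fun h =>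
      |𝒢.jacobian a b g (a.coord h)| • θ (𝒢.mul g h)) =
      ∫ v in 𝒢.transitionDomain a b g, |𝒢.jacobian a b g (a.coord (a.param (𝒢.source g, v)))| •
        θ (𝒢.mul g (a.param (𝒢.source g, v))) := by
    refine setIntegral_eq_of_subset_of_forall_sdiff_eq_zero (a.isOpen_fibre _).measurableSet
      (fun u hu => hu.1) fun u hu => ?_
    beta_reduce
    rw [hb _ (𝒢.target_mul_param a hu.1) fun hmem => hu.2 ⟨hu.1, hmem⟩, smul_zero]
  rw [h3]
  refine setIntegral_congr_fun (𝒢.isOpen_transitionDomain a b g).measurableSet fun v hv => ?_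
  rw [a.coord_param _ hv.1, 𝒢.param_transition a b hv]
  rfl

/-- The Jacobian of the left translation by `h⁻¹` at `h` depends smoothly on `h`. -/
theorem contMDiffAt_jacobian_inv {h : G} (ha : h ∈ a.source)
    (hb : 𝒢.unit (𝒢.source h) ∈ b.source) :
    ContMDiffAt 𝓘(ℝ, EG) 𝓘(ℝ, ℝ) ∞ (fun h => |𝒢.jacobian a b (𝒢.inv h) (a.coord h)|) h := by
  have hcoord : ContMDiffAt 𝓘(ℝ, EG) 𝓘(ℝ, Fin d → ℝ) ∞ a.coord h :=
    a.contMDiffOn_coord.contMDiffAt (a.open_source.mem_nhds ha)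
  have hmem : (𝒢.target h, a.coord h) ∈ a.target := a.map_source h ha
  have hpair : ContMDiffAt (𝓘(ℝ, EG).prod 𝓘(ℝ, Fin d → ℝ)) (𝓘(ℝ, EM).prod 𝓘(ℝ, Fin d → ℝ)) ∞
      (fun z : G × (Fin d → ℝ) => (𝒢.source (𝒢.inv z.1), z.2)) (h, a.coord h) :=
    ((𝒢.contMDiff_source.comp 𝒢.contMDiff_inv).contMDiffAt.comp (h, a.coord h)
      contMDiffAt_fst).prodMk contMDiffAt_snd
  have hmem' : (𝒢.source (𝒢.inv h), a.coord h) ∈ a.target := by rwa [𝒢.source_inv]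
  have hmul : ContMDiffAt (𝓘(ℝ, EG).prod 𝓘(ℝ, Fin d → ℝ)) 𝓘(ℝ, EG) ∞
      (fun z : G × (Fin d → ℝ) => 𝒢.mul (𝒢.inv z.1) (a.param (𝒢.source (𝒢.inv z.1), z.2)))
      (h, a.coord h) := by
    refine 𝒢.contMDiffAt_mul (𝒢.contMDiff_inv.contMDiffAt.comp (h, a.coord h) contMDiffAt_fst)
      (ContMDiffAt.comp (h, a.coord h) (g := a.param)
        (a.contMDiffOn_param.contMDiffAt (a.open_target.mem_nhds hmem')) hpair) ?_
    filter_upwards [hpair.continuousAt.preimage_mem_nhds (a.open_target.mem_nhds hmem')] with z hz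
    exact (a.fst_param _ hz).symm
  have heq : 𝒢.mul (𝒢.inv h) (a.param (𝒢.source (𝒢.inv h), a.coord h)) =
      𝒢.unit (𝒢.source h) := by
    rw [𝒢.source_inv, a.left_inv h ha, 𝒢.inv_mul]
  have hf : ContMDiffAt (𝓘(ℝ, EG).prod 𝓘(ℝ, Fin d → ℝ)) 𝓘(ℝ, Fin d → ℝ) ∞
      (Function.uncurry fun (z : G) (v : Fin d → ℝ) => 𝒢.transition a b (𝒢.inv z) v)
      (h, a.coord h) :=
    ContMDiffAt.comp (h, a.coord h) (g := b.coord)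
      (b.contMDiffOn_coord.contMDiffAt (b.open_source.mem_nhds (by
        simp only [heq]; exact hb))) hmul
  -- The translation is smooth jointly in the arrow and the coordinate, so its partial derivative at
  -- the moving point `a.coord h` is smooth in `h`.
  have hfd := ContMDiffAt.mfderiv (m := ∞) (n := ∞)
    (fun (z : G) (v : Fin d → ℝ) => 𝒢.transition a b (𝒢.inv z) v) a.coord hf hcoord (by simp)
  replace hfd := (congrArg (fun L => ContMDiffAt 𝓘(ℝ, EG) 𝓘(ℝ, (Fin d → ℝ) →L[ℝ] (Fin d → ℝ)) ∞ L h)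
    (inTangentCoordinates_model_space (I := 𝓘(ℝ, Fin d → ℝ)) (I' := 𝓘(ℝ, Fin d → ℝ)) a.coord _
      (fun z => mfderiv 𝓘(ℝ, Fin d → ℝ) 𝓘(ℝ, Fin d → ℝ) (𝒢.transition a b (𝒢.inv z)) (a.coord z))
      h)).mp hfd
  simp only [mfderiv_eq_fderiv] at hfd
  have hdet : ContMDiffAt 𝓘(ℝ, EG) 𝓘(ℝ, ℝ) ∞
      (fun z => 𝒢.jacobian a b (𝒢.inv z) (a.coord z)) h :=
    ContinuousLinearMap.contDiff_det.contMDiff.contMDiffAt.comp h hfd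
  have hne : 𝒢.jacobian a b (𝒢.inv h) (a.coord h) ≠ 0 :=
    𝒢.jacobian_ne_zero a b ⟨hmem', by rw [heq]; exact hb⟩
  -- The absolute value is smooth here only because the Jacobian does not vanish.
  exact ((contDiffAt_norm ℝ hne).contMDiffAt).comp h hdet

end Transition

end LieGroupoid

/-! ### The Haar system, its left invariance, and averages. -/

namespace LieGroupoid

variable {EM EG M G : Type*}
  [NormedAddCommGroup EM] [NormedSpace ℝ EM] [NormedAddCommGroup EG] [NormedSpace ℝ EG]
  [TopologicalSpace M] [ChartedSpace EM M] [IsManifold 𝓘(ℝ, EM) ∞ M]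
  [TopologicalSpace G] [ChartedSpace EG G] [IsManifold 𝓘(ℝ, EG) ∞ G]
  (𝒢 : LieGroupoid EM EG M G)

/-- The choices needed to construct a normalized left invariant Haar system on `𝒢`: fibred charts of
the target map with a subordinate partition of unity, and a cut-off function. -/
structure HaarData where
  dim : ℕ
  chart : G → FibredChart EM EG 𝒢.target (Fin dim → ℝ)
  bump : SmoothPartitionOfUnity G 𝓘(ℝ, EG) G univ
  isCompact_tsupport : ∀ i, IsCompact (tsupport (bump i))
  tsupport_subset : ∀ i, tsupport (bump i) ⊆ (chart i).source
  cutoff : M → ℝ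
  contMDiff_cutoff : ContMDiff 𝓘(ℝ, EM) 𝓘(ℝ, ℝ) ∞ cutoff
  cutoff_nonneg : ∀ x, 0 ≤ cutoff x
  exists_cutoff_pos : ∀ x, ∃ h, 𝒢.target h = x ∧ 0 < cutoff (𝒢.source h)
  exists_compact : ∀ x, ∃ N ∈ 𝓝 x, ∃ K : Set G, IsCompact K ∧
    ∀ h, 𝒢.target h ∈ N → cutoff (𝒢.source h) ≠ 0 → h ∈ K

variable {𝒢}

theorem IsProper.nonempty_haarData [FiniteDimensional ℝ EM] [FiniteDimensional ℝ EG] [T2Space M]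
    [SecondCountableTopology M] (h𝒢 : 𝒢.IsProper) : Nonempty 𝒢.HaarData := by
  have := h𝒢.t2Space
  have := h𝒢.sigmaCompactSpace
  have : LocallyCompactSpace G := ChartedSpace.locallyCompactSpace EG G
  obtain ⟨d, hd⟩ := 𝒢.isSubmersion_target.exists_fibredChart
  choose c hc using hd
  choose V hV hVmem using fun x : G => exists_compact_mem_nhds x
  -- Intersecting the chart domains with interiors of compact neighbourhoods forces the supports of
  -- the bumps to be compact.
  obtain ⟨χ, hχ⟩ := SmoothPartitionOfUnity.exists_isSubordinate 𝓘(ℝ, EG) isClosed_univ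
    (fun x => (c x).source ∩ interior (V x)) (fun x => (c x).open_source.inter isOpen_interior)
    fun x _ => mem_iUnion.2 ⟨x, hc x, mem_interior_iff_mem_nhds.2 (hVmem x)⟩
  obtain ⟨cut, h1, h2, h3, h4⟩ := h𝒢.exists_cutoff
  exact ⟨{
    dim := d
    chart := c
    bump := χ
    isCompact_tsupport := fun i => (hV i).of_isClosed_subset (isClosed_tsupport _)
      fun y hy => interior_subset (hχ i hy).2
    tsupport_subset := fun i y hy => (hχ i hy).1
    cutoff := cut
    contMDiff_cutoff := h1
    cutoff_nonneg := h2
    exists_cutoff_pos := h3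
    exists_compact := h4 }⟩

namespace HaarData

variable (A : 𝒢.HaarData)

/-- The left invariant density, in a fibred chart `a` of the target map. -/
def density (a : FibredChart EM EG 𝒢.target (Fin A.dim → ℝ)) (h : G) : ℝ :=
  ∑ᶠ j, A.bump j (𝒢.unit (𝒢.source h)) * |𝒢.jacobian a (A.chart j) (𝒢.inv h) (a.coord h)|

theorem mem_source_of_bump_ne_zero {i : G} {h : G} (hi : A.bump i h ≠ 0) :
    h ∈ (A.chart i).source := A.tsupport_subset i (subset_tsupport _ hi)

theorem density_nonneg (a : FibredChart EM EG 𝒢.target (Fin A.dim → ℝ)) (h : G) :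
    0 ≤ A.density a h :=
  finsum_nonneg fun j => mul_nonneg (A.bump.nonneg j _) (abs_nonneg _)

variable {a b : FibredChart EM EG 𝒢.target (Fin A.dim → ℝ)}

theorem density_pos {h : G} (ha : h ∈ a.source) : 0 < A.density a h := by
  obtain ⟨j, hj⟩ := A.bump.exists_pos_of_mem (mem_univ (𝒢.unit (𝒢.source h)))
  have hjac : 𝒢.jacobian a (A.chart j) (𝒢.inv h) (a.coord h) ≠ 0 := by
    refine 𝒢.jacobian_ne_zero a _ ⟨?_, ?_⟩
    · change (_, _) ∈ a.target
      rw [𝒢.source_inv]; exact a.map_source h ha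
    · rw [𝒢.source_inv, a.left_inv h ha, 𝒢.inv_mul]
      exact A.mem_source_of_bump_ne_zero hj.ne'
  refine (mul_pos hj (abs_pos.2 hjac)).trans_le
    (single_le_finsum (f := fun j => A.bump j (𝒢.unit (𝒢.source h)) *
      |𝒢.jacobian a (A.chart j) (𝒢.inv h) (a.coord h)|) j ?_
      fun j => mul_nonneg (A.bump.nonneg j _) (abs_nonneg _))
  refine (A.bump.locallyFinite.point_finite (𝒢.unit (𝒢.source h))).subset fun i hi => ?_
  exact left_ne_zero_of_mul hi

theorem contMDiffAt_density {h : G} (ha : h ∈ a.source) :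
    ContMDiffAt 𝓘(ℝ, EG) 𝓘(ℝ, ℝ) ∞ (A.density a) h := by
  have hu : ContMDiff 𝓘(ℝ, EG) 𝓘(ℝ, EG) ∞ fun h => 𝒢.unit (𝒢.source h) :=
    𝒢.contMDiff_unit.comp 𝒢.contMDiff_source
  -- Closed supports are used: every bump that is nonzero near the unit at `s(h)` has this unit in
  -- its closed support, hence in the domain of its chart, where the Jacobian is smooth.
  set s := A.bump.fintsupport (𝒢.unit (𝒢.source h)) with hs
  have hsum : ContMDiffAt 𝓘(ℝ, EG) 𝓘(ℝ, ℝ) ∞ (fun h =>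
      ∑ j ∈ s, A.bump j (𝒢.unit (𝒢.source h)) *
        |𝒢.jacobian a (A.chart j) (𝒢.inv h) (a.coord h)|) h := by
    refine ContMDiffAt.sum fun j hj => ?_
    refine ((A.bump j).contMDiff.comp hu).contMDiffAt.mul
      (𝒢.contMDiffAt_jacobian_inv a _ ha (A.tsupport_subset j ?_))
    exact (SmoothPartitionOfUnity.mem_fintsupport_iff A.bump _ j).1 hj
  refine hsum.congr_of_eventuallyEq ?_
  filter_upwards [hu.continuous.continuousAt.eventually
    (A.bump.eventually_finsupport_subset (𝒢.unit (𝒢.source h)))] with z hz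
  refine finsum_eq_sum_of_support_subset _ fun j hj => hz ?_
  exact (SmoothPartitionOfUnity.mem_finsupport A.bump _).2 (left_ne_zero_of_mul hj)

/-- The density is left invariant. -/
theorem density_eq {g h : G} (hg : 𝒢.source g = 𝒢.target h) (ha : h ∈ a.source)
    (hb : 𝒢.mul g h ∈ b.source) :
    A.density a h = |𝒢.jacobian a b g (a.coord h)| * A.density b (𝒢.mul g h) := by
  have hpar : a.param (𝒢.source g, a.coord h) = h := by rw [hg]; exact a.left_inv h ha
  have hdom : a.coord h ∈ 𝒢.transitionDomain a b g := by
    refine ⟨?_, by rwa [hpar]⟩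
    change (_, _) ∈ a.target
    rw [hg]; exact a.map_source h ha
  have htr : 𝒢.transition a b g (a.coord h) = b.coord (𝒢.mul g h) := by
    unfold transition; rw [hpar]
  unfold density
  rw [mul_finsum' _ _ ((A.bump.locallyFinite.point_finite
    (𝒢.unit (𝒢.source (𝒢.mul g h)))).subset fun i hi => left_ne_zero_of_mul hi)]
  refine finsum_congr fun j => ?_
  rw [𝒢.source_mul _ _ hg]
  by_cases hj : A.bump j (𝒢.unit (𝒢.source h)) = 0
  · simp [hj]
  -- The bumps are unaffected, as `s(gh) = s(h)`; the Jacobians obey the chain rule for `(gh)⁻¹ g =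
  -- h⁻¹`.
  have hgh : 𝒢.mul (𝒢.inv (𝒢.mul g h)) g = 𝒢.inv h := by
    have h1 : 𝒢.source (𝒢.mul g h) = 𝒢.source h := 𝒢.source_mul _ _ hg
    have h3 := 𝒢.inv_mul_cancel_left (g := 𝒢.mul g h) (h := 𝒢.inv h)
      (by rw [h1, 𝒢.target_inv])
    rw [𝒢.mul_inv_cancel_right hg] at h3
    exact h3
  have hk : 𝒢.source (𝒢.inv (𝒢.mul g h)) = 𝒢.target g := by
    rw [𝒢.source_inv, 𝒢.target_mul _ _ hg]
  have hdom' : 𝒢.transition a b g (a.coord h) ∈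
      𝒢.transitionDomain b (A.chart j) (𝒢.inv (𝒢.mul g h)) := by
    rw [htr]
    refine ⟨?_, ?_⟩
    · change (_, _) ∈ b.target
      rw [𝒢.source_inv]; exact b.map_source _ hb
    · rw [𝒢.source_inv, b.left_inv _ hb, 𝒢.inv_mul, 𝒢.source_mul _ _ hg]
      exact A.mem_source_of_bump_ne_zero hj
  have hjac := 𝒢.jacobian_mul a b (A.chart j) hk hdom hdom'
  rw [hgh, htr] at hjac
  rw [hjac, abs_mul]
  ring

/-- The unnormalized Haar system. -/
def fibreIntegral : FibreIntegral EM EG 𝒢.target A.dim where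
  index := G
  chart := A.chart
  weight i h := A.bump i h * (A.cutoff (𝒢.source h) * A.density (A.chart i) h)
  supp i := tsupport (A.bump i)
  contMDiff_weight i := by
    -- The density is smooth only on the chart domain, which contains the closed support of the
    -- bump.
    refine contMDiff_of_tsupport fun h hh => ?_
    have h1 : h ∈ tsupport (A.bump i) := tsupport_mul_subset_left hh
    exact (A.bump i).contMDiff.contMDiffAt.mul
      ((A.contMDiff_cutoff.comp 𝒢.contMDiff_source).contMDiffAt.mul
        (A.contMDiffAt_density (A.tsupport_subset i h1)))
  isCompact_supp := A.isCompact_tsupport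
  supp_subset := A.tsupport_subset
  weight_eq_zero i h hh := by
    rw [image_eq_zero_of_notMem_tsupport hh, zero_mul]
  locallyFinite x := by
    -- The cut-off confines the weights over `N` to a compact set, which meets only finitely many
    -- bumps.
    obtain ⟨N, hN, K, hK, hKN⟩ := A.exists_compact x
    refine ⟨N, hN, (A.bump.locallyFinite.finite_nonempty_inter_compact hK).subset ?_⟩
    rintro i ⟨h, hh, hw⟩
    exact ⟨h, left_ne_zero_of_mul hw, hKN h hh (left_ne_zero_of_mul (right_ne_zero_of_mul hw))⟩

theorem exists_finset (x : M) : ∃ s : Finset G, ∀ i h, 𝒢.target h = x →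
    A.cutoff (𝒢.source h) ≠ 0 → A.bump i h ≠ 0 → i ∈ s := by
  obtain ⟨N, hN, K, hK, hKN⟩ := A.exists_compact x
  refine ⟨(A.bump.locallyFinite.finite_nonempty_inter_compact hK).toFinset,
    fun i h hh hc hb => ?_⟩
  rw [Set.Finite.mem_toFinset]
  exact ⟨h, hb, hKN h (by rw [hh]; exact mem_of_mem_nhds hN) hc⟩

theorem sum_bump {s : Finset G} {h : G} (hs : ∀ i, A.bump i h ≠ 0 → i ∈ s) :
    ∑ i ∈ s, A.bump i h = 1 := by
  rw [← finsum_eq_sum_of_support_subset _ fun i hi => hs i hi]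
  exact A.bump.sum_eq_one (mem_univ h)

section Integral

variable [T2Space M] {E' : Type*} [NormedAddCommGroup E'] [NormedSpace ℝ E']

theorem continuousOn_mul_left (g : G) :
    ContinuousOn (fun h => 𝒢.mul g h) (𝒢.target ⁻¹' {𝒢.source g}) :=
  𝒢.contMDiffOn_mul.continuousOn.comp (Continuous.prodMk_right g).continuousOn
    fun h hh => by
      change 𝒢.source g = 𝒢.target h
      exact hh.symm

/-- Left invariance of the Haar system. On both fibres the integrand is cut up by the partition of
unity and by its translate under `g`. Each piece is seen by two charts, where the change of
variables and `density_eq` match it with its counterpart; the cut-off does not interfere because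
`s(gh) = s(h)`. -/
theorem integral_translate {g : G} {φ : G → E'}
    (hφ : ContinuousOn φ (𝒢.target ⁻¹' {𝒢.target g})) :
    A.fibreIntegral.integral (𝒢.target g) φ =
      A.fibreIntegral.integral (𝒢.source g) fun h => φ (𝒢.mul g h) := by
  have ht : Continuous 𝒢.target := 𝒢.contMDiff_target.continuous
  obtain ⟨sx, hsx⟩ := A.exists_finset (𝒢.source g)
  obtain ⟨sy, hsy⟩ := A.exists_finset (𝒢.target g)
  have hwx : ∀ i y, 𝒢.target y = 𝒢.source g → A.fibreIntegral.weight i y ≠ 0 → i ∈ sx :=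
    fun i y hy hw => hsx i y hy (left_ne_zero_of_mul (right_ne_zero_of_mul hw))
      (left_ne_zero_of_mul hw)
  have hwy : ∀ i y, 𝒢.target y = 𝒢.target g → A.fibreIntegral.weight i y ≠ 0 → i ∈ sy :=
    fun i y hy hw => hsy i y hy (left_ne_zero_of_mul (right_ne_zero_of_mul hw))
      (left_ne_zero_of_mul hw)
  have hmul : ∀ h, 𝒢.target h = 𝒢.source g → 𝒢.target (𝒢.mul g h) = 𝒢.target g :=
    fun h hh => 𝒢.target_mul _ _ hh.symm
  have hinv : ∀ h, 𝒢.target h = 𝒢.target g → 𝒢.target (𝒢.mul (𝒢.inv g) h) = 𝒢.source g :=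
    fun h hh => by rw [𝒢.target_mul _ _ (by rw [𝒢.source_inv, hh]), 𝒢.target_inv]
  have hsinv : ∀ h, 𝒢.target h = 𝒢.target g → 𝒢.source (𝒢.mul (𝒢.inv g) h) = 𝒢.source h :=
    fun h hh => 𝒢.source_mul _ _ (by rw [𝒢.source_inv, hh])
  have hcinv : ContinuousOn (fun h => 𝒢.mul (𝒢.inv g) h) (𝒢.target ⁻¹' {𝒢.target g}) := by
    have := continuousOn_mul_left (𝒢 := 𝒢) (𝒢.inv g)
    rwa [𝒢.source_inv] at this
  have hφ' : ContinuousOn (fun h => φ (𝒢.mul g h)) (𝒢.target ⁻¹' {𝒢.source g}) :=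
    hφ.comp (continuousOn_mul_left g) hmul
  rw [A.fibreIntegral.integral_eq_sum hwy, A.fibreIntegral.integral_eq_sum hwx]
  have hy : ∀ k, (A.chart k).integral (𝒢.target g) (fun h => A.fibreIntegral.weight k h • φ h) =
      ∑ i ∈ sx, (A.chart k).integral (𝒢.target g) fun h =>
        A.bump i (𝒢.mul (𝒢.inv g) h) • (A.fibreIntegral.weight k h • φ h) := by
    intro k
    rw [(A.chart k).integral_congr (ψ := fun h => ∑ i ∈ sx,
      A.bump i (𝒢.mul (𝒢.inv g) h) • (A.fibreIntegral.weight k h • φ h))]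
    · refine integral_finsetSum _ fun i _ => ?_
      refine (A.chart k).integrableOn (φ := fun h =>
        A.bump i (𝒢.mul (𝒢.inv g) h) • (A.fibreIntegral.weight k h • φ h)) ht
        (A.isCompact_tsupport k) (A.tsupport_subset k) ?_ fun y _ hy => ?_
      · exact ((A.bump i).contMDiff.continuous.comp_continuousOn hcinv).smul
          ((A.fibreIntegral.contMDiff_weight k).continuous.continuousOn.smul hφ)
      · rw [A.fibreIntegral.weight_eq_zero k y hy, zero_smul, smul_zero]
    · intro h _ hh
      -- Where the cut-off vanishes so does the weight. Elsewhere the finite set `sx` captures all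
      -- relevant bumps, and they sum to `1`.
      by_cases hc : A.cutoff (𝒢.source h) = 0
      · have : A.fibreIntegral.weight k h = 0 := by simp [fibreIntegral, hc]
        simp [this]
      · rw [← Finset.sum_smul, A.sum_bump fun i hi => hsx i _ (hinv h hh)
          (by rwa [hsinv h hh]) hi, one_smul]
  have hx : ∀ i, (A.chart i).integral (𝒢.source g)
      (fun h => A.fibreIntegral.weight i h • φ (𝒢.mul g h)) =
      ∑ k ∈ sy, (A.chart i).integral (𝒢.source g) fun h =>
        A.bump k (𝒢.mul g h) • (A.fibreIntegral.weight i h • φ (𝒢.mul g h)) := by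
    intro i
    rw [(A.chart i).integral_congr (ψ := fun h => ∑ k ∈ sy,
      A.bump k (𝒢.mul g h) • (A.fibreIntegral.weight i h • φ (𝒢.mul g h)))]
    · refine integral_finsetSum _ fun k _ => ?_
      refine (A.chart i).integrableOn (φ := fun h =>
        A.bump k (𝒢.mul g h) • (A.fibreIntegral.weight i h • φ (𝒢.mul g h))) ht
        (A.isCompact_tsupport i) (A.tsupport_subset i) ?_ fun y _ hy => ?_
      · exact ((A.bump k).contMDiff.continuous.comp_continuousOn (continuousOn_mul_left g)).smul
          ((A.fibreIntegral.contMDiff_weight i).continuous.continuousOn.smul hφ')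
      · rw [A.fibreIntegral.weight_eq_zero i y hy, zero_smul, smul_zero]
    · intro h _ hh
      by_cases hc : A.cutoff (𝒢.source h) = 0
      · have : A.fibreIntegral.weight i h = 0 := by simp [fibreIntegral, hc]
        simp [this]
      · rw [← Finset.sum_smul, A.sum_bump fun k hk => hsy k _ (hmul h hh)
          (by rwa [𝒢.source_mul _ _ hh.symm]) hk, one_smul]
  have hterm : ∀ i k, (A.chart k).integral (𝒢.target g) (fun h =>
      A.bump i (𝒢.mul (𝒢.inv g) h) • (A.fibreIntegral.weight k h • φ h)) =
      (A.chart i).integral (𝒢.source g) fun h =>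
        A.bump k (𝒢.mul g h) • (A.fibreIntegral.weight i h • φ (𝒢.mul g h)) := by
    intro i k
    rw [𝒢.integral_translate (A.chart i) (A.chart k) g]
    · refine (A.chart i).integral_congr fun h hi hh => ?_
      rw [𝒢.inv_mul_cancel_left hh.symm]
      by_cases hk : A.bump k (𝒢.mul g h) = 0
      · have : A.fibreIntegral.weight k (𝒢.mul g h) = 0 := by simp [fibreIntegral, hk]
        simp [this, hk]
      · have hd := A.density_eq (b := A.chart k) hh.symm hi (A.mem_source_of_bump_ne_zero hk)
        simp only [fibreIntegral, smul_smul]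
        rw [hd, 𝒢.source_mul _ _ hh.symm]
        congr 1
        ring
    · intro h _ hn
      rw [show A.bump i (𝒢.mul (𝒢.inv g) h) = 0 from
        by_contra fun hne => hn (A.mem_source_of_bump_ne_zero hne), zero_smul]
    · intro h _ hn
      rw [show A.fibreIntegral.weight k h = 0 from
        by_contra fun hne => hn (A.mem_source_of_bump_ne_zero (left_ne_zero_of_mul hne)),
        zero_smul, smul_zero]
  calc _ = ∑ k ∈ sy, ∑ i ∈ sx, (A.chart k).integral (𝒢.target g) (fun h =>
        A.bump i (𝒢.mul (𝒢.inv g) h) • (A.fibreIntegral.weight k h • φ h)) :=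
        Finset.sum_congr rfl fun k _ => hy k
    _ = ∑ i ∈ sx, ∑ k ∈ sy, (A.chart i).integral (𝒢.source g) (fun h =>
        A.bump k (𝒢.mul g h) • (A.fibreIntegral.weight i h • φ (𝒢.mul g h))) := by
        rw [Finset.sum_comm]
        exact Finset.sum_congr rfl fun i _ => Finset.sum_congr rfl fun k _ => hterm i k
    _ = _ := Finset.sum_congr rfl fun i _ => (hx i).symm

/-- The total mass of the fibre over `x`. -/
def mass (x : M) : ℝ := A.fibreIntegral.integral x fun _ => (1 : ℝ)

/-- The mass is constant along orbits, so normalizing by it preserves left invariance. -/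
theorem mass_target (g : G) : A.mass (𝒢.target g) = A.mass (𝒢.source g) :=
  A.integral_translate continuousOn_const

/-- All weights are nonnegative, and at an arrow where the cut-off is positive some weight is
positive, hence positive on a nonempty open set of coordinates. -/
theorem mass_pos (x : M) : 0 < A.mass x := by
  obtain ⟨h, rfl, hc⟩ := A.exists_cutoff_pos x
  obtain ⟨s, hs⟩ := A.fibreIntegral.eventually_finite (𝒢.target h)
  obtain ⟨i, hi⟩ := A.bump.exists_pos_of_mem (mem_univ h)
  have hi' := A.mem_source_of_bump_ne_zero hi.ne'
  have hnn : ∀ i y, 0 ≤ A.fibreIntegral.weight i y := fun i y =>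
    mul_nonneg (A.bump.nonneg i y) (mul_nonneg (A.cutoff_nonneg _) (A.density_nonneg _ _))
  have hpos : 0 < A.fibreIntegral.weight i h :=
    mul_pos hi (mul_pos hc (A.density_pos hi'))
  have hmem : i ∈ s := hs.self_of_nhds i h rfl hpos.ne'
  unfold mass
  rw [A.fibreIntegral.integral_eq_sum hs.self_of_nhds]
  refine Finset.sum_pos' (fun j _ => integral_nonneg fun v => ?_) ⟨i, hmem, ?_⟩
  · simpa using hnn j _
  have hint := A.fibreIntegral.term_integrableOn (x := 𝒢.target h) (φ := fun _ => (1 : ℝ))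
    𝒢.contMDiff_target.continuous continuousOn_const i
  refine (setIntegral_pos_iff_support_of_nonneg_ae (ae_of_all _ fun v => ?_) hint).2 ?_
  · simpa using hnn i _
  · have hopen : IsOpen (Function.support (fun v => A.fibreIntegral.weight i
        ((A.fibreIntegral.chart i).param (𝒢.target h, v)) • (1 : ℝ)) ∩
        (A.fibreIntegral.chart i).fibre (𝒢.target h)) := by
      rw [inter_comm]
      refine ContinuousOn.isOpen_inter_preimage (t := {0}ᶜ) ?_
        ((A.fibreIntegral.chart i).isOpen_fibre _) isOpen_compl_singleton
      exact ((A.fibreIntegral.contMDiff_weight i).continuous.comp_continuousOn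
        ((A.fibreIntegral.chart i).continuousOn_param_fibre _)).smul continuousOn_const
    refine hopen.measure_pos _ ⟨(A.chart i).coord h, ?_, (A.chart i).map_source h hi'⟩
    rw [Function.mem_support, smul_eq_mul, mul_one]
    have : (A.fibreIntegral.chart i).param (𝒢.target h, (A.chart i).coord h) = h :=
      (A.chart i).left_inv h hi'
    rw [this]
    exact hpos.ne'

open scoped Classical in
/-- The average of a function on the fibre `t⁻¹(x)`. -/
def average (x : M) (Φ : {h : G // 𝒢.target h = x} → E') : E' :=
  (A.mass x)⁻¹ • A.fibreIntegral.integral x fun h => if hh : 𝒢.target h = x then Φ ⟨h, hh⟩ else 0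

variable {E'' : Type*} [NormedAddCommGroup E''] [NormedSpace ℝ E'']

open scoped Classical in
theorem continuousOn_extend {x : M} {Φ : {h : G // 𝒢.target h = x} → E'} (hΦ : Continuous Φ) :
    ContinuousOn (fun h => if hh : 𝒢.target h = x then Φ ⟨h, hh⟩ else 0) (𝒢.target ⁻¹' {x}) := by
  rw [continuousOn_iff_continuous_domRestrict]
  refine hΦ.congr fun h => ?_
  exact (dif_pos (c := 𝒢.target h.1 = x) (t := fun hh => Φ ⟨h.1, hh⟩) (e := fun _ => 0) h.2).symm

theorem average_add {x : M} {Φ Ψ : {h : G // 𝒢.target h = x} → E'} (hΦ : Continuous Φ)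
    (hΨ : Continuous Ψ) : A.average x (fun h => Φ h + Ψ h) = A.average x Φ + A.average x Ψ := by
  unfold average
  rw [← smul_add, ← A.fibreIntegral.integral_add 𝒢.contMDiff_target.continuous
    (continuousOn_extend hΦ) (continuousOn_extend hΨ)]
  refine congrArg _ (A.fibreIntegral.integral_congr fun y hy => ?_)
  simp only [hy, dite_true]

theorem average_comp_clm [CompleteSpace E'] [CompleteSpace E''] {x : M}
    {Φ : {h : G // 𝒢.target h = x} → E'} (hΦ : Continuous Φ) (L : E' →L[ℝ] E'') :
    A.average x (fun h => L (Φ h)) = L (A.average x Φ) := by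
  unfold average
  rw [L.map_smul, ← A.fibreIntegral.integral_comp_clm 𝒢.contMDiff_target.continuous
    (continuousOn_extend hΦ)]
  refine congrArg _ (A.fibreIntegral.integral_congr fun y hy => ?_)
  simp only [hy, dite_true]

theorem average_const [CompleteSpace E'] (x : M) (a : E') : A.average x (fun _ => a) = a := by
  unfold average
  rw [A.fibreIntegral.integral_congr (ψ := fun _ => (1 : ℝ) • a) fun y hy => by simp [hy],
    A.fibreIntegral.integral_smul_const 𝒢.contMDiff_target.continuous continuousOn_const]
  exact inv_smul_smul₀ (A.mass_pos x).ne' a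

theorem average_translate {g : G} {Φ : {h : G // 𝒢.target h = 𝒢.target g} → E'}
    (hΦ : Continuous Φ) :
    A.average (𝒢.target g) Φ = A.average (𝒢.source g) fun h =>
      Φ ⟨𝒢.mul g h, 𝒢.target_mul _ _ h.2.symm⟩ := by
  unfold average
  rw [A.mass_target, A.integral_translate (continuousOn_extend hΦ)]
  refine congrArg _ (A.fibreIntegral.integral_congr fun y hy => ?_)
  simp only [hy, 𝒢.target_mul _ _ hy.symm, dite_true]

variable {EP HP : Type*} [NormedAddCommGroup EP] [NormedSpace ℝ EP] [TopologicalSpace HP]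
  {K : ModelWithCorners ℝ EP HP} [K.Boundaryless] {P : Type*} [TopologicalSpace P]
  [ChartedSpace HP P] [IsManifold K ∞ P]

/-- Averages depend smoothly on parameters. -/
theorem contMDiffAt_average {x : P → M} {Φ : ∀ p, {h : G // 𝒢.target h = x p} → E'} {U : Set P}
    (hU : IsOpen U) {p₀ : P} (hp₀ : p₀ ∈ U) (hx : ContMDiffOn K 𝓘(ℝ, EM) ∞ x U)
    (hΦ : ∀ p ∈ U, ∀ y, 𝒢.target y = x p → ∃ Φ' : P × G → E',
      ContMDiffAt (K.prod 𝓘(ℝ, EG)) 𝓘(ℝ, E') ∞ Φ' (p, y) ∧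
      ∀ᶠ z in 𝓝 (p, y), ∀ hz : 𝒢.target z.2 = x z.1, Φ' z = Φ z.1 ⟨z.2, hz⟩) :
    ContMDiffAt K 𝓘(ℝ, E') ∞ (fun p => A.average (x p) (Φ p)) p₀ := by
  have ht : Continuous 𝒢.target := 𝒢.contMDiff_target.continuous
  have hmass : ContMDiffAt K 𝓘(ℝ, ℝ) ∞ (fun p => A.mass (x p)) p₀ :=
    A.fibreIntegral.contMDiffAt_integral ht hU hp₀ hx fun p _ y _ =>
      ⟨fun _ => 1, contMDiffAt_const, Eventually.of_forall fun _ _ => rfl⟩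
  refine (hmass.inv₀ (A.mass_pos _).ne').smul
    (A.fibreIntegral.contMDiffAt_integral ht hU hp₀ hx fun p hp y hy => ?_)
  obtain ⟨Φ', h1, h2⟩ := hΦ p hp y hy
  refine ⟨Φ', h1, ?_⟩
  filter_upwards [h2] with z hz hzx
  rw [dif_pos hzx]
  exact hz hzx

end Integral

end HaarData

end LieGroupoid

/-! ### Averages with values in a tangent space. -/

namespace LieGroupoid.HaarData

variable {EM EG M G : Type*}
  [NormedAddCommGroup EM] [NormedSpace ℝ EM] [NormedAddCommGroup EG] [NormedSpace ℝ EG]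
  [TopologicalSpace M] [ChartedSpace EM M] [IsManifold 𝓘(ℝ, EM) ∞ M]
  [TopologicalSpace G] [ChartedSpace EG G] [IsManifold 𝓘(ℝ, EG) ∞ G]
  {𝒢 : LieGroupoid EM EG M G} (A : 𝒢.HaarData) [T2Space M]
  {E E' : Type*} [NormedAddCommGroup E] [NormedSpace ℝ E] [FiniteDimensional ℝ E]
  [NormedAddCommGroup E'] [NormedSpace ℝ E'] [FiniteDimensional ℝ E']
  {N N' : Type*} [TopologicalSpace N] [ChartedSpace E N] [IsManifold 𝓘(ℝ, E) ∞ N]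
  [TopologicalSpace N'] [ChartedSpace E' N'] [IsManifold 𝓘(ℝ, E') ∞ N']

/-- The average of a function on the fibre `t⁻¹(x)` with values in the tangent space at `p`. -/
def tangentAverage (x : M) {p : N} (Φ : {h : G // 𝒢.target h = x} → TangentSpace 𝓘(ℝ, E) p) :
    TangentSpace 𝓘(ℝ, E) p :=
  A.average (E' := E) x Φ

theorem linearMap_average {x : M} {Φ : {h : G // 𝒢.target h = x} → E} (hΦ : Continuous Φ)
    (L : E →ₗ[ℝ] E') : L (A.average x Φ) = A.average x fun h => L (Φ h) :=
  haveI := FiniteDimensional.complete ℝ E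
  haveI := FiniteDimensional.complete ℝ E'
  (A.average_comp_clm hΦ L.toContinuousLinearMap).symm

theorem map_tangentAverage {x : M} {p : N} {q : N'}
    {Φ : {h : G // 𝒢.target h = x} → TangentSpace 𝓘(ℝ, E) p} (hΦ : Continuous Φ)
    (L : TangentSpace 𝓘(ℝ, E) p →ₗ[ℝ] TangentSpace 𝓘(ℝ, E') q) :
    L (A.tangentAverage x Φ) = A.tangentAverage x fun h => L (Φ h) :=
  A.linearMap_average (E := E) (E' := E') hΦ L

theorem tangentAverage_add {x : M} {p : N}
    {Φ Ψ : {h : G // 𝒢.target h = x} → TangentSpace 𝓘(ℝ, E) p} (hΦ : Continuous Φ)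
    (hΨ : Continuous Ψ) :
    A.tangentAverage x (fun h => Φ h + Ψ h) = A.tangentAverage x Φ + A.tangentAverage x Ψ :=
  A.average_add (E' := E) hΦ hΨ

theorem tangentAverage_const (x : M) {p : N} (v : TangentSpace 𝓘(ℝ, E) p) :
    A.tangentAverage x (fun _ => v) = v :=
  haveI := FiniteDimensional.complete ℝ E
  A.average_const (E' := E) x v

theorem tangentAverage_translate {g : G} {p : N}
    {Φ : {h : G // 𝒢.target h = 𝒢.target g} → TangentSpace 𝓘(ℝ, E) p} (hΦ : Continuous Φ) :
    A.tangentAverage (𝒢.target g) Φ = A.tangentAverage (𝒢.source g) fun h =>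
      Φ ⟨𝒢.mul g h, 𝒢.target_mul _ _ h.2.symm⟩ :=
  A.average_translate (E' := E) hΦ

/-- A linear map on a product is a sum of linear maps in each variable. Needed for `divDeriv`, which
is linear in the pair of vectors. -/
theorem map_tangentAverage_prod {x : M} {p p' : N} {q : N'}
    {Φ : {h : G // 𝒢.target h = x} → TangentSpace 𝓘(ℝ, E) p}
    {Ψ : {h : G // 𝒢.target h = x} → TangentSpace 𝓘(ℝ, E) p'} (hΦ : Continuous Φ)
    (hΨ : Continuous Ψ)
    (L : TangentSpace 𝓘(ℝ, E) p × TangentSpace 𝓘(ℝ, E) p' →ₗ[ℝ] TangentSpace 𝓘(ℝ, E') q) :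
    L (A.tangentAverage x Φ, A.tangentAverage x Ψ) =
      A.tangentAverage x fun h => L (Φ h, Ψ h) := by
  have hlin : ∀ L' : E →ₗ[ℝ] E', Continuous L' := fun L' => L'.continuous_of_finiteDimensional
  have h1 : ∀ v w, L (v, w) = (L ∘ₗ LinearMap.inl ℝ _ _) v + (L ∘ₗ LinearMap.inr ℝ _ _) w := by
    intro v w
    simp [← map_add]
  have h2 : Continuous fun h => (L ∘ₗ LinearMap.inl ℝ _ _) (Φ h) :=
    (hlin (L ∘ₗ LinearMap.inl ℝ _ _)).comp hΦ
  have h3 : Continuous fun h => (L ∘ₗ LinearMap.inr ℝ _ _) (Ψ h) :=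
    (hlin (L ∘ₗ LinearMap.inr ℝ _ _)).comp hΨ
  rw [h1, A.map_tangentAverage hΦ, A.map_tangentAverage hΨ, ← A.tangentAverage_add h2 h3]
  exact congrArg _ (funext fun h => (h1 _ _).symm)

theorem _root_.continuous_of_continuous_mk {Y : Type*} [TopologicalSpace Y] {p : N}
    {Φ : Y → TangentSpace 𝓘(ℝ, E) p}
    (h : Continuous fun y => (⟨p, Φ y⟩ : TangentBundle 𝓘(ℝ, E) N)) : Continuous Φ :=
  (FiberBundle.totalSpaceMk_isInducing E (TangentSpace 𝓘(ℝ, E) : N → Type _) p).continuous_iff.2 h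

variable {EP HP : Type*} [NormedAddCommGroup EP] [NormedSpace ℝ EP] [TopologicalSpace HP]
  {K : ModelWithCorners ℝ EP HP} [K.Boundaryless] {P : Type*} [TopologicalSpace P]
  [ChartedSpace HP P] [IsManifold K ∞ P]

/-- For fixed `p` all averaged vectors lie over the single point `b p`. A trivialization near `b p₀`
is linear on fibres, so it commutes with averaging and reduces the claim to averages in the model
space. -/
theorem contMDiffAt_tangentAverage {x : P → M} {b : P → N}
    {Φ : ∀ p, {h : G // 𝒢.target h = x p} → TangentSpace 𝓘(ℝ, E) (b p)} {U : Set P}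
    (hU : IsOpen U) {p₀ : P} (hp₀ : p₀ ∈ U) (hx : ContMDiffOn K 𝓘(ℝ, EM) ∞ x U)
    (hb : ContMDiffOn K 𝓘(ℝ, E) ∞ b U)
    (hΦ : ∀ p ∈ U, ∀ y, 𝒢.target y = x p → ∃ Φ' : P × G → TangentBundle 𝓘(ℝ, E) N,
      ContMDiffAt (K.prod 𝓘(ℝ, EG)) 𝓘(ℝ, E).tangent ∞ Φ' (p, y) ∧
      ∀ᶠ z in 𝓝 (p, y), ∀ hz : 𝒢.target z.2 = x z.1, Φ' z = ⟨b z.1, Φ z.1 ⟨z.2, hz⟩⟩) :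
    ContMDiffAt K 𝓘(ℝ, E).tangent ∞
      (fun p => (⟨b p, A.tangentAverage (x p) (Φ p)⟩ : TangentBundle 𝓘(ℝ, E) N)) p₀ := by
  have hcont : ∀ p ∈ U, Continuous (Φ p) := by
    intro p hp
    refine continuous_of_continuous_mk (continuous_iff_continuousAt.2 fun y => ?_)
    obtain ⟨Φ', h1, h2⟩ := hΦ p hp y y.2
    have h3 : ContinuousAt (fun h : {h : G // 𝒢.target h = x p} => (p, h.1)) y := by fun_prop
    refine (ContinuousAt.comp (f := fun h : {h : G // 𝒢.target h = x p} => (p, h.1)) (x := y)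
      (g := Φ') h1.continuousAt h3).congr ?_
    filter_upwards [h3.eventually h2] with h hh using hh h.2
  set e := trivializationAt E (TangentSpace 𝓘(ℝ, E) : N → Type _) (b p₀) with he
  have hbe : b p₀ ∈ e.baseSet := FiberBundle.mem_baseSet_trivializationAt' (b p₀)
  set V : Set P := U ∩ b ⁻¹' e.baseSet
  have hV : IsOpen V := hb.continuousOn.isOpen_inter_preimage hU e.open_baseSet
  refine (e.contMDiffAt_iff (e.mem_source.2 hbe)).2
    ⟨hb.contMDiffAt (hU.mem_nhds hp₀), ?_⟩
  have havg : ∀ p ∈ V, (e ⟨b p, A.tangentAverage (x p) (Φ p)⟩).2 =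
      A.average (x p) fun h => (e ⟨b p, Φ p h⟩).2 := by
    intro p hp
    have hL : ∀ v : TangentSpace 𝓘(ℝ, E) (b p),
        e.linearMapAt ℝ (b p) v = (e ⟨b p, v⟩).2 := fun v => by
      rw [e.linearMapAt_apply, if_pos (show b p ∈ e.baseSet from hp.2)]
    simp only [← hL]
    exact A.linearMap_average (E := E) (E' := E) (hcont p hp.1) (e.linearMapAt ℝ (b p))
  have hsm : ContMDiffAt K 𝓘(ℝ, E) ∞
      (fun p => A.average (x p) fun h => (e ⟨b p, Φ p h⟩).2) p₀ := by
    refine A.contMDiffAt_average hV ⟨hp₀, hbe⟩ (hx.mono inter_subset_left) fun p hp y hy => ?_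
    obtain ⟨Φ', h1, h2⟩ := hΦ p hp.1 y hy
    refine ⟨fun z => (e (Φ' z)).2, ?_, ?_⟩
    · refine ((e.contMDiffAt_iff (e.mem_source.2 ?_)).1 h1).2
      rw [h2.self_of_nhds hy]
      exact hp.2
    · filter_upwards [h2] with z hz hzx
      rw [hz hzx]
  refine hsm.congr_of_eventuallyEq ?_
  filter_upwards [hV.mem_nhds ⟨hp₀, hbe⟩] with p hp using havg p hp

end LieGroupoid.HaarData

/-! ### Finite powers of a manifold. -/

section Pi

variable {n : ℕ} {E : Type*} [NormedAddCommGroup E] [NormedSpace ℝ E] {N : Type*}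
  [TopologicalSpace N] [ChartedSpace E N]
  {E' H' X : Type*} [NormedAddCommGroup E'] [NormedSpace ℝ E'] [TopologicalSpace H']
  {J : ModelWithCorners ℝ E' H'} [TopologicalSpace X] [ChartedSpace H' X]

instance IsManifold.pi [IsManifold 𝓘(ℝ, E) ∞ N] :
    IsManifold (ModelWithCorners.pi fun _ : Fin n => 𝓘(ℝ, E)) ∞ (Fin n → N) := by
  refine isManifold_of_contDiffOn _ _ _ ?_
  rintro _ _ ⟨a, ha, rfl⟩ ⟨b, hb, rfl⟩
  refine contDiffOn_pi.2 fun i => ?_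
  have h : (a i).symm ≫ₕ b i ∈ contDiffGroupoid ∞ 𝓘(ℝ, E) :=
    HasGroupoid.compatible (ha i (mem_univ i)) (hb i (mem_univ i))
  rw [contDiffGroupoid, mem_groupoid_of_pregroupoid] at h
  have h1 : ContDiffOn ℝ ∞ (b i ∘ (a i).symm) ((a i).symm ≫ₕ b i).source := by
    simpa [contDiffPregroupoid] using h.1
  refine h1.comp (contDiff_apply ℝ E i).contDiffOn fun x hx => ?_
  have h2 : x ∈ ((OpenPartialHomeomorph.pi a).symm ≫ₕ OpenPartialHomeomorph.pi b).source := hx.1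
  rw [OpenPartialHomeomorph.trans_source] at h2 ⊢
  exact ⟨h2.1 i (mem_univ i), h2.2 i (mem_univ i)⟩

theorem contMDiffAt_pi {f : X → Fin n → N} {x : X}
    (h : ∀ i, ContMDiffAt J 𝓘(ℝ, E) ∞ (fun y => f y i) x) :
    ContMDiffAt J (ModelWithCorners.pi fun _ : Fin n => 𝓘(ℝ, E)) ∞ f x :=
  ⟨continuousWithinAt_pi.2 fun i => (h i).continuousAt.continuousWithinAt,
    contDiffWithinAt_pi.2 fun i => (h i).2⟩

end Pi

/-! ### Strings of arrows: local retractions and the appending of an arrow. -/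

namespace LieGroupoid

variable {EM EG M G : Type*}
  [NormedAddCommGroup EM] [NormedSpace ℝ EM] [NormedAddCommGroup EG] [NormedSpace ℝ EG]
  [TopologicalSpace M] [ChartedSpace EM M] [IsManifold 𝓘(ℝ, EM) ∞ M]
  [TopologicalSpace G] [ChartedSpace EG G] [IsManifold 𝓘(ℝ, EG) ∞ G]
  (𝒢 : LieGroupoid EM EG M G)

theorem cons_mem_strings {n : ℕ} {a : G} {g : Fin (n + 1) → G} (hg : g ∈ 𝒢.strings n)
    (h : 𝒢.source a = 𝒢.target (g 0)) :
    (Fin.cons a g : Fin (n + 2) → G) ∈ 𝒢.strings (n + 1) := by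
  intro i
  refine Fin.cases ?_ (fun j => ?_) i
  · simpa using h
  · rw [Fin.cons_succ, ← Fin.succ_castSucc, Fin.cons_succ]
    exact hg j

/-- The submanifold of strings is locally a smooth retract. -/
theorem exists_retraction_strings [FiniteDimensional ℝ EG] (n : ℕ) {g₀ : Fin (n + 1) → G}
    (hg₀ : g₀ ∈ 𝒢.strings n) :
    ∃ U : Set (Fin (n + 1) → G), IsOpen U ∧ g₀ ∈ U ∧ ∃ r : (Fin (n + 1) → G) → Fin (n + 1) → G,
      ContMDiffOn (ModelWithCorners.pi fun _ : Fin (n + 1) => 𝓘(ℝ, EG))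
        (ModelWithCorners.pi fun _ : Fin (n + 1) => 𝓘(ℝ, EG)) ∞ r U ∧
      (∀ g ∈ U, r g ∈ 𝒢.strings n) ∧ ∀ g ∈ 𝒢.strings n, g ∈ U → r g = g := by
  obtain ⟨d, hd⟩ := 𝒢.isSubmersion_source.exists_fibredChart
  induction n with
  | zero =>
    exact ⟨univ, isOpen_univ, trivial, id, contMDiffOn_id, fun g _ i => i.elim0, fun _ _ _ => rfl⟩
  | succ n ih =>
    have htail : ∀ g ∈ 𝒢.strings (n + 1), Fin.tail g ∈ 𝒢.strings n := fun g hg i => hg i.succ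
    obtain ⟨U', hU', hgU', r', hr', hrs, hrid⟩ := ih (htail g₀ hg₀)
    obtain ⟨c, hc⟩ := hd (g₀ 0)
    have ht : ContMDiff (ModelWithCorners.pi fun _ : Fin (n + 2) => 𝓘(ℝ, EG))
        (ModelWithCorners.pi fun _ : Fin (n + 1) => 𝓘(ℝ, EG)) ∞
        (fun g : Fin (n + 2) → G => Fin.tail g) :=
      fun g => contMDiffAt_pi fun i => contMDiff_coord i.succ g
    set V : Set (Fin (n + 2) → G) := Fin.tail ⁻¹' U' ∩ (fun g => g 0) ⁻¹' c.source
    have hV : IsOpen V := (hU'.preimage ht.continuous).inter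
      (c.open_source.preimage (continuous_apply 0))
    have hr1 : ContMDiffOn (ModelWithCorners.pi fun _ : Fin (n + 2) => 𝓘(ℝ, EG))
        (ModelWithCorners.pi fun _ : Fin (n + 1) => 𝓘(ℝ, EG)) ∞ (fun g => r' (Fin.tail g)) V :=
      hr'.comp ht.contMDiffOn fun g hg => hg.1
    -- The first arrow keeps its fibre coordinate and receives the source demanded by the retracted
    -- tail.
    set z : (Fin (n + 2) → G) → M × (Fin d → ℝ) :=
      fun g => (𝒢.target (r' (Fin.tail g) 0), c.coord (g 0))
    have hz : ContMDiffOn (ModelWithCorners.pi fun _ : Fin (n + 2) => 𝓘(ℝ, EG))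
        (𝓘(ℝ, EM).prod 𝓘(ℝ, Fin d → ℝ)) ∞ z V :=
      ((𝒢.contMDiff_target.comp (contMDiff_coord 0)).comp_contMDiffOn hr1).prodMk
        (c.contMDiffOn_coord.comp (contMDiff_coord 0).contMDiffOn fun g hg => hg.2)
    have hzid : ∀ g ∈ 𝒢.strings (n + 1), g ∈ V → z g = (𝒢.source (g 0), c.coord (g 0)) := by
      intro g hg hgV
      refine Prod.ext ?_ rfl
      change 𝒢.target (r' (Fin.tail g) 0) = _
      rw [hrid _ (htail g hg) hgV.1]
      exact (hg 0).symm
    have hVz := hz.continuousOn.isOpen_inter_preimage hV c.open_target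
    refine ⟨V ∩ z ⁻¹' c.target, hVz, ⟨⟨hgU', hc⟩, ?_⟩,
      fun g => Fin.cons (c.param (z g)) (r' (Fin.tail g)), ?_, fun g hg => ?_, fun g hg hgV => ?_⟩
    · change z g₀ ∈ c.target
      rw [hzid g₀ hg₀ ⟨hgU', hc⟩]
      exact c.map_source _ hc
    · intro g hg
      refine (contMDiffAt_pi fun i => ?_).contMDiffWithinAt
      refine Fin.cases ?_ (fun j => ?_) i
      · simp only [Fin.cons_zero]
        exact (c.contMDiffOn_param.comp (hz.mono inter_subset_left) fun g hg => hg.2).contMDiffAt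
          (hVz.mem_nhds hg)
      · simp only [Fin.cons_succ]
        exact (contMDiff_coord j _).comp g (hr1.contMDiffAt (hV.mem_nhds hg.1))
    · refine 𝒢.cons_mem_strings (hrs _ hg.1.1) ?_
      rw [c.fst_param _ hg.2]
    · simp only
      rw [hzid g hg hgV.1, c.left_inv _ hgV.1.2, hrid _ (htail g hg) hgV.1.1]
      exact Fin.cons_self_tail g

/-! ### Appending an arrow -/

/-- `(g₁, …, gₙ₊₁, h)`. -/
def appendArrow {n : ℕ} (g : 𝒢.strings n)
    (h : {h : G // 𝒢.target h = 𝒢.source (g.1 (Fin.last n))}) : 𝒢.strings (n + 1) :=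
  ⟨Fin.snoc (α := fun _ => G) g.1 h.1, by
    intro i
    refine Fin.lastCases ?_ (fun j => ?_) i
    · rw [Fin.succ_last, Fin.snoc_last, Fin.snoc_castSucc]
      exact h.2.symm
    · rw [Fin.snoc_castSucc, Fin.succ_castSucc, Fin.snoc_castSucc]
      exact g.2 j⟩

variable {𝒢}

theorem appendArrow_zero {n : ℕ} (g : 𝒢.strings n)
    (h : {h : G // 𝒢.target h = 𝒢.source (g.1 (Fin.last n))}) :
    (𝒢.appendArrow g h).1 0 = g.1 0 :=
  Fin.snoc_castSucc (α := fun _ => G) h.1 g.1 0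

theorem tail_snoc {X : Type*} {n : ℕ} (g : Fin (n + 1) → X) (h : X) :
    Fin.tail (Fin.snoc (α := fun _ => X) g h : Fin (n + 2) → X) =
      Fin.snoc (α := fun _ => X) (Fin.tail g) h := by
  conv_lhs => rw [← Fin.cons_self_tail g, ← Fin.cons_snoc_eq_snoc_cons]
  exact Fin.tail_cons _ _

theorem tailString_appendArrow {n : ℕ} (g : 𝒢.strings (n + 1))
    (h : {h : G // 𝒢.target h = 𝒢.source (g.1 (Fin.last (n + 1)))}) :
    𝒢.tailString (𝒢.appendArrow g h) = 𝒢.appendArrow (𝒢.tailString g) h :=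
  Subtype.ext (tail_snoc _ _)

theorem contractString_last_appendArrow {n : ℕ} (g : 𝒢.strings n)
    (h : {h : G // 𝒢.target h = 𝒢.source (g.1 (Fin.last n))}) :
    𝒢.contractString (Fin.last (n + 1)) (𝒢.appendArrow g h) = g := by
  refine Subtype.ext (funext fun i => ?_)
  have hi : (i : ℕ) < (Fin.last (n + 1) : Fin (n + 2)) := by
    simpa using i.is_le
  exact (Fin.contractNth_apply_of_lt _ 𝒢.mul _ i hi).trans
    (Fin.snoc_castSucc (α := fun _ => G) h.1 g.1 i)

theorem last_contractString {n : ℕ} (j : Fin (n + 1)) (g : 𝒢.strings (n + 1)) :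
    𝒢.source ((𝒢.contractString j.castSucc g).1 (Fin.last n)) =
      𝒢.source (g.1 (Fin.last (n + 1))) := by
  have h := g.2 (Fin.last n)
  rcases (Fin.le_last j).lt_or_eq with hj | rfl
  · refine congrArg _ (Fin.contractNth_apply_of_gt _ 𝒢.mul g.1 (Fin.last n) ?_)
    simpa using Fin.lt_def.1 hj
  · refine (congrArg _ (Fin.contractNth_apply_of_eq _ 𝒢.mul g.1 (Fin.last n) ?_)).trans
      (𝒢.source_mul _ _ h)
    simp

theorem contractString_castSucc_appendArrow {n : ℕ} (j : Fin (n + 1)) (g : 𝒢.strings (n + 1))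
    (h : {h : G // 𝒢.target h = 𝒢.source (g.1 (Fin.last (n + 1)))}) :
    𝒢.contractString j.castSucc.castSucc (𝒢.appendArrow g h) =
      𝒢.appendArrow (𝒢.contractString j.castSucc g)
        ⟨h.1, h.2.trans (last_contractString j g).symm⟩ := by
  refine Subtype.ext (funext fun i => ?_)
  refine Fin.lastCases ?_ (fun i => ?_) i
  · refine (Fin.contractNth_apply_of_gt _ 𝒢.mul _ (Fin.last (n + 1)) ?_).trans ?_
    · simpa using j.is_le
    · simp only [appendArrow, Fin.succ_last, Fin.snoc_last]
  · refine Eq.trans ?_ (Fin.snoc_castSucc (α := fun _ => G) h.1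
      (𝒢.contractString j.castSucc g).1 i).symm
    rcases lt_trichotomy (i : ℕ) j with hij | hij | hij
    · refine (Fin.contractNth_apply_of_lt _ 𝒢.mul _ i.castSucc (by simpa using hij)).trans ?_
      refine Eq.trans ?_ (Fin.contractNth_apply_of_lt _ 𝒢.mul g.1 i (by simpa using hij)).symm
      simp only [appendArrow, Fin.snoc_castSucc]
    · refine (Fin.contractNth_apply_of_eq _ 𝒢.mul _ i.castSucc (by simpa using hij)).trans ?_
      refine Eq.trans ?_ (Fin.contractNth_apply_of_eq _ 𝒢.mul g.1 i (by simpa using hij)).symm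
      simp only [appendArrow, Fin.snoc_castSucc, Fin.succ_castSucc]
    · refine (Fin.contractNth_apply_of_gt _ 𝒢.mul _ i.castSucc (by simpa using hij)).trans ?_
      refine Eq.trans ?_ (Fin.contractNth_apply_of_gt _ 𝒢.mul g.1 i (by simpa using hij)).symm
      simp only [appendArrow, Fin.snoc_castSucc, Fin.succ_castSucc]

theorem source_contractString_last {n : ℕ} (g : 𝒢.strings (n + 1)) :
    𝒢.source ((𝒢.contractString (Fin.last (n + 1)) g).1 (Fin.last n)) =
      𝒢.target (g.1 (Fin.last (n + 1))) := by
  refine (congrArg _ (Fin.contractNth_apply_of_lt _ 𝒢.mul g.1 (Fin.last n) ?_)).trans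
    (g.2 (Fin.last n))
  simp

/-- The one face that multiplies into the appended arrow: it amounts to a left translation of `h`,
which invariance of the average absorbs. -/
theorem contractString_castSucc_last_appendArrow {n : ℕ} (g : 𝒢.strings (n + 1))
    (h : {h : G // 𝒢.target h = 𝒢.source (g.1 (Fin.last (n + 1)))}) :
    𝒢.contractString (Fin.last (n + 1)).castSucc (𝒢.appendArrow g h) =
      𝒢.appendArrow (𝒢.contractString (Fin.last (n + 1)) g)
        ⟨𝒢.mul (g.1 (Fin.last (n + 1))) h.1, (𝒢.target_mul _ _ h.2.symm).trans
          (source_contractString_last g).symm⟩ := by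
  refine Subtype.ext (funext fun i => ?_)
  refine Fin.lastCases ?_ (fun i => ?_) i
  · refine (Fin.contractNth_apply_of_eq _ 𝒢.mul _ (Fin.last (n + 1)) (by simp)).trans ?_
    simp only [appendArrow, Fin.succ_last, Fin.snoc_last, Fin.snoc_castSucc]
  · refine Eq.trans ?_ (Fin.snoc_castSucc (α := fun _ => G) _
      (𝒢.contractString (Fin.last (n + 1)) g).1 i).symm
    refine (Fin.contractNth_apply_of_lt _ 𝒢.mul _ i.castSucc (by simpa using i.is_le)).trans ?_
    refine Eq.trans ?_ (Fin.contractNth_apply_of_lt _ 𝒢.mul g.1 i (by simpa using i.is_le)).symm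
    simp only [appendArrow, Fin.snoc_castSucc]

theorem continuous_appendArrow {n : ℕ} (g : 𝒢.strings n) : Continuous (𝒢.appendArrow g) := by
  refine Continuous.subtype_mk (continuous_pi fun i => ?_) _
  refine Fin.lastCases ?_ (fun i => ?_) i
  · simpa only [Fin.snoc_last] using continuous_subtype_val
  · simpa only [Fin.snoc_castSucc] using continuous_const

end LieGroupoid

/-! ### Averaging over the last arrow, and vanishing in degrees at least two. -/

namespace LieGroupoid

variable {EM EG M G : Type*}
  [NormedAddCommGroup EM] [NormedSpace ℝ EM] [NormedAddCommGroup EG] [NormedSpace ℝ EG]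
  [TopologicalSpace M] [ChartedSpace EM M] [IsManifold 𝓘(ℝ, EM) ∞ M]
  [TopologicalSpace G] [ChartedSpace EG G] [IsManifold 𝓘(ℝ, EG) ∞ G]
  (𝒢 : LieGroupoid EM EG M G)

/-- Every tangent space is by definition the model space, and the transport is the identity there.
Vectors over equal but syntactically different points can thus be averaged together. -/
theorem _root_.tangentCast_eq {E X : Type*} [NormedAddCommGroup E] [NormedSpace ℝ E]
    [TopologicalSpace X] [ChartedSpace E X] {x y : X} (h : x = y) (v : TangentSpace 𝓘(ℝ, E) x) :
    (tangentCast 𝓘(ℝ, E) h v : E) = v := by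
  subst h; rfl

/-- The differential of the source map, with all tangent spaces identified with the model. -/
def sourceDeriv (p : G) : EG →L[ℝ] EM :=
  mfderiv 𝓘(ℝ, EG) 𝓘(ℝ, EM) 𝒢.source p

/-- The differential of the division map, with all tangent spaces identified with the model. -/
def modelDivDeriv (p q : G) : EG × EG →L[ℝ] EG :=
  𝒢.divDeriv p q

/-- A family of tangent vectors, with all tangent spaces identified with the model. -/
def modelCochain {n : ℕ} (c : 𝒢.StringField n) (g : 𝒢.strings n) : EG := c g

variable {𝒢}

theorem modelCochain_delta {n : ℕ} (c : 𝒢.StringField n) (g : 𝒢.strings (n + 1)) :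
    𝒢.modelCochain (𝒢.delta n c) g =
      - 𝒢.modelDivDeriv ((𝒢.contractString 0 g).1 0) ((𝒢.tailString g).1 0)
          (𝒢.modelCochain c (𝒢.contractString 0 g), 𝒢.modelCochain c (𝒢.tailString g))
      + ∑ j : Fin (n + 1), (-1 : ℝ) ^ ((j : ℕ) + 2) •
          𝒢.modelCochain c (𝒢.contractString j.succ g) := by
  have h : 𝒢.delta n c g =
      - (tangentCast 𝓘(ℝ, EG) (𝒢.div_string g)
        (𝒢.divDeriv ((𝒢.contractString 0 g).1 0) ((𝒢.tailString g).1 0)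
          (c (𝒢.contractString 0 g), c (𝒢.tailString g))))
      + ∑ j : Fin (n + 1), (-1 : ℝ) ^ ((j : ℕ) + 2) •
        (tangentCast 𝓘(ℝ, EG) (𝒢.contractString_succ_zero j g)
          (c (𝒢.contractString j.succ g))) := by
    simp [delta]
  refine h.trans (congrArg₂ (fun a b : EG => -a + b) (tangentCast_eq _ _) ?_)
  exact Finset.sum_congr rfl fun j _ =>
    congrArg (fun v : EG => (-1 : ℝ) ^ ((j : ℕ) + 2) • v) (tangentCast_eq _ _)

/-- The first arrow must be fixed: only then do the values lie in one fibre, whose topology is that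
of the model. -/
theorem continuous_modelCochain [FiniteDimensional ℝ EG] {n : ℕ} {c : 𝒢.StringField n}
    (hc : c ∈ 𝒢.cochains n) {Y : Type*} [TopologicalSpace Y] {f : Y → 𝒢.strings n}
    (hf : Continuous f) {p : G} (hp : ∀ y, (f y).1 0 = p) :
    Continuous fun y => 𝒢.modelCochain c (f y) := by
  have h1 := hc.1.continuous.comp hf
  have h2 : Continuous fun y => tangentCast 𝓘(ℝ, EG) (hp y) (c (f y)) := by
    refine continuous_of_continuous_mk (E := EG) (p := p) (N := G) ?_
    convert h1 using 2 with y
    exact mk_tangentCast _ _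
  have h3 : (fun y => 𝒢.modelCochain c (f y)) = fun y => tangentCast 𝓘(ℝ, EG) (hp y) (c (f y)) :=
    funext fun y => (tangentCast_eq (hp y) (c (f y))).symm
  rw [h3]
  exact h2

namespace HaarData

variable (A : 𝒢.HaarData) {E' : Type*} [NormedAddCommGroup E'] [NormedSpace ℝ E'] [T2Space M]

theorem average_congr {x y : M} (hxy : x = y) {Φ : {h : G // 𝒢.target h = x} → E'}
    {Ψ : {h : G // 𝒢.target h = y} → E'} (h : ∀ g, Φ g = Ψ ⟨g.1, g.2.trans hxy⟩) :
    A.average x Φ = A.average y Ψ := by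
  subst hxy
  exact congrArg _ (funext h)

/-- The operator on cochains which averages over the last arrow. -/
def contraction {n : ℕ} (c : 𝒢.StringField (n + 1)) : 𝒢.StringField n := fun g =>
  A.tangentAverage (𝒢.source (g.1 (Fin.last n))) fun h =>
    tangentCast 𝓘(ℝ, EG) (appendArrow_zero g h) (c (𝒢.appendArrow g h))

theorem modelCochain_contraction {n : ℕ} (c : 𝒢.StringField (n + 1)) (g : 𝒢.strings n) :
    𝒢.modelCochain (A.contraction c) g =
      A.average (𝒢.source (g.1 (Fin.last n))) fun h => 𝒢.modelCochain c (𝒢.appendArrow g h) :=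
  A.average_congr (E' := EG)
    (Φ := fun h => tangentCast 𝓘(ℝ, EG) (appendArrow_zero g h) (c (𝒢.appendArrow g h)))
    rfl fun h => tangentCast_eq (appendArrow_zero g h) (c (𝒢.appendArrow g h))

variable [FiniteDimensional ℝ EG]

/-- For faces away from `h` appending commutes with contracting, so this is the definition of the
contraction; for the face containing `g_last h` it is left invariance. -/
theorem average_contractString {n : ℕ} {c : 𝒢.StringField (n + 1)} (hc : c ∈ 𝒢.cochains (n + 1))
    (j : Fin (n + 2)) (g : 𝒢.strings (n + 1)) :
    Continuous (fun h : {h : G // 𝒢.target h = 𝒢.source (g.1 (Fin.last (n + 1)))} =>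
      𝒢.modelCochain c (𝒢.contractString j.castSucc (𝒢.appendArrow g h))) ∧
    A.average (𝒢.source (g.1 (Fin.last (n + 1))))
        (fun h => 𝒢.modelCochain c (𝒢.contractString j.castSucc (𝒢.appendArrow g h))) =
      𝒢.modelCochain (A.contraction c) (𝒢.contractString j g) := by
  rw [modelCochain_contraction]
  refine Fin.lastCases ?_ (fun j => ?_) j
  · have hx := source_contractString_last g
    simp only [contractString_castSucc_last_appendArrow]
    have h2 : Continuous fun h : {h : G // 𝒢.target h = 𝒢.target (g.1 (Fin.last (n + 1)))} =>
        𝒢.modelCochain c (𝒢.appendArrow (𝒢.contractString (Fin.last (n + 1)) g)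
          ⟨h.1, h.2.trans hx.symm⟩) :=
      continuous_modelCochain hc ((continuous_appendArrow _).comp
        (continuous_subtype_val.subtype_mk _)) fun h => appendArrow_zero _ _
    have h3 : Continuous fun h : {h : G // 𝒢.target h = 𝒢.source (g.1 (Fin.last (n + 1)))} =>
        𝒢.mul (g.1 (Fin.last (n + 1))) h.1 :=
      continuousOn_iff_continuous_domRestrict.1 (continuousOn_mul_left (g.1 (Fin.last (n + 1))))
    exact ⟨h2.comp (h3.subtype_mk fun h => 𝒢.target_mul _ _ h.2.symm),
      (A.average_translate h2).symm.trans (A.average_congr hx.symm fun h => rfl)⟩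
  · simp only [contractString_castSucc_appendArrow]
    exact ⟨continuous_modelCochain hc ((continuous_appendArrow _).comp
        (continuous_subtype_val.subtype_mk _)) fun h => appendArrow_zero _ _,
      A.average_congr (last_contractString j g).symm fun h => rfl⟩

/-- The contraction is a contracting homotopy on cocycles. -/
theorem delta_contraction {n : ℕ} {c : 𝒢.StringField (n + 1)} (hc : c ∈ 𝒢.cocycles (n + 1)) :
    𝒢.delta n (A.contraction c) = (-1 : ℝ) ^ n • c := by
  have := FiniteDimensional.complete ℝ EG
  funext g
  set x := 𝒢.source (g.1 (Fin.last (n + 1))) with hx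
  have hcontr := fun j => A.average_contractString hc.1 j g
  have htail : Continuous fun h : {h : G // 𝒢.target h = x} =>
      𝒢.modelCochain c (𝒢.appendArrow (𝒢.tailString g) h) :=
    continuous_modelCochain hc.1 (continuous_appendArrow (𝒢.tailString g))
      fun h => appendArrow_zero _ _
  have htail' : A.average x (fun h => 𝒢.modelCochain c (𝒢.appendArrow (𝒢.tailString g) h)) =
      𝒢.modelCochain (A.contraction c) (𝒢.tailString g) :=
    (A.modelCochain_contraction c (𝒢.tailString g)).symm
  set D : EG × EG →L[ℝ] EG :=
    𝒢.modelDivDeriv ((𝒢.contractString 0 g).1 0) ((𝒢.tailString g).1 0) with hD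
  -- The cocycle identity at `(g, h)`, solved for the last face. That face forgets `h` and has
  -- coefficient `(-1)^(n + 3)`, whence the sign.
  have h0 : ∀ h : {h : G // 𝒢.target h = x}, (-1 : ℝ) ^ n • 𝒢.modelCochain c g =
      - D (𝒢.modelCochain c (𝒢.contractString (Fin.castSucc 0) (𝒢.appendArrow g h)),
          𝒢.modelCochain c (𝒢.appendArrow (𝒢.tailString g) h))
      + ∑ j : Fin (n + 1), (-1 : ℝ) ^ ((j : ℕ) + 2) •
        𝒢.modelCochain c (𝒢.contractString j.succ.castSucc (𝒢.appendArrow g h)) := by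
    intro h
    have h1 : 𝒢.modelCochain (𝒢.delta (n + 1) c) (𝒢.appendArrow g h) = 0 :=
      congrFun (LinearMap.mem_ker.1 hc.2) _
    have h2 : (𝒢.contractString 0 (𝒢.appendArrow g h)).1 0 = (𝒢.contractString 0 g).1 0 :=
      (congrArg (fun z : 𝒢.strings (n + 1) => z.1 0)
        (contractString_castSucc_appendArrow 0 g h)).trans (appendArrow_zero _ _)
    have h3 : (𝒢.appendArrow (𝒢.tailString g) h).1 0 = (𝒢.tailString g).1 0 :=
      appendArrow_zero _ _
    rw [modelCochain_delta, Fin.sum_univ_castSucc, Fin.succ_last, contractString_last_appendArrow,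
      tailString_appendArrow, h2, h3, ← hD, ← add_assoc] at h1
    simp only [Fin.val_castSucc, Fin.succ_castSucc] at h1
    have h4 : (-1 : ℝ) ^ ((Fin.last (n + 1) : ℕ) + 2) = -(-1) ^ n := by
      simp [pow_succ]
    rw [h4, neg_smul, ← sub_eq_add_neg] at h1
    exact (sub_eq_zero.1 h1).symm
  -- All remaining faces are packed into one vector, and the right side becomes one linear map `L`
  -- of it, so averaging commutes with everything at once.
  set Ψ : {h : G // 𝒢.target h = x} → EG × EG × (Fin (n + 1) → EG) := fun h =>
    (𝒢.modelCochain c (𝒢.contractString (Fin.castSucc 0) (𝒢.appendArrow g h)),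
      𝒢.modelCochain c (𝒢.appendArrow (𝒢.tailString g) h),
      fun j => 𝒢.modelCochain c (𝒢.contractString j.succ.castSucc (𝒢.appendArrow g h))) with hΨ
  have hΨc : Continuous Ψ :=
    (hcontr 0).1.prodMk (htail.prodMk (continuous_pi fun j => (hcontr j.succ).1))
  set L : EG × EG × (Fin (n + 1) → EG) →ₗ[ℝ] EG :=
    - (D.toLinearMap ∘ₗ (LinearMap.fst ℝ EG (EG × (Fin (n + 1) → EG))).prod
        (LinearMap.fst ℝ EG (Fin (n + 1) → EG) ∘ₗ LinearMap.snd ℝ EG (EG × (Fin (n + 1) → EG)))) +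
      ∑ j : Fin (n + 1), (-1 : ℝ) ^ ((j : ℕ) + 2) • (LinearMap.proj j ∘ₗ
        LinearMap.snd ℝ EG (Fin (n + 1) → EG) ∘ₗ LinearMap.snd ℝ EG (EG × (Fin (n + 1) → EG)))
    with hLdef
  have hL : ∀ v, L v = - D (v.1, v.2.1) + ∑ j : Fin (n + 1), (-1 : ℝ) ^ ((j : ℕ) + 2) • v.2.2 j := by
    intro v
    simp [hLdef]
  have hav : A.average x Ψ = (𝒢.modelCochain (A.contraction c) (𝒢.contractString 0 g),
      𝒢.modelCochain (A.contraction c) (𝒢.tailString g),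
      fun j => 𝒢.modelCochain (A.contraction c) (𝒢.contractString j.succ g)) := by
    refine Prod.ext ?_ (Prod.ext ?_ (funext fun j => ?_))
    · exact (A.linearMap_average hΨc (LinearMap.fst ℝ EG (EG × (Fin (n + 1) → EG)))).trans
        (hcontr 0).2
    · exact (A.linearMap_average hΨc (LinearMap.fst ℝ EG (Fin (n + 1) → EG) ∘ₗ
        LinearMap.snd ℝ EG (EG × (Fin (n + 1) → EG)))).trans htail'
    · exact (A.linearMap_average hΨc (LinearMap.proj j ∘ₗ
        LinearMap.snd ℝ EG (Fin (n + 1) → EG) ∘ₗ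
        LinearMap.snd ℝ EG (EG × (Fin (n + 1) → EG)))).trans (hcontr j.succ).2
  have h1 := A.linearMap_average hΨc L
  simp only [hL, hav] at h1
  change 𝒢.modelCochain (𝒢.delta n (A.contraction c)) g = (-1 : ℝ) ^ n • 𝒢.modelCochain c g
  rw [modelCochain_delta, ← hD, h1, ← A.average_const x ((-1 : ℝ) ^ n • 𝒢.modelCochain c g)]
  exact congrArg _ (funext fun h => (h0 h).symm)

/-- Smooth dependence of averages needs parameters in a manifold, while strings are only a subset of
a power of `G`. Composing with a local retraction onto the strings supplies the extension to an open
set. -/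
theorem smoothOnSubset_contraction {n : ℕ} {c : 𝒢.StringField (n + 1)}
    (hc : c ∈ 𝒢.cochains (n + 1)) :
    SmoothOnSubset (ModelWithCorners.pi fun _ : Fin (n + 1) => 𝓘(ℝ, EG)) 𝓘(ℝ, EG).tangent
      (𝒢.strings n) (fun g => (⟨g.1 0, A.contraction c g⟩ : TangentBundle 𝓘(ℝ, EG) G)) := by
  classical
  rintro ⟨g₀, hg₀⟩
  obtain ⟨U, hU, hgU, r, hr, hrs, hrid⟩ := 𝒢.exists_retraction_strings n hg₀
  -- The value `0` off the strings is never used: `Φ` is evaluated at points in the image of the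
  -- retraction.
  set Φ : ∀ q : Fin (n + 1) → G, {h : G // 𝒢.target h = 𝒢.source (q (Fin.last n))} →
      TangentSpace 𝓘(ℝ, EG) (q 0) := fun q h =>
    if hq : q ∈ 𝒢.strings n then
      tangentCast 𝓘(ℝ, EG) (appendArrow_zero ⟨q, hq⟩ h) (c (𝒢.appendArrow ⟨q, hq⟩ h))
    else 0 with hΦ
  set F : (Fin (n + 1) → G) → TangentBundle 𝓘(ℝ, EG) G := fun q =>
    ⟨q 0, A.tangentAverage (𝒢.source (q (Fin.last n))) (Φ q)⟩ with hF
  have hri : ∀ i, ContMDiffOn (ModelWithCorners.pi fun _ : Fin (n + 1) => 𝓘(ℝ, EG)) 𝓘(ℝ, EG) ∞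
      (fun p => r p i) U := fun i => (contMDiff_coord i).comp_contMDiffOn hr
  refine ⟨U, hU, hgU, fun p => F (r p), fun p₀ hp₀ => ?_, ?_⟩
  · refine (A.contMDiffAt_tangentAverage (Φ := fun p => Φ (r p)) hU hp₀
      (𝒢.contMDiff_source.comp_contMDiffOn (hri _)) (hri 0)
      fun p hp y hy => ?_).contMDiffWithinAt
    obtain ⟨W, hW, hpW, Fc, hFc, hFce⟩ := hc.1 (𝒢.appendArrow ⟨r p, hrs p hp⟩ ⟨y, hy⟩)
    have hsnoc : ContMDiffAt ((ModelWithCorners.pi fun _ : Fin (n + 1) => 𝓘(ℝ, EG)).prod 𝓘(ℝ, EG))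
        (ModelWithCorners.pi fun _ : Fin (n + 2) => 𝓘(ℝ, EG)) ∞
        (fun z : (Fin (n + 1) → G) × G => (Fin.snoc (α := fun _ => G) (r z.1) z.2 : Fin (n + 2) → G))
        (p, y) := by
      refine contMDiffAt_pi fun i => ?_
      refine Fin.lastCases ?_ (fun i => ?_) i
      · simp only [Fin.snoc_last]
        exact contMDiffAt_snd
      · simp only [Fin.snoc_castSucc]
        exact ((hri i).contMDiffAt (hU.mem_nhds hp)).comp (p, y)
          (contMDiffAt_fst (J := 𝓘(ℝ, EG)))
    refine ⟨fun z => Fc (Fin.snoc (α := fun _ => G) (r z.1) z.2),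
      (hFc.contMDiffAt (hW.mem_nhds hpW)).comp (p, y) hsnoc, ?_⟩
    filter_upwards [hsnoc.continuousAt.preimage_mem_nhds (hW.mem_nhds hpW),
      continuousAt_fst.preimage_mem_nhds (hU.mem_nhds hp)] with z hzW hzU hz
    refine (hFce (𝒢.appendArrow ⟨r z.1, hrs _ hzU⟩ ⟨z.2, hz⟩) hzW).trans ?_
    simp only [hΦ, dif_pos (hrs _ hzU)]
    exact (mk_tangentCast (I := 𝓘(ℝ, EG)) (appendArrow_zero (𝒢 := 𝒢) ⟨r z.1, hrs _ hzU⟩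
      ⟨z.2, hz⟩) _).symm
  · rintro ⟨g, hg⟩ hgU
    simp only [hrid g hg hgU, hF]
    refine congrArg (fun v => (⟨g 0, v⟩ : TangentBundle 𝓘(ℝ, EG) G)) ?_
    refine congrArg (A.tangentAverage _) (funext fun h => ?_)
    simp only [hΦ, dif_pos hg]

theorem contraction_mem_cochains [FiniteDimensional ℝ EM] {n : ℕ} {c : 𝒢.StringField (n + 1)}
    (hc : c ∈ 𝒢.cochains (n + 1)) : A.contraction c ∈ 𝒢.cochains n := by
  refine ⟨A.smoothOnSubset_contraction hc, fun g g' h ht => ?_⟩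
  have key : ∀ g : 𝒢.strings n, 𝒢.sourceDeriv (g.1 0) (𝒢.modelCochain (A.contraction c) g) =
      A.average (𝒢.source (g.1 (Fin.last n))) fun h =>
        𝒢.sourceDeriv ((𝒢.appendArrow g h).1 0) (𝒢.modelCochain c (𝒢.appendArrow g h)) := by
    intro g
    simp only [appendArrow_zero]
    rw [modelCochain_contraction]
    exact A.linearMap_average (continuous_modelCochain hc (continuous_appendArrow g)
      fun h => appendArrow_zero _ _) (𝒢.sourceDeriv (g.1 0)).toLinearMap
  -- The fibre averaged over depends on the last arrow. For `n = 0` this is the first arrow, of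
  -- which only the source is fixed; otherwise it belongs to the common tail.
  have hlast : 𝒢.source (g.1 (Fin.last n)) = 𝒢.source (g'.1 (Fin.last n)) := by
    cases n with
    | zero => exact h
    | succ n => exact congrArg (fun z : Fin (n + 1) → G => 𝒢.source (z (Fin.last n))) ht
  refine (tangentCast_eq h _).trans ?_
  refine (key g).trans ((A.average_congr hlast fun y => ?_).trans (key g').symm)
  have hy : 𝒢.source ((𝒢.appendArrow g y).1 0) =
      𝒢.source ((𝒢.appendArrow g' ⟨y.1, y.2.trans hlast⟩).1 0) := by
    rw [appendArrow_zero, appendArrow_zero, h]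
  refine (tangentCast_eq hy _).symm.trans (hc.2 _ _ hy ?_)
  exact (tail_snoc _ _).trans ((congrArg (fun z => Fin.snoc (α := fun _ => G) z y.1) ht).trans
    (tail_snoc _ _).symm)

end HaarData

theorem IsProper.subsingleton_cohomologySucc [FiniteDimensional ℝ EM] [FiniteDimensional ℝ EG]
    [T2Space M] [SecondCountableTopology M] (h𝒢 : 𝒢.IsProper) (n : ℕ) :
    Subsingleton (𝒢.cohomologySucc (n + 1)) := by
  obtain ⟨A⟩ := h𝒢.nonempty_haarData
  rw [Submodule.Quotient.subsingleton_iff, eq_top_iff]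
  rintro ⟨c, hc⟩ -
  refine Submodule.mem_comap.2 ⟨(-1 : ℝ) ^ n • A.contraction c,
    Submodule.smul_mem _ _ (A.contraction_mem_cochains hc.1), ?_⟩
  rw [map_smul, A.delta_contraction hc, smul_smul, ← mul_pow]
  simp

end LieGroupoid

/-! ### Equality in the tangent bundle. -/

section TangentBundle

variable {E X : Type*} [NormedAddCommGroup E] [NormedSpace ℝ E] [TopologicalSpace X]
  [ChartedSpace E X]

theorem tangentBundle_mk_ext {p q : X} {v : TangentSpace 𝓘(ℝ, E) p} {w : TangentSpace 𝓘(ℝ, E) q}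
    (h : p = q) (h' : (v : E) = w) : (⟨p, v⟩ : TangentBundle 𝓘(ℝ, E) X) = ⟨q, w⟩ :=
  Bundle.TotalSpace.ext h (heq_of_eq h')

theorem tangentBundle_snd_eq {ξ η : TangentBundle 𝓘(ℝ, E) X} (h : ξ = η) : (ξ.2 : E) = η.2 := by
  subst h; rfl

theorem tangentBundle_mk_inj {p : X} {v w : TangentSpace 𝓘(ℝ, E) p} :
    (⟨p, v⟩ : TangentBundle 𝓘(ℝ, E) X) = ⟨p, w⟩ ↔ v = w :=
  ⟨fun h => tangentBundle_snd_eq h, fun h => by rw [h]⟩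

end TangentBundle

/-! ### Invariant vector fields, and cohomology in degree zero. -/

namespace LieGroupoid

variable {EM EG M G : Type*}
  [NormedAddCommGroup EM] [NormedSpace ℝ EM] [NormedAddCommGroup EG] [NormedSpace ℝ EG]
  [TopologicalSpace M] [ChartedSpace EM M] [IsManifold 𝓘(ℝ, EM) ∞ M]
  [TopologicalSpace G] [ChartedSpace EG G] [IsManifold 𝓘(ℝ, EG) ∞ G]
  (𝒢 : LieGroupoid EM EG M G)

/-- The map `v ↦ r_g(v)` on `T_{1_{t(g)}} G`. -/
def rightVec (g : G) :
    TangentSpace 𝓘(ℝ, EG) (𝒢.unit (𝒢.target g)) →ₗ[ℝ] TangentSpace 𝓘(ℝ, EG) g :=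
  tangentCast 𝓘(ℝ, EG) (𝒢.unit_mul g) ∘ₗ
    (𝒢.rightTranslation g (𝒢.unit (𝒢.target g))).toLinearMap

/-- The map `v ↦ l_g(di(v))` on `T_{1_{s(g)}} G`. -/
def leftVec (g : G) :
    TangentSpace 𝓘(ℝ, EG) (𝒢.unit (𝒢.source g)) →ₗ[ℝ] TangentSpace 𝓘(ℝ, EG) g :=
  tangentCast 𝓘(ℝ, EG) (𝒢.mul_inv_unit_source g) ∘ₗ
    (𝒢.leftTranslation g (𝒢.inv (𝒢.unit (𝒢.source g)))).toLinearMap ∘ₗ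
    (mfderiv 𝓘(ℝ, EG) 𝓘(ℝ, EG) 𝒢.inv (𝒢.unit (𝒢.source g))).toLinearMap

variable {𝒢}

theorem rightInvariant_apply (g : G) (α : 𝒢.UnitField) :
    𝒢.rightInvariant g α = 𝒢.rightVec g (α (𝒢.target g)) := rfl

theorem hasVelocity_rightVec {a : ℝ → G} {g : G}
    {v : TangentSpace 𝓘(ℝ, EG) (𝒢.unit (𝒢.target g))}
    (ha : HasVelocity 𝓘(ℝ, EG) a ⟨𝒢.unit (𝒢.target g), v⟩)
    (h : ∀ᶠ τ in 𝓝 0, 𝒢.source (a τ) = 𝒢.target g) :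
    HasVelocity 𝓘(ℝ, EG) (fun τ => 𝒢.mul (a τ) g) ⟨g, 𝒢.rightVec g v⟩ := by
  have h1 := ha.mul_right h
  rwa [← mk_tangentCast (𝒢.unit_mul g)] at h1

theorem hasVelocity_leftVec {a : ℝ → G} {g : G}
    {v : TangentSpace 𝓘(ℝ, EG) (𝒢.unit (𝒢.source g))}
    (ha : HasVelocity 𝓘(ℝ, EG) a ⟨𝒢.unit (𝒢.source g), v⟩)
    (h : ∀ᶠ τ in 𝓝 0, 𝒢.source (a τ) = 𝒢.source g) :
    HasVelocity 𝓘(ℝ, EG) (fun τ => 𝒢.mul g (𝒢.inv (a τ))) ⟨g, 𝒢.leftVec g v⟩ := by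
  have h1 := (ha.comp (𝒢.mdiff_inv _)).mul_left (𝒢 := 𝒢) (g := g)
    (h.mono fun τ hτ => (𝒢.target_inv _).trans hτ)
  refine (congrArg (HasVelocity 𝓘(ℝ, EG) fun τ => 𝒢.mul g (𝒢.inv (a τ))) ?_).mp h1
  exact (mk_tangentCast (𝒢.mul_inv_unit_source g) _).symm

/-- The string consisting of a single arrow. -/
def single (g : G) : 𝒢.strings 0 := ⟨fun _ => g, fun i => i.elim0⟩

theorem eq_single (g : 𝒢.strings 0) : g = single (𝒢 := 𝒢) (g.1 0) :=
  Subtype.ext (funext fun i => congrArg g.1 (Fin.fin_one_eq_zero i))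

variable [FiniteDimensional ℝ EG]

theorem exists_curve_of_tangentSource_eq_zero {ξ : TangentBundle 𝓘(ℝ, EG) G} {x : M}
    (h : 𝒢.tangentSource ξ = ⟨x, 0⟩) :
    ∃ a : ℝ → G, HasVelocity 𝓘(ℝ, EG) a ξ ∧ ∀ᶠ τ in 𝓝 0, 𝒢.source (a τ) = x :=
  𝒢.exists_source_lift (h ▸ hasVelocity_const x)

theorem tangentSource_zero (g : G) : 𝒢.tangentSource ⟨g, 0⟩ = ⟨𝒢.source g, 0⟩ :=
  tangentBundle_mk_ext rfl (map_zero (mfderiv 𝓘(ℝ, EG) 𝓘(ℝ, EM) 𝒢.source g))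

theorem tangentSource_unit_of_mem {x : M} {v : TangentSpace 𝓘(ℝ, EG) (𝒢.unit x)}
    (h : mfderiv 𝓘(ℝ, EG) 𝓘(ℝ, EM) 𝒢.source (𝒢.unit x) v = 0) :
    𝒢.tangentSource ⟨𝒢.unit x, v⟩ = ⟨x, 0⟩ :=
  tangentBundle_mk_ext (𝒢.source_unit x) h

/-- Right translation by `g` is division by the constant `g⁻¹`; smoothness of right invariant fields
is thus inherited from the tangent division map. -/
theorem tangentDiv_rightVec {g : G} {v : TangentSpace 𝓘(ℝ, EG) (𝒢.unit (𝒢.target g))}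
    (h : 𝒢.tangentSource ⟨𝒢.unit (𝒢.target g), v⟩ = ⟨𝒢.target g, 0⟩) :
    𝒢.tangentDiv ⟨𝒢.unit (𝒢.target g), v⟩ ⟨𝒢.inv g, 0⟩ = ⟨g, 𝒢.rightVec g v⟩ := by
  obtain ⟨a, ha, has⟩ := exists_curve_of_tangentSource_eq_zero h
  refine (ha.div (hasVelocity_const (𝒢.inv g)) ?_).unique_of_eventuallyEq
    (hasVelocity_rightVec ha has) ?_
  · simpa only [𝒢.source_inv] using has
  · exact Eventually.of_forall fun τ => by rw [𝒢.inv_inv]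

theorem tangentDiv_leftVec {g : G} {v : TangentSpace 𝓘(ℝ, EG) (𝒢.unit (𝒢.source g))}
    (h : 𝒢.tangentSource ⟨𝒢.unit (𝒢.source g), v⟩ = ⟨𝒢.source g, 0⟩) :
    𝒢.tangentDiv ⟨g, 0⟩ ⟨𝒢.unit (𝒢.source g), v⟩ = ⟨g, 𝒢.leftVec g v⟩ := by
  obtain ⟨a, ha, has⟩ := exists_curve_of_tangentSource_eq_zero h
  exact ((hasVelocity_const g).div ha (has.mono fun τ hτ => hτ.symm)).unique
    (hasVelocity_leftVec ha has)

theorem tangentDiv_unit {ξ : TangentBundle 𝓘(ℝ, EG) G} {x : M}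
    (h : 𝒢.tangentSource ξ = ⟨x, 0⟩) : 𝒢.tangentDiv ξ ⟨𝒢.unit x, 0⟩ = ξ := by
  obtain ⟨a, ha, has⟩ := exists_curve_of_tangentSource_eq_zero h
  refine (ha.div (hasVelocity_const (𝒢.unit x)) ?_).unique_of_eventuallyEq ha ?_
  · simpa only [𝒢.source_unit] using has
  · exact has.mono fun τ hτ => 𝒢.div_unit hτ

/-- Linearity of the differential on `(u, v) = (u, 0) + (0, v)`, each summand being computed with
one of the two curves constant. -/
theorem tangentDiv_eq_add_leftVec {g : G} {u : TangentSpace 𝓘(ℝ, EG) g}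
    {v : TangentSpace 𝓘(ℝ, EG) (𝒢.unit (𝒢.source g))}
    (hu : 𝒢.tangentSource ⟨g, u⟩ = ⟨𝒢.source g, 0⟩)
    (hv : 𝒢.tangentSource ⟨𝒢.unit (𝒢.source g), v⟩ = ⟨𝒢.source g, 0⟩) :
    𝒢.tangentDiv ⟨g, u⟩ ⟨𝒢.unit (𝒢.source g), v⟩ = ⟨g, u + 𝒢.leftVec g v⟩ := by
  have h1 := tangentBundle_snd_eq (tangentDiv_unit hu)
  have h2 := tangentBundle_snd_eq (tangentDiv_leftVec hv)
  refine tangentBundle_mk_ext (𝒢.div_unit rfl) ?_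
  refine Eq.trans ?_ (congrArg₂ (fun a b : EG => a + b) h1 h2)
  have h3 : ((u, v) : TangentSpace 𝓘(ℝ, EG) g × TangentSpace 𝓘(ℝ, EG) (𝒢.unit (𝒢.source g))) =
    (u, 0) + (0, v) := by simp
  exact (congrArg _ h3).trans (map_add (𝒢.divDeriv g (𝒢.unit (𝒢.source g))) _ _)

/-! ### Invariant vector fields -/

theorem contMDiff_rightInvariant {α : 𝒢.UnitField} (hα : α ∈ 𝒢.algebroidSections) :
    ContMDiff 𝓘(ℝ, EG) 𝓘(ℝ, EG).tangent ∞
      (fun g => (⟨g, 𝒢.rightInvariant g α⟩ : TangentBundle 𝓘(ℝ, EG) G)) := by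
  have hs : ∀ g, 𝒢.tangentSource ⟨𝒢.unit (𝒢.target g), α (𝒢.target g)⟩ = ⟨𝒢.target g, 0⟩ :=
    fun g => tangentSource_unit_of_mem (hα.2 _)
  have h1 : (fun g => (⟨g, 𝒢.rightInvariant g α⟩ : TangentBundle 𝓘(ℝ, EG) G)) =
      fun g => 𝒢.tangentDiv ⟨𝒢.unit (𝒢.target g), α (𝒢.target g)⟩ ⟨𝒢.inv g, 0⟩ :=
    funext fun g => (tangentDiv_rightVec (hs g)).symm
  rw [h1]
  intro g
  refine 𝒢.contMDiffAt_tangentDiv ((hα.1.comp 𝒢.contMDiff_target) g)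
    (𝒢.contMDiff_inv.zero_along g) (Eventually.of_forall fun g => (hs g).trans ?_)
  rw [tangentSource_zero, 𝒢.source_inv]

theorem contMDiff_leftInvariant {α : 𝒢.UnitField} (hα : α ∈ 𝒢.algebroidSections) :
    ContMDiff 𝓘(ℝ, EG) 𝓘(ℝ, EG).tangent ∞
      (fun g => (⟨g, 𝒢.leftInvariant g α⟩ : TangentBundle 𝓘(ℝ, EG) G)) := by
  have hs : ∀ g, 𝒢.tangentSource ⟨𝒢.unit (𝒢.source g), α (𝒢.source g)⟩ = ⟨𝒢.source g, 0⟩ :=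
    fun g => tangentSource_unit_of_mem (hα.2 _)
  have h1 : (fun g => (⟨g, 𝒢.leftInvariant g α⟩ : TangentBundle 𝓘(ℝ, EG) G)) =
      fun g => 𝒢.tangentDiv ⟨g, 0⟩ ⟨𝒢.unit (𝒢.source g), α (𝒢.source g)⟩ :=
    funext fun g => (tangentDiv_leftVec (hs g)).symm
  rw [h1]
  intro g
  exact 𝒢.contMDiffAt_tangentDiv (contMDiff_id.zero_along g)
    ((hα.1.comp 𝒢.contMDiff_source) g)
    (Eventually.of_forall fun g => (tangentSource_zero g).trans (hs g).symm)

theorem mk_anchor (x : M) (α : 𝒢.UnitField) :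
    (⟨x, 𝒢.anchor x α⟩ : TangentBundle 𝓘(ℝ, EM) M) = 𝒢.tangentTarget ⟨𝒢.unit x, α x⟩ :=
  mk_tangentCast (𝒢.target_unit x) _

theorem tangentTarget_rightInvariant {α : 𝒢.UnitField} (hα : α ∈ 𝒢.algebroidSections) (g : G) :
    𝒢.tangentTarget ⟨g, 𝒢.rightInvariant g α⟩ = ⟨𝒢.target g, 𝒢.anchor (𝒢.target g) α⟩ := by
  obtain ⟨a, ha, has⟩ := exists_curve_of_tangentSource_eq_zero
    (tangentSource_unit_of_mem (hα.2 (𝒢.target g)))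
  rw [mk_anchor]
  exact (hasVelocity_rightVec ha has).target.unique_of_eventuallyEq ha.target
    (has.mono fun τ hτ => 𝒢.target_mul _ _ hτ)

theorem tangentSource_rightInvariant {α : 𝒢.UnitField} (hα : α ∈ 𝒢.algebroidSections) (g : G) :
    𝒢.tangentSource ⟨g, 𝒢.rightInvariant g α⟩ = ⟨𝒢.source g, 0⟩ := by
  obtain ⟨a, ha, has⟩ := exists_curve_of_tangentSource_eq_zero
    (tangentSource_unit_of_mem (hα.2 (𝒢.target g)))
  exact (hasVelocity_rightVec ha has).source.unique_of_eventuallyEq (hasVelocity_const _)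
    (has.mono fun τ hτ => 𝒢.source_mul _ _ hτ)

theorem tangentTarget_leftInvariant {α : 𝒢.UnitField} (hα : α ∈ 𝒢.algebroidSections) (g : G) :
    𝒢.tangentTarget ⟨g, 𝒢.leftInvariant g α⟩ = ⟨𝒢.target g, 0⟩ := by
  obtain ⟨a, ha, has⟩ := exists_curve_of_tangentSource_eq_zero
    (tangentSource_unit_of_mem (hα.2 (𝒢.source g)))
  exact (hasVelocity_leftVec ha has).target.unique_of_eventuallyEq (hasVelocity_const _)
    (has.mono fun τ hτ => 𝒢.target_div hτ.symm)

theorem tangentSource_leftInvariant {α : 𝒢.UnitField} (hα : α ∈ 𝒢.algebroidSections) (g : G) :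
    𝒢.tangentSource ⟨g, 𝒢.leftInvariant g α⟩ = ⟨𝒢.source g, 𝒢.anchor (𝒢.source g) α⟩ := by
  obtain ⟨a, ha, has⟩ := exists_curve_of_tangentSource_eq_zero
    (tangentSource_unit_of_mem (hα.2 (𝒢.source g)))
  rw [mk_anchor]
  exact (hasVelocity_leftVec ha has).source.unique_of_eventuallyEq ha.target
    (has.mono fun τ hτ => 𝒢.source_div hτ.symm)

/-! ### Cohomology in degree zero -/

/-- Both `f ∘ a` and the constant curve are integral curves of the zero field on `N`, so uniqueness
of integral curves applies. -/
theorem eventually_eq_of_mfderiv_eq_zero {E N : Type*} [NormedAddCommGroup E] [NormedSpace ℝ E]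
    [TopologicalSpace N] [ChartedSpace E N] [IsManifold 𝓘(ℝ, E) ∞ N]
    {a : ℝ → G} {Z : ∀ g : G, TangentSpace 𝓘(ℝ, EG) g} (ha : IsMIntegralCurveAt (I := 𝓘(ℝ, EG)) a Z 0)
    {f : G → N} (hf : ContMDiff 𝓘(ℝ, EG) 𝓘(ℝ, E) ∞ f)
    (hZ : ∀ g, mfderiv 𝓘(ℝ, EG) 𝓘(ℝ, E) f g (Z g) = 0) :
    ∀ᶠ τ in 𝓝 0, f (a τ) = f (a 0) := by
  have : IsManifold 𝓘(ℝ, E) 1 N := .of_le (n := ∞) (by simp)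
  refine isMIntegralCurveAt_eventuallyEq_of_contMDiffAt_boundaryless (I := 𝓘(ℝ, E)) (t₀ := 0)
    (γ := fun τ => f (a τ)) (γ' := fun _ => f (a 0)) (v := fun _ => 0) ?_ ?_ ?_ rfl
  · exact (Bundle.contMDiff_zeroSection ℝ (TangentSpace 𝓘(ℝ, E) : N → Type _)).contMDiffAt
  · filter_upwards [ha] with τ hτ
    have h1 := (hf.mdifferentiableAt (by simp) (x := a τ)).hasMFDerivAt.comp τ hτ
    refine h1.congr_mfderiv (ContinuousLinearMap.ext fun r => ?_)
    change mfderiv 𝓘(ℝ, EG) 𝓘(ℝ, E) f (a τ) ((show ℝ from r) • Z (a τ)) =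
      (show ℝ from r) • (0 : E)
    rw [map_smul, hZ, smul_zero, smul_zero]
    rfl
  · refine Eventually.of_forall fun τ => ?_
    refine (hasMFDerivAt_const (I := 𝓘(ℝ, ℝ)) (I' := 𝓘(ℝ, E)) (f (a 0)) τ).congr_mfderiv
      (ContinuousLinearMap.ext fun r => ?_)
    exact (smul_zero (M := ℝ) (A := E) (show ℝ from r)).symm

/-- A section of the isotropy is tangent to a curve in the isotropy group. -/
theorem exists_isotropy_curve {α : 𝒢.UnitField} (hα : α ∈ 𝒢.algebroidSections)
    (hρ : ∀ x, 𝒢.anchor x α = 0) (x : M) :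
    ∃ a : ℝ → G, HasVelocity 𝓘(ℝ, EG) a ⟨𝒢.unit x, α x⟩ ∧
      (∀ᶠ τ in 𝓝 0, 𝒢.source (a τ) = x) ∧ ∀ᶠ τ in 𝓝 0, 𝒢.target (a τ) = x := by
  have := FiniteDimensional.complete ℝ EG
  have : IsManifold 𝓘(ℝ, EG) 1 G := .of_le (n := ∞) (by simp)
  -- The integral curve of the right invariant field through the unit stays in the source fibre,
  -- and, since `ρ(α) = 0`, in the target fibre. No submanifold structure on the isotropy group is
  -- required.
  obtain ⟨a, ha0, ha⟩ := exists_isMIntegralCurveAt_of_contMDiffAt_boundaryless (I := 𝓘(ℝ, EG))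
    (v := fun g => 𝒢.rightInvariant g α) (x₀ := 𝒢.unit x) 0
    ((contMDiff_rightInvariant hα _).of_le (by simp))
  refine ⟨a, ⟨ha.self_of_nhds.mdifferentiableAt, ?_⟩, ?_, ?_⟩
  · have h1 : tangentMap 𝓘(ℝ, ℝ) 𝓘(ℝ, EG) a ⟨0, (1 : ℝ)⟩ = ⟨a 0, 𝒢.rightInvariant (a 0) α⟩ := by
      simp only [tangentMap]
      rw [ha.self_of_nhds.mfderiv]
      exact tangentBundle_mk_ext rfl (one_smul ℝ (𝒢.rightInvariant (a 0) α : EG))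
    rw [h1, ha0]
    have h2 := tangentSource_unit_of_mem (hα.2 (𝒢.target (𝒢.unit x)))
    rw [rightInvariant_apply, ← tangentDiv_rightVec h2, 𝒢.inv_unit, 𝒢.target_unit]
    exact tangentDiv_unit (tangentSource_unit_of_mem (hα.2 x))
  · have h1 := eventually_eq_of_mfderiv_eq_zero ha 𝒢.contMDiff_source fun g =>
      tangentBundle_mk_inj.1 (tangentSource_rightInvariant hα g)
    rwa [ha0, 𝒢.source_unit] at h1
  · have h1 := eventually_eq_of_mfderiv_eq_zero ha 𝒢.contMDiff_target fun g =>
      (tangentBundle_mk_inj.1 (tangentTarget_rightInvariant hα g)).trans (hρ _)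
    rwa [ha0, 𝒢.target_unit] at h1

/-- Let `a` be a curve in the isotropy group with velocity `α` and `v` the velocity of `g a`.
Differentiating `(g a) a⁻¹ = g` gives `v + l_g(di α) = 0`, and `(g a g⁻¹) g = g a` gives `r_g(ad_g
α) = v`. Both conditions therefore say `r_g(α) = v`, as `r_g` is injective on vectors along the
source fibre. -/
theorem isotropyAction_eq_iff {α : 𝒢.UnitField} (hα : α ∈ 𝒢.algebroidSections)
    (hρ : ∀ x, 𝒢.anchor x α = 0) (g : G) :
    𝒢.isotropyAction g (α (𝒢.source g)) = α (𝒢.target g) ↔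
      𝒢.rightInvariant g α + 𝒢.leftInvariant g α = 0 := by
  obtain ⟨a, ha, has, hat⟩ := exists_isotropy_curve hα hρ (𝒢.source g)
  set v : TangentSpace 𝓘(ℝ, EG) g := tangentCast 𝓘(ℝ, EG) (𝒢.mul_unit g)
    (𝒢.leftTranslation g (𝒢.unit (𝒢.source g)) (α (𝒢.source g))) with hv
  have hav : HasVelocity 𝓘(ℝ, EG) (fun τ => 𝒢.mul g (a τ)) ⟨g, v⟩ := by
    rw [hv, mk_tangentCast (𝒢.mul_unit g)]
    exact ha.mul_left hat
  have hsga : ∀ᶠ τ in 𝓝 0, 𝒢.source (𝒢.mul g (a τ)) = 𝒢.source g := by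
    filter_upwards [has, hat] with τ h1 h2
    rw [𝒢.source_mul _ _ h2.symm, h1]
  have hsv : 𝒢.tangentSource ⟨g, v⟩ = ⟨𝒢.source g, 0⟩ :=
    hav.source.unique_of_eventuallyEq (hasVelocity_const _) hsga
  have hsum : v + 𝒢.leftInvariant g α = 0 := by
    refine tangentBundle_mk_inj.1 ((tangentDiv_eq_add_leftVec hsv
      (tangentSource_unit_of_mem (hα.2 _))).symm.trans ?_)
    refine (hav.div ha ?_).unique_of_eventuallyEq (hasVelocity_const g) ?_
    · filter_upwards [hsga, has] with τ h1 h2 using h1.trans h2.symm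
    · exact hat.mono fun τ h => 𝒢.mul_inv_cancel_right h.symm
  have hconj : HasVelocity 𝓘(ℝ, EG) (fun τ => 𝒢.mul (𝒢.mul g (a τ)) (𝒢.inv g))
      ⟨𝒢.unit (𝒢.target g), 𝒢.isotropyAction g (α (𝒢.source g))⟩ := by
    have h1 : ContMDiffOn 𝓘(ℝ, EG) 𝓘(ℝ, EG) ∞ (fun h => 𝒢.mul g h)
        {h | 𝒢.source h = 𝒢.source g ∧ 𝒢.target h = 𝒢.source g} :=
      𝒢.contMDiffOn_mul.comp (contMDiff_const.prodMk contMDiff_id).contMDiffOn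
        fun p hp => hp.2.symm
    have h2 : ContMDiffOn 𝓘(ℝ, EG) 𝓘(ℝ, EG) ∞ (fun h => 𝒢.mul (𝒢.mul g h) (𝒢.inv g))
        {h | 𝒢.source h = 𝒢.source g ∧ 𝒢.target h = 𝒢.source g} :=
      𝒢.contMDiffOn_mul.comp (h1.prodMk contMDiffOn_const) fun p hp => by
        change 𝒢.source (𝒢.mul g p) = 𝒢.target (𝒢.inv g)
        rw [𝒢.source_mul _ _ hp.2.symm, 𝒢.target_inv, hp.1]
    have h3 := ha.comp_within (J := 𝓘(ℝ, EG)) (f := fun h => 𝒢.mul (𝒢.mul g h) (𝒢.inv g))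
      ((h2 (𝒢.unit (𝒢.source g)) ⟨𝒢.source_unit _, 𝒢.target_unit _⟩).mdifferentiableWithinAt
        (by simp)) (has.and hat)
    refine (congrArg (HasVelocity 𝓘(ℝ, EG) _) ?_).mp h3
    exact (mk_tangentCast (𝒢.conj_unit g) _).symm
  have hconjs : ∀ᶠ τ in 𝓝 0, 𝒢.source (𝒢.mul (𝒢.mul g (a τ)) (𝒢.inv g)) = 𝒢.target g :=
    hsga.mono fun τ h => 𝒢.source_div h
  rw [rightInvariant_apply]
  constructor
  · intro h
    rw [h] at hconj
    have h1 := (hasVelocity_rightVec hconj hconjs).unique_of_eventuallyEq hav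
      (hsga.mono fun τ h => 𝒢.inv_mul_cancel_right h)
    rw [tangentBundle_mk_inj.1 h1, hsum]
  · intro h
    obtain ⟨b, hb, hbs⟩ := exists_curve_of_tangentSource_eq_zero
      (tangentSource_unit_of_mem (hα.2 (𝒢.target g)))
    have hR := hasVelocity_rightVec hb hbs
    rw [add_right_cancel (h.trans hsum.symm)] at hR
    have h1 := hR.mul_right (𝒢 := 𝒢) (g := 𝒢.inv g) (hbs.mono fun τ h => by
      rw [𝒢.source_mul _ _ h, 𝒢.target_inv])
    have h2 := hav.mul_right (𝒢 := 𝒢) (g := 𝒢.inv g) (hsga.mono fun τ h => by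
      rw [h, 𝒢.target_inv])
    exact tangentBundle_mk_inj.1 ((hconj.unique h2).trans (h1.unique_of_eventuallyEq hb
      (hbs.mono fun τ h => 𝒢.mul_inv_cancel_right h)))

theorem deltaZero_eq_zero_iff {α : 𝒢.UnitField} :
    𝒢.deltaZero α = 0 ↔ ∀ g, 𝒢.rightInvariant g α + 𝒢.leftInvariant g α = 0 :=
  ⟨fun h g => congrFun h (single g), fun h => funext fun g => h (g.1 0)⟩

/-- Left invariant fields are killed by `dt`, so `dt(δα)` at `g` is `ρ(α)` at `t(g)` and a cocycle
takes values in the isotropy; then `isotropyAction_eq_iff` applies. -/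
theorem cocyclesZero_eq : 𝒢.cocyclesZero = 𝒢.invariantIsotropySections := by
  ext α
  refine ⟨fun ⟨hα, h⟩ => ?_, fun ⟨hα, hρ, h⟩ => ⟨hα, LinearMap.mem_ker.2 ?_⟩⟩
  · have h0 := deltaZero_eq_zero_iff.1 (LinearMap.mem_ker.1 h)
    have hρ : ∀ x, 𝒢.anchor x α = 0 := by
      intro x
      obtain ⟨g, rfl⟩ : ∃ g, 𝒢.target g = x := ⟨_, 𝒢.target_unit x⟩
      have h1 := tangentBundle_mk_inj.1 (tangentTarget_rightInvariant hα g)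
      have h2 : mfderiv 𝓘(ℝ, EG) 𝓘(ℝ, EM) 𝒢.target g (𝒢.leftInvariant g α) = 0 :=
        tangentBundle_mk_inj.1 (tangentTarget_leftInvariant hα g)
      have h3 : mfderiv 𝓘(ℝ, EG) 𝓘(ℝ, EM) 𝒢.target g
          (𝒢.rightInvariant g α + 𝒢.leftInvariant g α) = 0 := by
        rw [h0, map_zero]
      rw [map_add, h2, add_zero] at h3
      exact h1.symm.trans h3
    exact ⟨hα, hρ, fun g => (isotropyAction_eq_iff hα hρ g).2 (h0 g)⟩
  · exact deltaZero_eq_zero_iff.2 fun g => (isotropyAction_eq_iff hα hρ g).1 (h g)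

end LieGroupoid

/-! ### Degree one: cocycles and their base fields. -/

namespace LieGroupoid

variable {EM EG M G : Type*}
  [NormedAddCommGroup EM] [NormedSpace ℝ EM] [NormedAddCommGroup EG] [NormedSpace ℝ EG]
  [TopologicalSpace M] [ChartedSpace EM M] [IsManifold 𝓘(ℝ, EM) ∞ M]
  [TopologicalSpace G] [ChartedSpace EG G] [IsManifold 𝓘(ℝ, EG) ∞ G]
  {𝒢 : LieGroupoid EM EG M G}

/-! ### Cochains of degree one as vector fields -/

/-- The value at `g` of a cochain of degree one, as a point of the tangent bundle. -/
def fieldAt (X : 𝒢.StringField 0) (g : G) : TangentBundle 𝓘(ℝ, EG) G := ⟨g, X (single g)⟩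

theorem contMDiff_fieldAt {X : 𝒢.StringField 0} (hX : X ∈ 𝒢.cochains 0) :
    ContMDiff 𝓘(ℝ, EG) 𝓘(ℝ, EG).tangent ∞ (fieldAt X) := by
  intro g
  obtain ⟨U, hU, hgU, F, hF, hFX⟩ := hX.1 (single g)
  have h1 : ContMDiff 𝓘(ℝ, EG) (ModelWithCorners.pi fun _ : Fin 1 => 𝓘(ℝ, EG)) ∞
      (fun (g : G) (_ : Fin 1) => g) := fun g => contMDiffAt_pi fun _ => contMDiffAt_id
  refine ((hF.contMDiffAt (hU.mem_nhds hgU)).comp g (h1 g)).congr_of_eventuallyEq ?_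
  filter_upwards [h1.continuous.continuousAt.preimage_mem_nhds (hU.mem_nhds hgU)] with g' hg'
  exact (hFX (single g') hg').symm

theorem tangentSource_fieldAt_congr {X : 𝒢.StringField 0} (hX : X ∈ 𝒢.cochains 0) {g g' : G}
    (h : 𝒢.source g = 𝒢.source g') :
    𝒢.tangentSource (fieldAt X g) = 𝒢.tangentSource (fieldAt X g') :=
  tangentBundle_mk_ext h ((tangentCast_eq h _).symm.trans
    (hX.2 (single g) (single g') h (Subsingleton.elim _ _)))

theorem mem_cochains_zero {X : 𝒢.StringField 0}
    (hX : ContMDiff 𝓘(ℝ, EG) 𝓘(ℝ, EG).tangent ∞ (fieldAt X))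
    (hs : ∀ g g', 𝒢.source g = 𝒢.source g' →
      𝒢.tangentSource (fieldAt X g) = 𝒢.tangentSource (fieldAt X g')) : X ∈ 𝒢.cochains 0 := by
  refine ⟨fun s => ⟨univ, isOpen_univ, trivial, fun p => fieldAt X (p 0),
    (hX.comp (contMDiff_coord 0)).contMDiffOn, fun s _ => ?_⟩, fun g g' h _ => ?_⟩
  · rw [eq_single s]; rfl
  · obtain ⟨a, rfl⟩ : ∃ a, g = single a := ⟨_, eq_single g⟩
    obtain ⟨b, rfl⟩ : ∃ b, g' = single b := ⟨_, eq_single g'⟩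
    exact (tangentCast_eq h _).trans (tangentBundle_snd_eq (hs _ _ h))

/-- This identifies the cocycles of degree one with the multiplicative vector fields. -/
theorem delta_zero_eq_zero_iff {X : 𝒢.StringField 0} :
    𝒢.delta 0 X = 0 ↔ ∀ g h, 𝒢.source g = 𝒢.target h →
      𝒢.tangentDiv (fieldAt X (𝒢.mul g h)) (fieldAt X h) = fieldAt X g := by
  have key : ∀ s : 𝒢.strings 1, 𝒢.delta 0 X s = 0 ↔
      𝒢.tangentDiv (fieldAt X (𝒢.mul (s.1 0) (s.1 1))) (fieldAt X (s.1 1)) =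
        fieldAt X (s.1 0) := by
    intro s
    have h0 : 𝒢.contractString 0 s = single (𝒢.mul (s.1 0) (s.1 1)) := by
      rw [eq_single (𝒢.contractString 0 s), contractString_zero_zero]
    have h1 : 𝒢.tailString s = single (s.1 1) := eq_single _
    have h2 : 𝒢.contractString (Fin.succ 0) s = single (s.1 0) := by
      rw [eq_single (𝒢.contractString (Fin.succ 0) s), contractString_succ_zero]
    have h3 := modelCochain_delta X s
    simp only [Fin.sum_univ_succ, h0, h1, h2, Finset.univ_eq_empty, Finset.sum_empty] at h3
    have h4 : 𝒢.modelCochain (𝒢.delta 0 X) s =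
        - 𝒢.modelDivDeriv (𝒢.mul (s.1 0) (s.1 1)) (s.1 1)
          (𝒢.modelCochain X (single (𝒢.mul (s.1 0) (s.1 1))), 𝒢.modelCochain X (single (s.1 1))) +
        𝒢.modelCochain X (single (s.1 0)) := by
      rw [h3]
      simp [single]
    have h5 : 𝒢.modelDivDeriv (𝒢.mul (s.1 0) (s.1 1)) (s.1 1)
          (𝒢.modelCochain X (single (𝒢.mul (s.1 0) (s.1 1))), 𝒢.modelCochain X (single (s.1 1))) =
        𝒢.modelCochain X (single (s.1 0)) ↔ 𝒢.modelCochain (𝒢.delta 0 X) s = 0 := by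
      rw [h4, neg_add_eq_zero]
    refine Iff.trans h5.symm ⟨fun h => ?_, fun h => tangentBundle_snd_eq h⟩
    exact tangentBundle_mk_ext (𝒢.mul_inv_cancel_right (s.2 0)) h
  refine ⟨fun h g k hgk => ?_, fun h => funext fun s => (key s).2 (h _ _ (s.2 0))⟩
  exact (key ⟨![g, k], fun i => by rw [Fin.fin_one_eq_zero i]; exact hgk⟩).1 (congrFun h _)

/-- The base field of a cochain of degree one. -/
def baseField : 𝒢.cochains 0 →ₗ[ℝ] SmoothVectorField EM M where
  toFun X := ⟨fun x => tangentCast 𝓘(ℝ, EM) (𝒢.source_unit x)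
      (mfderiv 𝓘(ℝ, EG) 𝓘(ℝ, EM) 𝒢.source (𝒢.unit x) (X.1 (single (𝒢.unit x)))), by
    have h1 : ContMDiff 𝓘(ℝ, EM) 𝓘(ℝ, EM).tangent ∞
        (fun x => 𝒢.tangentSource (fieldAt X.1 (𝒢.unit x))) :=
      (𝒢.contMDiff_source.contMDiff_tangentMap (m := ∞) (by simp)).comp
        ((contMDiff_fieldAt X.2).comp 𝒢.contMDiff_unit)
    convert h1 using 2 with x
    exact mk_tangentCast _ _⟩
  map_add' X Y := by
    ext x
    exact (congrArg (tangentCast 𝓘(ℝ, EM) (𝒢.source_unit x))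
      (map_add (mfderiv 𝓘(ℝ, EG) 𝓘(ℝ, EM) 𝒢.source (𝒢.unit x)) _ _)).trans
      (LinearMap.map_add _ _ _)
  map_smul' r X := by
    ext x
    exact (congrArg (tangentCast 𝓘(ℝ, EM) (𝒢.source_unit x))
      (map_smul (mfderiv 𝓘(ℝ, EG) 𝓘(ℝ, EM) 𝒢.source (𝒢.unit x)) _ _)).trans
      (LinearMap.map_smul _ _ _)

theorem mk_baseField (X : 𝒢.cochains 0) (x : M) :
    (⟨x, baseField X x⟩ : TangentBundle 𝓘(ℝ, EM) M) =
      𝒢.tangentSource (fieldAt X.1 (𝒢.unit x)) :=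
  mk_tangentCast (𝒢.source_unit x) _

theorem tangentSource_fieldAt (X : 𝒢.cochains 0) (g : G) :
    𝒢.tangentSource (fieldAt X.1 g) = ⟨𝒢.source g, baseField X (𝒢.source g)⟩ := by
  rw [mk_baseField]
  exact tangentSource_fieldAt_congr X.2 (𝒢.source_unit _).symm

theorem isBaseField_baseField (X : 𝒢.cochains 0) : 𝒢.IsBaseField X.1 (baseField X) := by
  intro g
  obtain ⟨a, rfl⟩ : ∃ a, g = single a := ⟨_, eq_single g⟩
  exact tangentBundle_mk_inj.1 (tangentSource_fieldAt X a)

theorem baseField_eq_iff (X : 𝒢.cochains 0) (V : SmoothVectorField EM M) :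
    baseField X = V ↔ ∀ g, 𝒢.tangentSource (fieldAt X.1 g) = ⟨𝒢.source g, V (𝒢.source g)⟩ := by
  refine ⟨fun h g => h ▸ tangentSource_fieldAt X g, fun h => ?_⟩
  ext x
  refine tangentBundle_mk_inj.1 ?_
  rw [mk_baseField, h, 𝒢.source_unit]

variable [FiniteDimensional ℝ EG]

/-- Apply `ds` to the cocycle identity at `(1_{t(g)}, g)`: since `ds ∘ dm̄` is `dt` of the second
entry, `dt(X(g))` equals `ds(X(1_{t(g)}))`. A cocycle is thus itself an `(s, t)`-lift of its base
field. -/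
theorem tangentTarget_fieldAt {X : 𝒢.cochains 0} (hX : 𝒢.delta 0 X.1 = 0) (g : G) :
    𝒢.tangentTarget (fieldAt X.1 g) = ⟨𝒢.target g, baseField X (𝒢.target g)⟩ := by
  have h1 := delta_zero_eq_zero_iff.1 hX (𝒢.unit (𝒢.target g)) g (𝒢.source_unit _)
  have h2 : 𝒢.tangentSource (fieldAt X.1 (𝒢.mul (𝒢.unit (𝒢.target g)) g)) =
      𝒢.tangentSource (fieldAt X.1 g) := by rw [𝒢.unit_mul]
  rw [← 𝒢.tangentSource_tangentDiv h2, h1, tangentSource_fieldAt, 𝒢.source_unit]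

theorem baseField_mem_liftableFields {X : 𝒢.cochains 0} (hX : 𝒢.delta 0 X.1 = 0) :
    baseField X ∈ 𝒢.liftableFields :=
  ⟨⟨fun g => X.1 (single g), contMDiff_fieldAt X.2⟩, fun g =>
    ⟨tangentBundle_mk_inj.1 (tangentSource_fieldAt X g),
      tangentBundle_mk_inj.1 (tangentTarget_fieldAt hX g)⟩⟩

end LieGroupoid

/-! ### Degree one: primitives, multiplicative lifts, and the isomorphism. -/

namespace LieGroupoid

variable {EM EG M G : Type*}
  [NormedAddCommGroup EM] [NormedSpace ℝ EM] [NormedAddCommGroup EG] [NormedSpace ℝ EG]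
  [TopologicalSpace M] [ChartedSpace EM M] [IsManifold 𝓘(ℝ, EM) ∞ M]
  [TopologicalSpace G] [ChartedSpace EG G] [IsManifold 𝓘(ℝ, EG) ∞ G]
  {𝒢 : LieGroupoid EM EG M G} [FiniteDimensional ℝ EG]

theorem _root_.continuous_tangent_linearMap_comp {E N E' N' Y : Type*}
    [NormedAddCommGroup E] [NormedSpace ℝ E] [FiniteDimensional ℝ E]
    [TopologicalSpace N] [ChartedSpace E N] [NormedAddCommGroup E'] [NormedSpace ℝ E']
    [TopologicalSpace N'] [ChartedSpace E' N'] [TopologicalSpace Y] {p : N} {q : N'}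
    (L : TangentSpace 𝓘(ℝ, E) p →ₗ[ℝ] TangentSpace 𝓘(ℝ, E') q)
    {Φ : Y → TangentSpace 𝓘(ℝ, E) p} (hΦ : Continuous Φ) : Continuous fun y => L (Φ y) :=
  have hL : ∀ L' : E →ₗ[ℝ] E', Continuous L' := fun L' => L'.continuous_of_finiteDimensional
  (hL L).comp hΦ

theorem tangentSource_fieldAt_deltaZero {α : 𝒢.UnitField} (hα : α ∈ 𝒢.algebroidSections) (g : G) :
    𝒢.tangentSource (fieldAt (𝒢.deltaZero α) g) =
      ⟨𝒢.source g, 𝒢.anchor (𝒢.source g) α⟩ := by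
  have h1 : mfderiv 𝓘(ℝ, EG) 𝓘(ℝ, EM) 𝒢.source g (𝒢.rightInvariant g α) = 0 :=
    tangentBundle_mk_inj.1 (tangentSource_rightInvariant hα g)
  have h2 : mfderiv 𝓘(ℝ, EG) 𝓘(ℝ, EM) 𝒢.source g (𝒢.leftInvariant g α) =
      𝒢.anchor (𝒢.source g) α := tangentBundle_mk_inj.1 (tangentSource_leftInvariant hα g)
  refine tangentBundle_mk_ext rfl ?_
  change mfderiv 𝓘(ℝ, EG) 𝓘(ℝ, EM) 𝒢.source g
    (𝒢.rightInvariant g α + 𝒢.leftInvariant g α) = _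
  rw [map_add, h1, h2, zero_add]

/-! ### Cocycles with base field in the image of the anchor -/

/-- The quotient at `h` of a cochain of degree one by a left invariant vector field. -/
def quotientAt (X : 𝒢.StringField 0) (α : 𝒢.UnitField) (h : G) : TangentBundle 𝓘(ℝ, EG) G :=
  𝒢.tangentDiv (fieldAt X h) ⟨h, 𝒢.leftInvariant h α⟩

theorem proj_quotientAt (X : 𝒢.StringField 0) (α : 𝒢.UnitField) {h : G} {x : M}
    (hx : 𝒢.target h = x) : (quotientAt X α h).1 = 𝒢.unit x :=
  (𝒢.mul_inv h).trans (congrArg _ hx)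

/-- The quotient at `h` of a cochain of degree one by a left invariant vector field, as a tangent
vector at the unit. -/
def quotientVec (X : 𝒢.StringField 0) (α : 𝒢.UnitField) {x : M} (h : {h : G // 𝒢.target h = x}) :
    TangentSpace 𝓘(ℝ, EG) (𝒢.unit x) :=
  tangentCast 𝓘(ℝ, EG) (proj_quotientAt X α h.2) (quotientAt X α h.1).2

theorem mk_quotientVec (X : 𝒢.StringField 0) (α : 𝒢.UnitField) {x : M}
    (h : {h : G // 𝒢.target h = x}) :
    (⟨𝒢.unit x, quotientVec X α h⟩ : TangentBundle 𝓘(ℝ, EG) G) = quotientAt X α h.1 :=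
  mk_tangentCast (proj_quotientAt X α h.2) _

section Primitive

variable {X : 𝒢.StringField 0} {α : 𝒢.UnitField}

theorem tangentSource_eq_leftInvariant
    (hα : α ∈ 𝒢.algebroidSections)
    (hXα : ∀ g, 𝒢.tangentSource (fieldAt X g) = ⟨𝒢.source g, 𝒢.anchor (𝒢.source g) α⟩) (h : G) :
    𝒢.tangentSource (fieldAt X h) = 𝒢.tangentSource ⟨h, 𝒢.leftInvariant h α⟩ :=
  (hXα h).trans (tangentSource_leftInvariant hα h).symm

theorem tangentSource_quotientAt
    (hα : α ∈ 𝒢.algebroidSections)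
    (hXα : ∀ g, 𝒢.tangentSource (fieldAt X g) = ⟨𝒢.source g, 𝒢.anchor (𝒢.source g) α⟩) (h : G) :
    𝒢.tangentSource (quotientAt X α h) = ⟨𝒢.target h, 0⟩ :=
  (𝒢.tangentSource_tangentDiv (tangentSource_eq_leftInvariant hα hXα h)).trans
    (tangentTarget_leftInvariant hα h)

theorem contMDiff_quotientAt (hX : X ∈ 𝒢.cocycles 0)
    (hα : α ∈ 𝒢.algebroidSections)
    (hXα : ∀ g, 𝒢.tangentSource (fieldAt X g) = ⟨𝒢.source g, 𝒢.anchor (𝒢.source g) α⟩) :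
    ContMDiff 𝓘(ℝ, EG) 𝓘(ℝ, EG).tangent ∞ (quotientAt X α) := fun h =>
  𝒢.contMDiffAt_tangentDiv (contMDiff_fieldAt hX.1 h) (contMDiff_leftInvariant hα h)
    (Eventually.of_forall (tangentSource_eq_leftInvariant hα hXα))

theorem continuous_quotientVec (hX : X ∈ 𝒢.cocycles 0)
    (hα : α ∈ 𝒢.algebroidSections)
    (hXα : ∀ g, 𝒢.tangentSource (fieldAt X g) = ⟨𝒢.source g, 𝒢.anchor (𝒢.source g) α⟩) (x : M) :
    Continuous fun h : {h : G // 𝒢.target h = x} => quotientVec X α h := by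
  refine continuous_of_continuous_mk (E := EG) (N := G) (p := 𝒢.unit x) ?_
  simp only [mk_quotientVec]
  exact (contMDiff_quotientAt hX hα hXα).continuous.comp continuous_subtype_val

/-- Take `a` with velocity `α` at `s(h)`, put `w = h a⁻¹`, and let `y`, `z` have velocities `X(h)`,
`X(gh)` and the same source as `w`. Then `(z (g w)⁻¹ g)(y w⁻¹)⁻¹ = z y⁻¹`. Differentiating, the left
side gives the sum and the right side `dm̄(X(gh), X(h)) = X(g)`. The result does not depend on `h`,
which makes it ready for averaging. -/
theorem rightVec_add_leftVec_quotientVec (hX : X ∈ 𝒢.cocycles 0)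
    (hα : α ∈ 𝒢.algebroidSections)
    (hXα : ∀ g, 𝒢.tangentSource (fieldAt X g) = ⟨𝒢.source g, 𝒢.anchor (𝒢.source g) α⟩) {g h : G} (hgh : 𝒢.source g = 𝒢.target h) :
    𝒢.rightVec g (quotientVec X α ⟨𝒢.mul g h, 𝒢.target_mul g h hgh⟩) +
      𝒢.leftVec g (quotientVec X α ⟨h, hgh.symm⟩) = X (single g) := by
  obtain ⟨a, ha, has⟩ := exists_curve_of_tangentSource_eq_zero
    (tangentSource_unit_of_mem (hα.2 (𝒢.source h)))
  have hw := hasVelocity_leftVec ha has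
  have hsgh := 𝒢.source_mul g h hgh
  -- The same curve `a` is used at `h` and at `gh`; this is what makes `(gh) a⁻¹ = g w` hold along
  -- the curves.
  have ha' : HasVelocity 𝓘(ℝ, EG) a
      ⟨𝒢.unit (𝒢.source (𝒢.mul g h)), α (𝒢.source (𝒢.mul g h))⟩ := by
    rw [hsgh]; exact ha
  have has' : ∀ᶠ τ in 𝓝 0, 𝒢.source (a τ) = 𝒢.source (𝒢.mul g h) :=
    has.mono fun τ hτ => hτ.trans hsgh.symm
  have hw' := hasVelocity_leftVec ha' has'
  obtain ⟨y, hy, hyw⟩ := 𝒢.exists_source_lift (ξ := fieldAt X h)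
    (tangentSource_eq_leftInvariant hα hXα h ▸ hw.source)
  obtain ⟨z, hz, hzy⟩ := 𝒢.exists_source_lift (ξ := fieldAt X (𝒢.mul g h))
    (tangentSource_fieldAt_congr hX.1 hsgh ▸ hy.source)
  have hb := hy.div hw hyw
  have hzw : ∀ᶠ τ in 𝓝 0, 𝒢.source (z τ) =
      𝒢.source (𝒢.mul (𝒢.mul g h) (𝒢.inv (a τ))) := by
    filter_upwards [hzy, hyw, has] with τ h1 h2 h3
    rw [h1, h2, 𝒢.source_div h3.symm, 𝒢.source_div (hsgh.trans h3.symm)]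
  have hb' := hz.div hw' hzw
  have hbu : HasVelocity 𝓘(ℝ, EG)
      (fun τ => 𝒢.mul (z τ) (𝒢.inv (𝒢.mul (𝒢.mul g h) (𝒢.inv (a τ)))))
      ⟨𝒢.unit (𝒢.target g), quotientVec X α ⟨𝒢.mul g h, 𝒢.target_mul g h hgh⟩⟩ := by
    rw [mk_quotientVec]; exact hb'
  have hr := hasVelocity_rightVec hbu (by
    filter_upwards [hzw, has] with τ h1 h3
    rw [𝒢.source_div h1, 𝒢.target_div (hsgh.trans h3.symm), 𝒢.target_mul g h hgh])
  have hsr : ∀ᶠ τ in 𝓝 0, 𝒢.source (𝒢.mul (𝒢.mul (z τ)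
      (𝒢.inv (𝒢.mul (𝒢.mul g h) (𝒢.inv (a τ))))) g) = 𝒢.source g := by
    filter_upwards [hzw, has] with τ h1 h3
    rw [𝒢.source_mul]
    rw [𝒢.source_div h1, 𝒢.target_div (hsgh.trans h3.symm), 𝒢.target_mul g h hgh]
  have hsb : 𝒢.tangentSource ⟨𝒢.unit (𝒢.source g), quotientVec X α ⟨h, hgh.symm⟩⟩ =
      ⟨𝒢.source g, 0⟩ := by
    rw [mk_quotientVec, tangentSource_quotientAt hα hXα]
    exact congrArg (fun x : M => (⟨x, 0⟩ : TangentBundle 𝓘(ℝ, EM) M)) hgh.symm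
  refine tangentBundle_mk_inj.1 ((tangentDiv_eq_add_leftVec
    (hr.source.unique_of_eventuallyEq (hasVelocity_const _) hsr) hsb).symm.trans ?_)
  rw [mk_quotientVec]
  refine Eq.trans ?_ (delta_zero_eq_zero_iff.1 (LinearMap.mem_ker.1 hX.2) g h hgh)
  refine (hr.div hb ?_).unique_of_eventuallyEq (hz.div hy hzy) ?_
  · filter_upwards [hsr, hyw, has] with τ h1 h2 h3
    rw [h1, 𝒢.source_div h2, 𝒢.target_div h3.symm, hgh]
  · filter_upwards [hzy, hyw, has, hzw] with τ h1 h2 h3 h4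
    set w := 𝒢.mul h (𝒢.inv (a τ)) with hwdef
    have h5 : 𝒢.mul (𝒢.mul g h) (𝒢.inv (a τ)) = 𝒢.mul g w := 𝒢.mul_div hgh h3.symm
    have h6 : 𝒢.source g = 𝒢.target w := by rw [hwdef, 𝒢.target_div h3.symm, hgh]
    have h7 : 𝒢.source w = 𝒢.source (𝒢.mul g w) := (𝒢.source_mul _ _ h6).symm
    rw [h5] at h4 ⊢
    have h8 := 𝒢.div_div_div h4 h7
    rw [𝒢.inv_div h7, 𝒢.mul_inv_cancel_right h6] at h8
    rw [h8]
    exact 𝒢.div_div_div (h1.trans h2) h2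

/-- The primitive at `x` is the average of `quotientVec` over `t⁻¹(x)`. Averaging
`rightVec_add_leftVec_quotientVec` over `h` in `t⁻¹(s(g))`, left invariance turns the term at `gh`
into the value of the primitive at `t(g)`. -/
theorem HaarData.mem_coboundaries_zero [FiniteDimensional ℝ EM] [T2Space M] (A : 𝒢.HaarData)
    (hX : X ∈ 𝒢.cocycles 0)
    (hα : α ∈ 𝒢.algebroidSections)
    (hXα : ∀ g, 𝒢.tangentSource (fieldAt X g) = ⟨𝒢.source g, 𝒢.anchor (𝒢.source g) α⟩) : X ∈ 𝒢.coboundaries 0 := by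
  have hcont := continuous_quotientVec hX hα hXα
  refine ⟨fun x => A.tangentAverage x fun h => quotientVec X α h, ⟨fun x => ?_, fun x => ?_⟩, ?_⟩
  · refine A.contMDiffAt_tangentAverage (U := univ) isOpen_univ trivial contMDiffOn_id
      𝒢.contMDiff_unit.contMDiffOn fun p _ y hy => ⟨fun z => quotientAt X α z.2, ?_, ?_⟩
    · exact (contMDiff_quotientAt hX hα hXα).contMDiffAt.comp (p, y) contMDiffAt_snd
    · exact Eventually.of_forall fun z hz => (mk_quotientVec X α ⟨z.2, hz⟩).symm
  · refine (A.map_tangentAverage (hcont x)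
      (mfderiv 𝓘(ℝ, EG) 𝓘(ℝ, EM) 𝒢.source (𝒢.unit x)).toLinearMap).trans ?_
    have h0 : ∀ h : {h : G // 𝒢.target h = x},
        mfderiv 𝓘(ℝ, EG) 𝓘(ℝ, EM) 𝒢.source (𝒢.unit x) (quotientVec X α h) = 0 := by
      intro h
      have h1 : 𝒢.tangentSource ⟨𝒢.unit x, quotientVec X α h⟩ = ⟨𝒢.target h.1, 0⟩ := by
        rw [mk_quotientVec, tangentSource_quotientAt hα hXα]
      exact tangentBundle_snd_eq h1
    exact (congrArg (A.tangentAverage x) (funext h0)).trans (A.tangentAverage_const x 0)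
  · funext s
    obtain ⟨g, rfl⟩ : ∃ g, s = single g := ⟨_, eq_single s⟩
    have h1 : Continuous fun h : {h : G // 𝒢.target h = 𝒢.source g} => 𝒢.mul g h.1 :=
      continuousOn_iff_continuous_domRestrict.1 (HaarData.continuousOn_mul_left g)
    have h2 : Continuous fun h : {h : G // 𝒢.target h = 𝒢.source g} => 𝒢.rightVec g
        (quotientVec X α ⟨𝒢.mul g h.1, 𝒢.target_mul g h.1 h.2.symm⟩) :=
      continuous_tangent_linearMap_comp _ ((hcont _).comp
        (h1.subtype_mk fun h => 𝒢.target_mul _ _ h.2.symm))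
    have hR : 𝒢.rightVec g (A.tangentAverage (𝒢.target g) fun h => quotientVec X α h) =
        A.tangentAverage (𝒢.source g) fun h => 𝒢.rightVec g
          (quotientVec X α ⟨𝒢.mul g h.1, 𝒢.target_mul g h.1 h.2.symm⟩) :=
      (A.map_tangentAverage (hcont _) _).trans
        (A.tangentAverage_translate (continuous_tangent_linearMap_comp _ (hcont _)))
    have hL : 𝒢.leftVec g (A.tangentAverage (𝒢.source g) fun h => quotientVec X α h) =
        A.tangentAverage (𝒢.source g) fun h => 𝒢.leftVec g (quotientVec X α h) :=
      A.map_tangentAverage (hcont _) _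
    refine (congrArg₂ (fun v w : TangentSpace 𝓘(ℝ, EG) g => v + w) hR hL).trans ?_
    refine (A.tangentAverage_add h2 (continuous_tangent_linearMap_comp _ (hcont _))).symm.trans ?_
    exact (congrArg (A.tangentAverage (𝒢.source g)) (funext fun h =>
      rightVec_add_leftVec_quotientVec hX hα hXα h.2.symm)).trans (A.tangentAverage_const _ _)

end Primitive

/-! ### Cocycles with prescribed base field -/

section Multiplicative

variable {V : SmoothVectorField EM M} {X : SmoothVectorField EG G}

theorem tangentSource_lift (hX : ∀ g,
      mfderiv 𝓘(ℝ, EG) 𝓘(ℝ, EM) 𝒢.source g (X g) = V (𝒢.source g) ∧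
      mfderiv 𝓘(ℝ, EG) 𝓘(ℝ, EM) 𝒢.target g (X g) = V (𝒢.target g)) (g : G) :
    𝒢.tangentSource ⟨g, X g⟩ = ⟨𝒢.source g, V (𝒢.source g)⟩ :=
  tangentBundle_mk_ext rfl (hX g).1

theorem tangentTarget_lift (hX : ∀ g,
      mfderiv 𝓘(ℝ, EG) 𝓘(ℝ, EM) 𝒢.source g (X g) = V (𝒢.source g) ∧
      mfderiv 𝓘(ℝ, EG) 𝓘(ℝ, EM) 𝒢.target g (X g) = V (𝒢.target g)) (g : G) :
    𝒢.tangentTarget ⟨g, X g⟩ = ⟨𝒢.target g, V (𝒢.target g)⟩ :=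
  tangentBundle_mk_ext rfl (hX g).2

theorem tangentSource_lift_mul (hX : ∀ g,
      mfderiv 𝓘(ℝ, EG) 𝓘(ℝ, EM) 𝒢.source g (X g) = V (𝒢.source g) ∧
      mfderiv 𝓘(ℝ, EG) 𝓘(ℝ, EM) 𝒢.target g (X g) = V (𝒢.target g)) {g h : G}
    (hgh : 𝒢.source g = 𝒢.target h) :
    𝒢.tangentSource ⟨𝒢.mul g h, X (𝒢.mul g h)⟩ = 𝒢.tangentSource ⟨h, X h⟩ := by
  rw [tangentSource_lift hX, tangentSource_lift hX, 𝒢.source_mul _ _ hgh]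

/-- The tangent vector `dm̄(X(gh), X(h))` at `g`. -/
def liftQuotient (𝒢 : LieGroupoid EM EG M G) (X : SmoothVectorField EG G) (g : G)
    (h : {h : G // 𝒢.target h = 𝒢.source g}) : TangentSpace 𝓘(ℝ, EG) g :=
  tangentCast 𝓘(ℝ, EG) (𝒢.mul_inv_cancel_right h.2.symm)
    (𝒢.tangentDiv ⟨𝒢.mul g h.1, X (𝒢.mul g h.1)⟩ ⟨h.1, X h.1⟩).2

theorem mk_liftQuotient (g : G) (h : {h : G // 𝒢.target h = 𝒢.source g}) :
    (⟨g, 𝒢.liftQuotient X g h⟩ : TangentBundle 𝓘(ℝ, EG) G) =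
      𝒢.tangentDiv ⟨𝒢.mul g h.1, X (𝒢.mul g h.1)⟩ ⟨h.1, X h.1⟩ :=
  mk_tangentCast (𝒢.mul_inv_cancel_right h.2.symm) _

/-- The division of `X(gh)` by `X(h)` depends smoothly on the composable pair `(g, h)`. -/
theorem exists_extend_liftQuotient (hX : ∀ g,
      mfderiv 𝓘(ℝ, EG) 𝓘(ℝ, EM) 𝒢.source g (X g) = V (𝒢.source g) ∧
      mfderiv 𝓘(ℝ, EG) 𝓘(ℝ, EM) 𝒢.target g (X g) = V (𝒢.target g)) {g h : G}
    (hgh : 𝒢.source g = 𝒢.target h) :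
    ∃ Φ : G × G → TangentBundle 𝓘(ℝ, EG) G,
      ContMDiffAt (𝓘(ℝ, EG).prod 𝓘(ℝ, EG)) 𝓘(ℝ, EG).tangent ∞ Φ (g, h) ∧
      ∀ᶠ z in 𝓝 (g, h), ∀ hz : 𝒢.target z.2 = 𝒢.source z.1,
        Φ z = ⟨z.1, 𝒢.liftQuotient X z.1 ⟨z.2, hz⟩⟩ := by
  obtain ⟨W, hW, hmem, F, hF, hFm⟩ := 𝒢.smooth_mul ⟨(g, h), hgh⟩
  have hFgh : F (g, h) = 𝒢.mul g h := hFm ⟨(g, h), hgh⟩ hmem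
  obtain ⟨U, hU, hUmem, T, hT, hTe⟩ :=
    𝒢.exists_extend_tangentDiv (p := 𝒢.mul g h) (q := h) (𝒢.source_mul _ _ hgh)
  have h1 : ContMDiffAt (𝓘(ℝ, EG).prod 𝓘(ℝ, EG))
      (𝓘(ℝ, EG).tangent.prod 𝓘(ℝ, EG).tangent) ∞
      (fun z : G × G => ((⟨F z, X (F z)⟩, ⟨z.2, X z.2⟩) :
        TangentBundle 𝓘(ℝ, EG) G × TangentBundle 𝓘(ℝ, EG) G)) (g, h) :=
    ((X.contMDiff (F (g, h))).comp (g, h) (hF.contMDiffAt (hW.mem_nhds hmem))).prodMk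
      ((X.contMDiff h).comp (g, h) contMDiffAt_snd)
  have hU' : U ∈ 𝓝 (((⟨F (g, h), X (F (g, h))⟩, ⟨h, X h⟩) :
      TangentBundle 𝓘(ℝ, EG) G × TangentBundle 𝓘(ℝ, EG) G)) :=
    hU.mem_nhds (hUmem _ hFgh rfl)
  refine ⟨fun z => T (⟨F z, X (F z)⟩, ⟨z.2, X z.2⟩), (hT.contMDiffAt hU').comp (g, h) h1, ?_⟩
  filter_upwards [h1.continuousAt.preimage_mem_nhds hU', hW.mem_nhds hmem] with z hzU hzW hz
  have h2 : F z = 𝒢.mul z.1 z.2 := hFm ⟨z, hz.symm⟩ hzW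
  rw [mk_liftQuotient]
  have h3 : (⟨F z, X (F z)⟩ : TangentBundle 𝓘(ℝ, EG) G) = ⟨𝒢.mul z.1 z.2, X (𝒢.mul z.1 z.2)⟩ :=
    congrArg (fun k => (⟨k, X k⟩ : TangentBundle 𝓘(ℝ, EG) G)) h2
  rw [← h3]
  refine hTe _ hzU ?_
  change 𝒢.tangentSource ⟨F z, X (F z)⟩ = 𝒢.tangentSource ⟨z.2, X z.2⟩
  rw [h3]
  exact tangentSource_lift_mul hX hz.symm

theorem continuous_liftQuotient (hX : ∀ g,
      mfderiv 𝓘(ℝ, EG) 𝓘(ℝ, EM) 𝒢.source g (X g) = V (𝒢.source g) ∧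
      mfderiv 𝓘(ℝ, EG) 𝓘(ℝ, EM) 𝒢.target g (X g) = V (𝒢.target g)) (g : G) :
    Continuous fun h => 𝒢.liftQuotient X g h := by
  refine continuous_of_continuous_mk (E := EG) (N := G) (p := g)
    (continuous_iff_continuousAt.2 fun h => ?_)
  obtain ⟨Φ, h1, h2⟩ := exists_extend_liftQuotient hX h.2.symm
  have h3 : ContinuousAt (fun k : {h : G // 𝒢.target h = 𝒢.source g} => (g, k.1)) h := by fun_prop
  refine (ContinuousAt.comp (f := fun k : {h : G // 𝒢.target h = 𝒢.source g} => (g, k.1))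
    (x := h) (g := Φ) h1.continuousAt h3).congr ?_
  filter_upwards [h3.eventually h2] with k hk using hk k.2

theorem tangentSource_liftQuotient (hX : ∀ g,
      mfderiv 𝓘(ℝ, EG) 𝓘(ℝ, EM) 𝒢.source g (X g) = V (𝒢.source g) ∧
      mfderiv 𝓘(ℝ, EG) 𝓘(ℝ, EM) 𝒢.target g (X g) = V (𝒢.target g)) (g : G)
    (h : {h : G // 𝒢.target h = 𝒢.source g}) :
    𝒢.tangentSource ⟨g, 𝒢.liftQuotient X g h⟩ = ⟨𝒢.source g, V (𝒢.source g)⟩ := by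
  rw [mk_liftQuotient, 𝒢.tangentSource_tangentDiv (tangentSource_lift_mul hX h.2.symm),
    tangentTarget_lift hX, h.2]

/-- The common divisor `X(h)` cancels, as in `((gk)h h⁻¹)(kh h⁻¹)⁻¹ = (gk)h (kh)⁻¹`. -/
theorem tangentDiv_liftQuotient (hX : ∀ g,
      mfderiv 𝓘(ℝ, EG) 𝓘(ℝ, EM) 𝒢.source g (X g) = V (𝒢.source g) ∧
      mfderiv 𝓘(ℝ, EG) 𝓘(ℝ, EM) 𝒢.target g (X g) = V (𝒢.target g)) {g k : G}
    (hgk : 𝒢.source g = 𝒢.target k) (h : {h : G // 𝒢.target h = 𝒢.source k}) :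
    𝒢.tangentDiv
        ⟨𝒢.mul g k, 𝒢.liftQuotient X (𝒢.mul g k) ⟨h.1, h.2.trans (𝒢.source_mul _ _ hgk).symm⟩⟩
        ⟨k, 𝒢.liftQuotient X k h⟩ =
      ⟨g, 𝒢.liftQuotient X g ⟨𝒢.mul k h.1, (𝒢.target_mul _ _ h.2.symm).trans hgk.symm⟩⟩ := by
  have h1 := 𝒢.source_mul _ _ hgk
  rw [mk_liftQuotient, mk_liftQuotient, mk_liftQuotient,
    𝒢.tangentDiv_tangentDiv_tangentDiv (tangentSource_lift_mul hX (h1.trans h.2.symm))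
      (tangentSource_lift_mul hX h.2.symm)]
  exact congrArg (fun q => 𝒢.tangentDiv ⟨q, X q⟩ ⟨𝒢.mul k h.1, X (𝒢.mul k h.1)⟩)
    (𝒢.mul_assoc _ _ _ hgk h.2.symm)

variable [T2Space M] (A : 𝒢.HaarData)

/-- The average of the vectors `dm̄(X(gh), X(h))` over `h`. -/
def HaarData.multiplicativeAverage (X : SmoothVectorField EG G) : 𝒢.StringField 0 := fun s =>
  A.tangentAverage (𝒢.source (s.1 0)) (𝒢.liftQuotient X (s.1 0))

theorem HaarData.fieldAt_multiplicativeAverage (g : G) :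
    fieldAt (A.multiplicativeAverage X) g =
      ⟨g, A.tangentAverage (𝒢.source g) (𝒢.liftQuotient X g)⟩ := rfl

/-- Each `dm̄(X(gh), X(h))` has `s`-projection `dt(X(h)) = V(t(h)) = V(s(g))`, by `t`-projectability
of `X`; a constant survives averaging. -/
theorem HaarData.tangentSource_multiplicativeAverage [FiniteDimensional ℝ EM] (hX : ∀ g,
      mfderiv 𝓘(ℝ, EG) 𝓘(ℝ, EM) 𝒢.source g (X g) = V (𝒢.source g) ∧
      mfderiv 𝓘(ℝ, EG) 𝓘(ℝ, EM) 𝒢.target g (X g) = V (𝒢.target g)) (g : G) :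
    𝒢.tangentSource (fieldAt (A.multiplicativeAverage X) g) =
      ⟨𝒢.source g, V (𝒢.source g)⟩ := by
  refine tangentBundle_mk_ext rfl ((A.map_tangentAverage (continuous_liftQuotient hX g)
    (mfderiv 𝓘(ℝ, EG) 𝓘(ℝ, EM) 𝒢.source g).toLinearMap).trans ?_)
  refine (congrArg (A.tangentAverage (𝒢.source g)) (funext fun h => ?_)).trans
    (A.tangentAverage_const (𝒢.source g) (V (𝒢.source g)))
  exact tangentBundle_mk_inj.1 (tangentSource_liftQuotient hX g h)

/-- Average `tangentDiv_liftQuotient` over `h`: the left side is linear in the two quotients, and on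
the right the substitution `h ↦ kh` is absorbed by left invariance. -/
theorem HaarData.multiplicativeAverage_mem_cocycles [FiniteDimensional ℝ EM] (hX : ∀ g,
      mfderiv 𝓘(ℝ, EG) 𝓘(ℝ, EM) 𝒢.source g (X g) = V (𝒢.source g) ∧
      mfderiv 𝓘(ℝ, EG) 𝓘(ℝ, EM) 𝒢.target g (X g) = V (𝒢.target g)) :
    A.multiplicativeAverage X ∈ 𝒢.cocycles 0 := by
  refine ⟨mem_cochains_zero (fun g => ?_) fun g g' h => ?_, LinearMap.mem_ker.2
    (delta_zero_eq_zero_iff.2 fun g k hgk => ?_)⟩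
  · exact A.contMDiffAt_tangentAverage (Φ := fun g => 𝒢.liftQuotient X g) (U := univ) isOpen_univ
      trivial 𝒢.contMDiff_source.contMDiffOn contMDiffOn_id
      fun p _ y hy => exists_extend_liftQuotient hX hy.symm
  · rw [A.tangentSource_multiplicativeAverage hX, A.tangentSource_multiplicativeAverage hX, h]
  · have hs := 𝒢.source_mul _ _ hgk
    set Ψ : {h : G // 𝒢.target h = 𝒢.source k} → TangentSpace 𝓘(ℝ, EG) (𝒢.mul g k) := fun h =>
      𝒢.liftQuotient X (𝒢.mul g k) ⟨h.1, h.2.trans hs.symm⟩ with hΨ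
    have hΨc : Continuous Ψ := (continuous_liftQuotient hX (𝒢.mul g k)).comp
      (continuous_subtype_val.subtype_mk _)
    have h1 : A.tangentAverage (𝒢.source (𝒢.mul g k)) (𝒢.liftQuotient X (𝒢.mul g k)) =
        A.tangentAverage (𝒢.source k) Ψ := A.average_congr (E' := EG) hs fun h => rfl
    have h2 : Continuous fun h : {h : G // 𝒢.target h = 𝒢.target k} =>
        𝒢.liftQuotient X g ⟨h.1, h.2.trans hgk.symm⟩ := (continuous_liftQuotient hX g).comp
      (continuous_subtype_val.subtype_mk _)
    have h3 : A.tangentAverage (𝒢.source g) (𝒢.liftQuotient X g) =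
        A.tangentAverage (𝒢.target k) fun h => 𝒢.liftQuotient X g ⟨h.1, h.2.trans hgk.symm⟩ :=
      A.average_congr (E' := EG) hgk fun h => rfl
    rw [A.fieldAt_multiplicativeAverage, A.fieldAt_multiplicativeAverage,
      A.fieldAt_multiplicativeAverage, h1, h3, A.tangentAverage_translate h2]
    refine tangentBundle_mk_ext (𝒢.mul_inv_cancel_right hgk) ?_
    refine (A.map_tangentAverage_prod hΨc (continuous_liftQuotient hX k)
      (𝒢.divDeriv (𝒢.mul g k) k).toLinearMap).trans ?_
    exact A.average_congr (E' := EG) rfl fun h =>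
      tangentBundle_snd_eq (tangentDiv_liftQuotient hX hgk h)

end Multiplicative

/-! ### Cohomology in degree one -/

/-- The class of the base field of a cocycle of degree one. -/
def baseClass : 𝒢.cocycles 0 →ₗ[ℝ] 𝒢.invariantNormalSections :=
  ((𝒢.anchorImage.mkQ ∘ₗ baseField) ∘ₗ Submodule.inclusion inf_le_left).codRestrict _ fun z =>
    Submodule.mem_map_of_mem (baseField_mem_liftableFields (LinearMap.mem_ker.1 z.2.2))

theorem IsProper.exists_cohomologySucc_zero_equiv [FiniteDimensional ℝ EM] [T2Space M]
    [SecondCountableTopology M] (h𝒢 : 𝒢.IsProper) :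
    ∃ e : 𝒢.cohomologySucc 0 ≃ₗ[ℝ] 𝒢.invariantNormalSections,
      ∀ z : 𝒢.cocycles 0, ∃ V : SmoothVectorField EM M, 𝒢.IsBaseField z V ∧
        (e (Submodule.Quotient.mk z) : 𝒢.normalSections) = Submodule.Quotient.mk V := by
  obtain ⟨A⟩ := h𝒢.nonempty_haarData
  -- Coboundaries are the cocycles with base field in the image of the anchor: `ds(δα) = ρ(α)` gives
  -- one inclusion, the averaged primitive the other.
  have hker : (𝒢.coboundaries 0).submoduleOf (𝒢.cocycles 0) =
      LinearMap.ker (baseClass (𝒢 := 𝒢)) := by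
    ext z
    have h1 : z ∈ LinearMap.ker (baseClass (𝒢 := 𝒢)) ↔
        baseField ⟨z.1, z.2.1⟩ ∈ 𝒢.anchorImage := by
      rw [LinearMap.mem_ker, Subtype.ext_iff]
      exact Submodule.Quotient.mk_eq_zero _
    rw [h1]
    constructor
    · rintro ⟨α, hα, hαz⟩
      refine ⟨α, hα, fun x => ?_⟩
      refine tangentBundle_mk_inj.1 ?_
      rw [mk_baseField]
      change 𝒢.tangentSource (fieldAt z.1 (𝒢.unit x)) = _
      rw [show z.1 = 𝒢.deltaZero α from hαz.symm, tangentSource_fieldAt_deltaZero hα,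
        𝒢.source_unit]
    · rintro ⟨α, hα, hαz⟩
      refine A.mem_coboundaries_zero z.2 hα fun g => ?_
      exact (tangentSource_fieldAt ⟨z.1, z.2.1⟩ g).trans (congrArg _ (hαz (𝒢.source g)))
  -- Averaging a lift keeps the base field `V` itself, not merely its class.
  have hsurj : Function.Surjective (baseClass (𝒢 := 𝒢)) := by
    rintro ⟨_, V, ⟨X, hX⟩, rfl⟩
    refine ⟨⟨A.multiplicativeAverage X, A.multiplicativeAverage_mem_cocycles hX⟩, ?_⟩
    refine Subtype.ext (congrArg 𝒢.anchorImage.mkQ ?_)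
    exact (baseField_eq_iff _ V).2 (A.tangentSource_multiplicativeAverage hX)
  refine ⟨(Submodule.quotEquivOfEq _ _ hker).trans (baseClass.quotKerEquivOfSurjective hsurj),
    fun z => ⟨baseField ⟨z.1, z.2.1⟩, isBaseField_baseField ⟨z.1, z.2.1⟩, rfl⟩⟩

end LieGroupoid

end

/-- Deformation cohomology of a proper Lie groupoid: in degree `0` it is `Γ(𝔦)^inv`, as a subspace
of `Γ(A)`; in degree `1` it is `Γ(ν)^inv`, by sending the class of a cocycle (a multiplicative vector
field) to the class of its base field; and in degrees `n + 2 ≥ 2` it vanishes. -/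
theorem mainTheorem1 {EM EG M G : Type*}
    [NormedAddCommGroup EM] [NormedSpace ℝ EM] [FiniteDimensional ℝ EM]
    [NormedAddCommGroup EG] [NormedSpace ℝ EG] [FiniteDimensional ℝ EG]
    [TopologicalSpace M] [ChartedSpace EM M] [IsManifold 𝓘(ℝ, EM) ∞ M]
    [T2Space M] [SecondCountableTopology M]
    [TopologicalSpace G] [ChartedSpace EG G] [IsManifold 𝓘(ℝ, EG) ∞ G]
    (𝒢 : LieGroupoid EM EG M G) (hproper : 𝒢.IsProper) :
    (∃ e : 𝒢.cohomologyZero ≃ₗ[ℝ] 𝒢.invariantIsotropySections,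
      ∀ z : 𝒢.cocyclesZero, (e z : 𝒢.UnitField) = z) ∧
    (∃ e : 𝒢.cohomologySucc 0 ≃ₗ[ℝ] 𝒢.invariantNormalSections,
      ∀ z : 𝒢.cocycles 0, ∃ V : SmoothVectorField EM M, 𝒢.IsBaseField z V ∧
        (e (Submodule.Quotient.mk z) : 𝒢.normalSections) = Submodule.Quotient.mk V) ∧
    (∀ n : ℕ, Subsingleton (𝒢.cohomologySucc (n + 1))) :=
  ⟨⟨LinearEquiv.ofEq _ _ LieGroupoid.cocyclesZero_eq, fun _ => rfl⟩, hproper.exists_cohomologySucc_zero_equiv,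
    hproper.subsingleton_cohomologySucc⟩
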